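/- Let $K$ be a field of characteristic $0$ and consider a Frobenius manifold $(M,\nabla^z,e,E,r,\eta)$ over $K$ of finite dimension in the formal neighbourhood of a basepoint $p$, in flat coordinates $(u^a)$ vanishing at $p$. Thus $\eta=(\eta_{ab})$ is a constant nondegenerate symmetric matrix with inverse $(\eta^{ab})$; $\partial_a\circ\partial_b=A_{ab}^c\partial_c$ with $A_{ab}^c\in K[[u]]$ is a commutative associative product satisfying $\partial_aA_{bc}^d=\partial_bA_{ac}^d$ and $\eta(X\circ Y,Z)=\eta(X,Y\circ Z)$; $e=e^a\partial_a$ is a constant vector field which is the identity for $\circ$; $E$ is a vector field with affine-linear components such that $[E,X\circ Y]=[E,X]\circ Y+X\circ[E,Y]+X\circ Y$ and $\mathcal L_E\eta=(2-r)\eta$; $\nabla^z=\nabla+zA$ on the cotangent bundle, where $\nabla$ is the Levi-Civita connection of $\eta$ and $A_a=((A_a)_b^c)=(A_{ab}^c)$. Endomorphisms of $T^*M$ are matrices $F_a^b$ acting by $F(du^b)=F_a^b\,du^a$. Put $\mu=1-\frac r2+\nabla_E-\mathcal L_E$, $\mathcal U=A_E$ and $\delta_z=\partial_z+z^{-1}(\mu+\frac12)+\mathcal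 U$. Let $\Theta(z)=I+\sum_{n\ge0}z^{n+1}\Theta_n$ be a symmetric fundamental solution: $\partial_a\Theta(z)=z\,\Theta(z)A_a$; $\Theta^*(-z)\Theta(z)=I$, where $*$ is the $\eta$-adjoint; and, writing $\tilde\delta_z=\Theta(z)\,\delta_z\,\Theta(z)^{-1}=\partial_z+z^{-1}\sum_kz^kR_k$ and $\mu_s$ for the semisimple part of $\mu$, there is a sign $\varepsilon=\pm1$ with $[\mu_s,R_k]=\varepsilon kR_k$ for all $k$. Assume $e^a(\Theta_0)_a^b=u^b$ for all $b$. On the jet-space of $M$, with coordinates $u^a_n$ ($n\ge0$, $u^a_0=u^a$), let $\mathcal P$ be the jet $t\mapsto p+te$ and let $\widehat{\mathcal O}=K[[u^a_n-\delta_{n,1}e^a]]$ be the ring of formal functions at $\mathcal P$. Let $\partial=\sum u^a_{n+1}\,\partial/\partial u^a_n$, $\mathcal Q=\sum n\,u^a_n\,\partial/\partial u^a_n$, $\mathcal X=u_1^aA_a$, and $$\sigma_a(z)=\sum_{k\ge0}z^k\sigma_{k,a}=\sum_{n\ge0}\bigl((\partial+z\mathcal X)^n\mathcal X\bigr)_a^b\,\frac{\partial}{\partial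 u^b_n},\qquad \sum_{k\ge0}z^k\partial_{k,a}=z^{-1}\sum_{n\ge0}\bigl(\partial^{n+1}\Theta(z)\bigr)_a^b\,\frac{\partial}{\partial u^b_n}=\Theta(z)_a^b\,\sigma_b(z).$$ Let $\mathbf t(z)=\sum_{k\in\mathbb Z}z^{-k-1}\mathbf t_k$, $\mathbf t_k^a\in\widehat{\mathcal O}$, satisfy $\mathcal Q\,\mathbf t(z)=-\mathbf t(z)$ and $\sum_jy^j\partial_{j,a}\mathbf t^b(z)=\sum_{l\ge0}y^lz^{-l-1}\bigl(\Theta(y)\Theta(z)^{-1}\bigr)_a^b$, and let $\mathcal F_0\in\widehat{\mathcal O}$ satisfy $\partial_{k,a}\mathcal F_0=(-1)^k\eta_{ab}\mathbf t^b_{-k-1}$ for $k\ge0$ and $\mathcal Q\mathcal F_0=-2\mathcal F_0$. Let $Z_0=e^{\mathcal F_0/\hbar}$, $\Phi_a(z)=\hbar\sum_{k\ge0}z^k\partial_{k,a}+\sum_{k\ge0}(-z)^{-k-1}\eta_{ab}\mathbf t^b_k$ and, for an integer $k\ge-1$, let $L_k$ be the Eguchi–Hori–Xiong Virasoro operator $$L_k=\tfrac1{2\hbar}\operatorname{Res}_{z=0}:\!\eta\bigl(\Phi(-z),z\tilde\delta_z^{k+1}\Phi(z)\bigr)\!:\;-\tfrac14\delta_{k,0}\operatorname{Tr}\bigl(\mu^2-\tfrac14\bigr),$$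 where the normal ordering puts the vector fields $\partial_{k,a}$ to the right and $\eta(\alpha,\beta)=\eta^{ab}\alpha_a\beta_b$ on covectors. Then $$L_k\circ Z_0=Z_0\circ\bigl(\hbar\,\Delta_k+\mathcal L_k+\mathcal H_k\bigr)$$ as operators on formal series $\sum_{i\in\mathbb Z}\hbar^if_i$ with $f_i\in\widehat{\mathcal O}$ and $f_i=0$ for $i\gg0$. Here, with $\mathbf s^a(z)=\mathbf t^b(z)\Theta(z)_b^a$, $$\mathcal L_k=\operatorname{Res}_{z=0}\bigl\langle\mathbf s(z),z\delta_z^{k+1}\sigma(z)\bigr\rangle,\qquad \Delta_k=\tfrac12\operatorname{Res}_{z=0}\eta\bigl(\sigma(-z),z\delta_z^{k+1}\sigma(z)\bigr),$$ $$\mathcal H_k=-\tfrac14\sum_{\ell=0}^k\operatorname{Tr}\bigl((\mu-\tfrac12)\,\mathcal U^\ell\,(\mu+\tfrac12)\,\mathcal U^{k-\ell}\bigr).$$ In $\Delta_k$ the products of vector fields are bilinear over functions and are compositions on the frame $\partial_{k,a}$; equivalently, $\sigma_a(-z)$ acts on the covector field $z\delta_z^{k+1}\sigma(z)f$ by the Dubrovin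 connection, $\nabla^z_{\sigma_a(-z)}=\sigma_a(-z)+zA_{\sigma_a(-z)}$ with $A_{\sigma_a(-z)}=\mathcal X_a^dA_d$. -/

import Mathlib

noncomputable section

namespace JetFrobenius

open MvPowerSeries

/-! ## Frobenius manifolds near a basepoint

The basepoint is the origin of the flat coordinates `u^a`, `a : ι`.  Functions near the basepoint are
formal power series in the `u^a`.  An endomorphism `F` of the cotangent bundle is the matrix
`F a b = F_a^b` with `F (du^b) = ∑ a, F_a^b du^a`; composition of endomorphisms is the product of
matrices and covector fields are columns. -/

/-- Formal functions on the manifold at the basepoint, in flat coordinates. -/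
abbrev Fn (K ι : Type*) [Field K] := MvPowerSeries ι K

/-- The coefficient of `z^n` in a power series in `z` of endomorphisms of the cotangent bundle, written
as a matrix of power series in `z`. -/
def zCoeff {K ι : Type*} [Field K] (n : ℕ) (Θ : Matrix ι ι (PowerSeries (Fn K ι))) :
    Matrix ι ι (Fn K ι) :=
  Θ.map (PowerSeries.coeff n)

/-- The `b`-th component `E^b = ∑ a, lin a b * u^a + const b` of a linear vector field. -/
def linearField {K ι : Type*} [Field K] [Fintype ι] (lin : Matrix ι ι K) (const : ι → K) (b : ι) :
    Fn K ι :=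
  ∑ a, lin a b • (X a : Fn K ι) + C (const b)

/-- A Frobenius manifold `(M, ∇^z, e, E, r, η)` in the formal neighbourhood of a basepoint, in flat
coordinates. The Levi-Civita connection `∇` of `η` is the trivial one in these coordinates, so `η`
and `e` have constant components, and `∇^z = ∇ + z A` with `∂_a ∘ ∂_b = ∑ c, A_{ab}^c ∂_c`. -/
structure FrobeniusManifold (K ι : Type*) [Field K] [Fintype ι] [DecidableEq ι] where
  /-- `A a b c` is `A_{ab}^c`, so `A a` is the endomorphism `A_{∂_a}` of the cotangent bundle. -/
  A : ι → Matrix ι ι (Fn K ι)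
  /-- The components of the flat unit field `e = ∑ a, e^a ∂_a`. -/
  e : ι → K
  /-- `eulerLin a b = ∂_a E^b`, where `E` is the Euler vector field. -/
  eulerLin : Matrix ι ι K
  /-- The components of `E` at the basepoint. -/
  eulerConst : ι → K
  /-- The charge. -/
  r : K
  /-- The flat metric `η_{ab}` on the tangent bundle. -/
  η : Matrix ι ι K
  comm : ∀ a b c, A a b c = A b a c
  assoc : ∀ a b c f, ∑ d, A a b d * A d c f = ∑ d, A b c d * A a d f
  unit : ∀ b c, ∑ a, e a • A a b c = if b = c then 1 else 0
  /-- `[∇_X, A_Y] - [∇_Y, A_X] = A_{[X,Y]}`. -/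
  closed : ∀ a b c d, pderiv K a (A b c d) = pderiv K b (A a c d)
  /-- `[E, X ∘ Y] = [E, X] ∘ Y + X ∘ [E, Y] + X ∘ Y`. -/
  euler : ∀ a b c,
    ∑ d, linearField eulerLin eulerConst d * pderiv K d (A a b c) - ∑ d, eulerLin d c • A a b d
      = -∑ d, eulerLin a d • A d b c - ∑ d, eulerLin b d • A a d c + A a b c
  η_symm : ∀ a b, η a b = η b a
  η_nondeg : IsUnit η.det
  /-- `η(X ∘ Y, Z) = η(X, Y ∘ Z)`. -/
  η_mul : ∀ a b c, ∑ d, η d c • A a b d = ∑ d, η a d • A b c d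
  /-- `L_E η = (2 - r) η`. -/
  η_euler : ∀ a b, ∑ d, eulerLin a d * η d b + ∑ d, eulerLin b d * η a d = (2 - r) * η a b

namespace FrobeniusManifold

variable {K ι : Type*} [Field K] [Fintype ι] [DecidableEq ι] (M : FrobeniusManifold K ι)

/-- The Euler vector field. -/
def E (b : ι) : Fn K ι := linearField M.eulerLin M.eulerConst b

/-- `μ = 1 - r/2 + ∇_E - L_E` on the cotangent bundle. -/
def μ : Matrix ι ι K := (1 - M.r / 2) • (1 : Matrix ι ι K) - M.eulerLin

/-- `U = A_E`. -/
def U : Matrix ι ι (Fn K ι) := ∑ a, M.E a • M.A a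

/-! ### Fundamental solutions -/

/-- `Θ(0) = I` and `∇ ∘ Θ(z) = Θ(z) ∘ ∇^z`, that is, `∂_a Θ(z) = z Θ(z) A_a`. -/
def IsFundamentalSolution (Θ : Matrix ι ι (PowerSeries (Fn K ι))) : Prop :=
  zCoeff 0 Θ = 1 ∧
    ∀ (a : ι) (n : ℕ), (zCoeff (n + 1) Θ).map (pderiv K a) = zCoeff n Θ * M.A a

/-- The flat coordinates determined by `Θ(z) = I + z 𝓜 + ...`, namely `𝓜_e^b`, are the `u^b`; in
particular they vanish at the basepoint. -/
def IsNormalized (Θ : Matrix ι ι (PowerSeries (Fn K ι))) : Prop :=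
  ∀ b, ∑ a, M.e a • zCoeff 1 Θ a b = X b

/-- `z (μ + 1/2) z⁻¹ + z U = (μ + 1/2) + z U`, so that `δ_z = ∂_z + z⁻¹ ((μ + 1/2) + z U)`. -/
def deltaSymbol : Matrix ι ι (PowerSeries (Fn K ι)) :=
  (M.μ + (1 / 2 : K) • 1).map (fun x => PowerSeries.C (C x)) +
    (PowerSeries.X : PowerSeries (Fn K ι)) • M.U.map PowerSeries.C

/-- `R(z)`, defined by `Θ(z) ∘ δ_z ∘ Θ(z)⁻¹ = ∂_z + z⁻¹ R(z)`. -/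
def R (Θ : Matrix ι ι (PowerSeries (Fn K ι))) : Matrix ι ι (PowerSeries (Fn K ι)) :=
  Θ * M.deltaSymbol * Θ⁻¹ +
    (PowerSeries.X : PowerSeries (Fn K ι)) • (Θ * Θ⁻¹.map (PowerSeries.derivative (Fn K ι)))

/-- `Θ` is conformal: `[μ_s, R_k] = ε k R_k` for all `k`, where `μ_s` is the semisimple part of `μ`.
Both choices of the sign `ε = ±1` (the same for all `k`) are allowed. -/
def IsConformal (Θ : Matrix ι ι (PowerSeries (Fn K ι))) : Prop :=
  ∃ μs μn : Matrix ι ι K,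
    M.μ = μs + μn ∧ μs * μn = μn * μs ∧ Module.End.IsSemisimple (Matrix.toLin' μs) ∧ IsNilpotent μn ∧
    ∃ ε : K, (ε = 1 ∨ ε = -1) ∧ ∀ k : ℕ,
      μs.map C * zCoeff k (M.R Θ) - zCoeff k (M.R Θ) * μs.map C
        = (ε * k) • zCoeff k (M.R Θ)

/-- The adjoint `Θ^+(z) = Θ^*(-z)`, where `Θ^*` is the adjoint for the metric on the cotangent
bundle induced by `η`. -/
def adjoint (Θ : Matrix ι ι (PowerSeries (Fn K ι))) : Matrix ι ι (PowerSeries (Fn K ι)) :=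
  M.η.map (fun x => PowerSeries.C (C x)) * (Θ.map PowerSeries.evalNegHom).transpose *
    (M.η⁻¹).map (fun x => PowerSeries.C (C x))

/-- A symmetric fundamental solution: conformal, with `Θ^+(z) Θ(z) = I`. -/
def IsSymmetricFundamentalSolution (Θ : Matrix ι ι (PowerSeries (Fn K ι))) : Prop :=
  M.IsFundamentalSolution Θ ∧ M.IsConformal Θ ∧ M.adjoint Θ * Θ = 1

end FrobeniusManifold

/-! ## The jet-space -/

/-- Formal functions on the jet-space at the basepoint `t ↦ p + t e`. The variable `(n, a)` is
`u^a_n - δ_{n,1} e^a`. -/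
abbrev JetFn (K ι : Type*) [Field K] := MvPowerSeries (ℕ × ι) K

section Jets

variable {K ι : Type*} [Field K]

/-- The sum of a family of power series, coefficient by coefficient. -/
def formalSum {J : Type*} (F : J → JetFn K ι) : JetFn K ι :=
  fun m => ∑ᶠ j, coeff m (F j)

/-- The action on functions of the vector field `∑ p, v p ∂/∂u_p` on the jet-space. -/
def vectorField (v : ℕ × ι → JetFn K ι) (f : JetFn K ι) : JetFn K ι :=
  formalSum fun p => v p * pderiv K p f

variable [Fintype ι]

/-- Pull-back of functions along the projection from the jet-space. -/
def pullback : Fn K ι →ₐ[K] JetFn K ι := rename fun a : ι => ((0, a) : ℕ × ι)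

/-- For a sequence `f` of covector-valued objects (the coefficients of `∑ m, z^m f_m`), the coefficients
of `(∂_z + z⁻¹ ∑ j, z^j R_j) f`. -/
def zConnection {V : Type*} [AddCommGroup V] [Module (JetFn K ι) V]
    (R : ℕ → Matrix ι ι (JetFn K ι)) (f : ℤ → ι → V) : ℤ → ι → V :=
  fun m a => (m + 1) • f (m + 1) a + ∑ᶠ j : ℕ, ∑ b, R j a b • f (m + 1 - j) b

/-- Formal series `∑ i, ħ^i f_i` in `ħ` and `ħ⁻¹`. -/
abbrev HSeries (K ι : Type*) [Field K] := ℤ → JetFn K ι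

/-- Multiplication by `Z = exp(F / ħ)`; meaningful on series with finitely many positive powers
of `ħ`. -/
def expMul (F : JetFn K ι) (f : HSeries K ι) : HSeries K ι :=
  fun i => ∑ᶠ n : ℕ, ((n.factorial : K)⁻¹) • (F ^ n * f (i + n))

/-- `s(z) = Θ^*(z) t(z) = ∑ k, z^{-k-1} s_k`, where `t(z) = ∑ k, z^{-k-1} t_k` and `Θ^*(z)` is the
endomorphism of the tangent bundle dual to `Θ(z)`. -/
def sField (Θ : Matrix ι ι (PowerSeries (Fn K ι))) (t : ℤ → ι → JetFn K ι) (k : ℤ) (a : ι) :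
    JetFn K ι :=
  formalSum fun j : ℕ => ∑ b, t (k + j) b * pullback (zCoeff j Θ b a)

end Jets

namespace FrobeniusManifold

variable {K ι : Type*} [Field K] [Fintype ι] [DecidableEq ι] (M : FrobeniusManifold K ι)

/-- The jet coordinate `u^a_n`. -/
def u (n : ℕ) (a : ι) : JetFn K ι := X (n, a) + C (if n = 1 then M.e a else 0)

/-- The vector field `∂ = ∑ u^a_{n+1} ∂/∂u^a_n`. -/
def dt : JetFn K ι → JetFn K ι := vectorField fun p => M.u (p.1 + 1) p.2

/-- The dilaton vector field `∑ n u^a_n ∂/∂u^a_n`. -/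
def dilaton : JetFn K ι → JetFn K ι := vectorField fun p => (p.1 : JetFn K ι) * M.u p.1 p.2

/-- `𝓧 = A_∂ = ∑ a, u^a_1 A_a`. -/
def 𝓧 : Matrix ι ι (JetFn K ι) := ∑ a, M.u 1 a • (M.A a).map pullback

/-- `faaDiBruno n j` is the coefficient of `z^j` in `P_{n+1}(z) = (∂ + z 𝓧)^n 𝓧`. -/
def faaDiBruno : ℕ → ℕ → Matrix ι ι (JetFn K ι)
  | 0, 0 => M.𝓧
  | 0, _ + 1 => 0
  | n + 1, 0 => (faaDiBruno n 0).map M.dt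
  | n + 1, j + 1 => (faaDiBruno n (j + 1)).map M.dt + M.𝓧 * faaDiBruno n j

/-- The vector field `σ_{k,a}`, where `σ_a(z) = ∑ k, z^k σ_{k,a} = ∑ n b, P_{n+1}(z)_a^b ∂/∂u^b_n`;
it is zero for `k < 0`. -/
def σ (k : ℤ) (a : ι) : JetFn K ι → JetFn K ι :=
  if 0 ≤ k then vectorField fun p => M.faaDiBruno p.1 k.toNat a p.2 else 0

/-- The vector field `∂_{k,a}` of the affine structure, where
`∂_a(z) = ∑ k, z^k ∂_{k,a} = z⁻¹ ∑ n b, (∂^{n+1} Θ(z))_a^b ∂/∂u^b_n = Θ(z) σ(z)`. -/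
def flatField (Θ : Matrix ι ι (PowerSeries (Fn K ι))) (k : ℕ) (a : ι) : JetFn K ι → JetFn K ι :=
  vectorField fun p => M.dt^[p.1 + 1] (pullback (zCoeff (k + 1) Θ a p.2))

/-- `t(z) = ∑ k, z^{-k-1} t_k` is the generating function of the flat coordinates:
`𝒬 t(z) = -t(z)` and `∂(y) t(z) = ∑ l ≥ 0, y^l z^{-l-1} Θ(y) Θ(z)⁻¹`. -/
def IsFlatGeneratingFunction (Θ : Matrix ι ι (PowerSeries (Fn K ι))) (t : ℤ → ι → JetFn K ι) :
    Prop :=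
  (∀ k a, M.dilaton (t k a) = -t k a) ∧
  ∀ (j : ℕ) (a : ι) (k : ℤ) (b : ι),
    M.flatField Θ j a (t k b) =
      pullback ((∑ l ∈ Finset.range (j + 1),
        if k ≤ l then zCoeff (j - l) Θ * zCoeff (l - k).toNat Θ⁻¹ else 0) a b)

/-- The genus `0` potential: `∂_{k,a} F₀ = (-1)^k ∑ b, η_{ab} t_{-k-1}^b` and `𝒬 F₀ = -2 F₀`. -/
def IsPotential (Θ : Matrix ι ι (PowerSeries (Fn K ι))) (t : ℤ → ι → JetFn K ι)
    (F₀ : JetFn K ι) : Prop :=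
  (∀ (k : ℕ) (a : ι), M.flatField Θ k a F₀ = ((-1 : K) ^ k) • ∑ b, M.η a b • t (-k - 1) b) ∧
  M.dilaton F₀ = (-2 : K) • F₀

/-- The coefficients of `(μ + 1/2) + z U`, pulled back to the jet-space. -/
def deltaCoeff (j : ℕ) : Matrix ι ι (JetFn K ι) := (zCoeff j M.deltaSymbol).map pullback

/-- The coefficients of `R(z)`, pulled back to the jet-space. -/
def deltaTildeCoeff (Θ : Matrix ι ι (PowerSeries (Fn K ι))) (j : ℕ) : Matrix ι ι (JetFn K ι) :=
  (zCoeff j (M.R Θ)).map pullback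

/-! ### The Virasoro operators on the large phase space -/

/-- The coefficient of `z^m` in the free field
`Φ_a(z) = ħ ∑ k ≥ 0, z^k ∂_{k,a} + ∑ k ≥ 0, (-z)^{-k-1} ∑ b, η_{ab} t_k^b`. -/
def freeField (Θ : Matrix ι ι (PowerSeries (Fn K ι))) (t : ℤ → ι → JetFn K ι) (m : ℤ) (a : ι) :
    HSeries K ι → HSeries K ι :=
  if 0 ≤ m then fun f i => M.flatField Θ m.toNat a (f (i - 1))
  else fun f i => (((-1 : K) ^ m) • ∑ b, M.η a b • t (-m - 1) b) * f i

/-- The normal ordered product `:Φ_{m,a} Φ_{n,b}:`, with derivatives to the right. -/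
def normalOrder (Θ : Matrix ι ι (PowerSeries (Fn K ι))) (t : ℤ → ι → JetFn K ι)
    (m : ℤ) (a : ι) (n : ℤ) (b : ι) : HSeries K ι → HSeries K ι :=
  if 0 ≤ m ∧ n < 0 then M.freeField Θ t n b ∘ M.freeField Θ t m a
  else M.freeField Θ t m a ∘ M.freeField Θ t n b

/-- `Res_{z=0} :η(Φ(-z), z δ̃_z^{k+1} Φ(z)):`. -/
def residueQuadratic (Θ : Matrix ι ι (PowerSeries (Fn K ι))) (t : ℤ → ι → JetFn K ι) (k : ℤ)
    (f : HSeries K ι) : HSeries K ι :=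
  fun i => formalSum fun m : ℤ => ((-1 : K) ^ m) • ∑ a, ∑ b, M.η⁻¹ a b •
    (zConnection (M.deltaTildeCoeff Θ))^[(k + 1).toNat]
      (fun n c => M.normalOrder Θ t m a n c) (-2 - m) b f i

/-- The Virasoro operator
`L_k = (2ħ)⁻¹ Res_{z=0} :η(Φ(-z), z δ̃_z^{k+1} Φ(z)): - (1/4) δ_{k,0} Tr(μ² - 1/4)`. -/
def virasoro (Θ : Matrix ι ι (PowerSeries (Fn K ι))) (t : ℤ → ι → JetFn K ι) (k : ℤ)
    (f : HSeries K ι) : HSeries K ι :=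
  fun i => (1 / 2 : K) • M.residueQuadratic Θ t k f (i + 1) -
    (if k = 0 then (1 / 4 : K) * (M.μ ^ 2 - (1 / 4 : K) • 1).trace else 0) • f i

/-! ### The intrinsic operators on the jet-space -/

/-- The coefficient of `z^m` in `δ_z^{k+1} σ_a(z)`. -/
def deltaSigma (k m : ℤ) (a : ι) : JetFn K ι → JetFn K ι :=
  (zConnection M.deltaCoeff)^[(k + 1).toNat] (fun n c => M.σ n c) m a

/-- The vector field `𝓛_k = Res_{z=0} ⟨s(z), z δ_z^{k+1} σ(z)⟩`. -/
def virasoroField (Θ : Matrix ι ι (PowerSeries (Fn K ι))) (t : ℤ → ι → JetFn K ι) (k : ℤ)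
    (f : JetFn K ι) : JetFn K ι :=
  formalSum fun m : ℤ => ∑ a, sField Θ t m a * M.deltaSigma k (m - 1) a f

/-- The endomorphism `A_{σ_a(z)} = ∑ d, 𝓧_a^d A_d`, which does not depend on `z`. -/
def 𝓦 (a : ι) : Matrix ι ι (JetFn K ι) := ∑ d, M.𝓧 a d • (M.A d).map pullback

/-- For a covector field `g(z) = ∑ n, z^n g_n` on the jet-space with coefficients in Laurent series,
the coefficient of `z⁻¹` in the `b`-th component of `∇^z_{σ_a(-z)} g(z)`. Here
`∇^z_{σ_a(-z)} = σ_a(-z) + z A_{σ_a(-z)}` is the covariant derivative for the Dubrovin connection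
pulled back to the jet-space. -/
def residueCovariant (a b : ι) (g : ℤ → ι → JetFn K ι) : JetFn K ι :=
  formalSum (fun m : ℕ => ((-1 : K) ^ m) • M.σ m a (g (-1 - m) b)) + ∑ c, M.𝓦 a b c * g (-2) c

/-- The second-order operator `Δ_k = (1/2) Res_{z=0} η(σ(-z), z δ_z^{k+1} σ(z))`. The left factor
acts on the covector field `z δ_z^{k+1} σ(z) f` by the Dubrovin connection, see
`residueCovariant`. Equivalently, the product of two vector fields in `Δ_k` is bilinear over functions
and is the composition on the frame `∂_{k,a}`. -/
def secondOrder (k : ℤ) (f : JetFn K ι) : JetFn K ι :=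
  (1 / 2 : K) • ∑ a, ∑ b, M.η⁻¹ a b •
    M.residueCovariant a b fun n c => M.deltaSigma k (n - 1) c f

/-- `H_k = -(1/4) ∑_{ℓ=0}^k Tr((μ - 1/2) U^ℓ (μ + 1/2) U^{k-ℓ})`. -/
def H (k : ℤ) : Fn K ι :=
  (-1 / 4 : K) • ∑ l ∈ Finset.range (k + 1).toNat,
    ((M.μ - (1 / 2 : K) • 1).map C * M.U ^ l * (M.μ + (1 / 2 : K) • 1).map C *
      M.U ^ (k.toNat - l)).trace

end FrobeniusManifold

end JetFrobenius

end

noncomputable section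

namespace JetFrobenius

/-! ## Laurent series in `z` -/

namespace Laurent

variable {A : Type*} [CommRing A]

/-! Conjugation by `Z₀ = exp(F₀/ħ)` adds the function `∂_{k,a} F₀` to each `ħ ∂_{k,a}`. The
equations for `F₀` say that these functions continue the multiplication part of `Φ` to the
nonnegative powers of `z`. So `Z₀⁻¹ Φ Z₀ = ħ ∂(z) + τ(z)`, where `τ(z) = η t(-z)` is the full
two-sided series `coordSeq` (`freeField_expMul`). Normal ordering removes only the contractions of
`∂_{m,a}` with the original multiplication part; those with the derivatives of `F₀` survive
(`normalOrder_expMul`). The quadratic expression splits into a part quadratic in `τ`, two cross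
terms, a second-order operator, and a function in which the derivative has hit `τ`.

In each of the first three the fundamental solution is gauged away. One has `∂(z) = Θ(z) σ(z)`,
`τ(z) = Θ(z) η s(-z)` and `δ̃ = Θ δ Θ⁻¹`, and `Θ` is an isometry of the pairing of `f(-z)` with
`g(z)`.

The part quadratic in `τ` vanishes (`pairRes_coordSeq_coordSeq`): `s(z) = O(z⁻²)` by
`sField_eq_zero`, and `δ` never raises the top power of `z`, so there is no residue. The two cross
terms are equal, because `μ` is skew and `U` is self-adjoint, which makes `δ` self-adjoint for the
symmetric residue pairing; each is `𝓛_k` (`pairRes_coordSeq_flatSeq`, `pairRes_flatSeq_coordSeq`).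
In the second-order part `R(z)` is constant (`map_mapD_R`), so the left derivative passes through
`δ̃`. When `σ(-z)` then differentiates `Θ(z)` it produces exactly the connection term of the
Dubrovin connection (`formalSum_flatField_flatSeq`).

The remaining function is a sum of traces of `δ̃^{k+1}` applied to the second derivatives of `F₀`.
These satisfy `z X_{m+1} = X_m - Θ (Θ⁻¹)_m`, and `[δ̃^{N+1}, z] = (N+1) δ̃^N`. The sum therefore
telescopes to the difference of the traces of the `z⁻²` coefficients of `δ̃^{k+2} 1` and `δ^{k+2} 1`
(`sum_trace_delta_hessian`). Conformality kills the first trace unless `k = 0`, where it cancels the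
central constant of `L_0`; the second is expanded by hand and gives `H_k`.

Two-sided series cannot be multiplied over the ring of jets. They become Laurent series modulo
functions of jet-weight at least `w`, because `t_m` has weight at least `m` for `m ≥ 2`
(`flatCoordinate_mem`). The identities involving `τ` as a whole series are proved in these quotients
for every `w`. The same weight argument forces the nonpositive coefficients `s_k` to vanish. -/

theorem coeff_mul_eq_finsum (f g : LaurentSeries A) (n : ℤ) :
    (Function.support fun m : ℤ => f.coeff m * g.coeff (n - m)).Finite ∧
      (f * g).coeff n = ∑ᶠ m : ℤ, f.coeff m * g.coeff (n - m) := by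
  classical
  have hs : (Function.support fun m : ℤ => f.coeff m * g.coeff (n - m)) ⊆
      ((Finset.antidiagonal f.isPWO_support g.isPWO_support n).image Prod.fst : Finset ℤ) := by
    intro m hm
    simp only [Finset.coe_image, Set.mem_image, Finset.mem_coe, Finset.mem_antidiagonal,
      HahnSeries.mem_support]
    refine ⟨(m, n - m), ⟨?_, ?_, by simp⟩, rfl⟩
    · exact left_ne_zero_of_mul hm
    · exact right_ne_zero_of_mul hm
  refine ⟨(Finset.finite_toSet _).subset hs, ?_⟩
  rw [finsum_eq_sum_of_support_subset _ hs, HahnSeries.coeff_mul, Finset.sum_image]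
  · refine Finset.sum_congr rfl fun ij hij => ?_
    rw [Finset.mem_antidiagonal] at hij
    rw [← hij.2.2, add_sub_cancel_left]
  · intro x hx y hy hxy
    simp only [Finset.mem_coe, Finset.mem_antidiagonal] at hx hy
    exact Prod.ext hxy (by linarith [hx.2.2, hy.2.2])

theorem coeff_mul_eq_sum (f g : LaurentSeries A) (n : ℤ) :
    (f * g).coeff n = ∑ᶠ m : ℤ, f.coeff m * g.coeff (n - m) :=
  (coeff_mul_eq_finsum f g n).2

/-- The series with given coefficients, vanishing below `N`. -/
def ofFun (c : ℤ → A) (N : ℤ) (h : ∀ n < N, c n = 0) : LaurentSeries A :=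
  HahnSeries.ofSuppBddBelow c ⟨N, fun n hn => not_lt.mp fun hlt => hn (h n hlt)⟩

@[simp] theorem coeff_ofFun (c : ℤ → A) (N : ℤ) (h : ∀ n < N, c n = 0) (n : ℤ) :
    (ofFun c N h).coeff n = c n := rfl

theorem exists_coeff_eq_zero (f : LaurentSeries A) : ∃ N : ℤ, ∀ n < N, f.coeff n = 0 :=
  ⟨f.order, fun _ hn => HahnSeries.coeff_eq_zero_of_lt_order hn⟩

/-- `z d/dz`. -/
def euler : LaurentSeries A →+ LaurentSeries A where
  toFun f := ofFun (fun n => n • f.coeff n) f.order fun n hn => by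
    rw [HahnSeries.coeff_eq_zero_of_lt_order hn, smul_zero]
  map_zero' := by ext n; simp
  map_add' f g := by ext n; simp

@[simp] theorem coeff_euler (f : LaurentSeries A) (n : ℤ) :
    (euler f).coeff n = n • f.coeff n := rfl

theorem euler_mul (f g : LaurentSeries A) : euler (f * g) = euler f * g + f * euler g := by
  ext n
  rw [HahnSeries.coeff_add, coeff_euler]
  simp only [coeff_mul_eq_sum]
  rw [← finsum_add_distrib (coeff_mul_eq_finsum _ _ n).1 (coeff_mul_eq_finsum _ _ n).1,
    smul_finsum' _ (coeff_mul_eq_finsum _ _ n).1]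
  refine finsum_congr fun m => ?_
  simp only [zsmul_eq_mul, coeff_euler]
  push_cast
  ring

@[simp] theorem euler_one : euler (1 : LaurentSeries A) = 0 := by
  ext n
  rcases eq_or_ne n 0 with rfl | h <;> simp [HahnSeries.coeff_one, *]

@[simp] theorem euler_natCast (m : ℕ) : euler (m : LaurentSeries A) = 0 := by
  rw [← nsmul_one, map_nsmul, euler_one, smul_zero]

variable (K : Type*) [Field K] [Algebra K A]

/-- The substitution `z ↦ -z`. -/
def neg : LaurentSeries A →+* LaurentSeries A where
  toFun f := ofFun (fun n => ((-1 : K) ^ n) • f.coeff n) f.order fun n hn => by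
    rw [HahnSeries.coeff_eq_zero_of_lt_order hn, smul_zero]
  map_zero' := by ext n; simp
  map_one' := by
    ext n
    rcases eq_or_ne n 0 with rfl | h <;> simp [HahnSeries.coeff_one, *]
  map_add' f g := by ext n; simp
  map_mul' f g := by
    ext n
    simp only [coeff_ofFun, coeff_mul_eq_sum]
    rw [smul_finsum']
    · refine finsum_congr fun m => ?_
      rw [smul_mul_smul_comm, ← zpow_add₀ (by simp), add_sub_cancel]
    · exact (coeff_mul_eq_finsum f g n).1

@[simp] theorem coeff_neg (f : LaurentSeries A) (n : ℤ) :
    (neg K f).coeff n = ((-1 : K) ^ n) • f.coeff n := rfl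

theorem neg_one_zpow_mul_self (n : ℤ) : ((-1 : K) ^ n) * (-1) ^ n = 1 := by
  rw [← mul_zpow]; simp

@[simp] theorem neg_neg (f : LaurentSeries A) : neg K (neg K f) = f := by
  ext n
  rw [coeff_neg, coeff_neg, smul_smul, neg_one_zpow_mul_self, one_smul]

theorem neg_euler (f : LaurentSeries A) : neg K (euler f) = euler (neg K f) := by
  ext n
  simp [smul_comm]

/-- The coordinate `z`. -/
abbrev z : LaurentSeries A := HahnSeries.single 1 1

/-- The inverse of the coordinate `z`. -/
abbrev zInv : LaurentSeries A := HahnSeries.single (-1) 1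

theorem z_mul_zInv : (z : LaurentSeries A) * zInv = 1 := by
  rw [HahnSeries.single_mul_single]; simp

theorem zInv_mul_z : (zInv : LaurentSeries A) * z = 1 := by
  rw [mul_comm, z_mul_zInv]

@[simp] theorem neg_z : neg K (z : LaurentSeries A) = -z := by
  ext n
  rcases eq_or_ne n 1 with rfl | h <;> simp [*]

@[simp] theorem neg_zInv : neg K (zInv : LaurentSeries A) = -zInv := by
  ext n
  rcases eq_or_ne n (-1) with rfl | h <;> simp [*]

@[simp] theorem euler_z : euler (z : LaurentSeries A) = z := by
  ext n
  rcases eq_or_ne n 1 with rfl | h <;> simp [*]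

@[simp] theorem euler_zInv : euler (zInv : LaurentSeries A) = -zInv := by
  ext n
  rcases eq_or_ne n (-1) with rfl | h <;> simp [*]

theorem coeff_z_mul (f : LaurentSeries A) (n : ℤ) : (z * f).coeff n = f.coeff (n - 1) := by
  rw [HahnSeries.coeff_single_mul, one_mul]

theorem coeff_zInv_mul (f : LaurentSeries A) (n : ℤ) : (zInv * f).coeff n = f.coeff (n + 1) := by
  rw [HahnSeries.coeff_single_mul, one_mul, sub_neg_eq_add]

/-! ### Matrices of Laurent series -/

variable {K} {ι κ : Type*} [Fintype ι]

/-- `z d/dz` on matrices. -/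
abbrev mEuler {ι κ : Type*} (F : Matrix ι κ (LaurentSeries A)) : Matrix ι κ (LaurentSeries A) :=
  F.map euler

theorem mEuler_mul {l : Type*} (F : Matrix l ι (LaurentSeries A))
    (G : Matrix ι κ (LaurentSeries A)) :
    mEuler (F * G) = mEuler F * G + F * mEuler G := by
  ext i j : 2
  simp only [Matrix.map_apply, Matrix.mul_apply, Matrix.add_apply, map_sum, euler_mul,
    ← Finset.sum_add_distrib]

theorem mEuler_add {l : Type*} (F G : Matrix l κ (LaurentSeries A)) :
    mEuler (F + G) = mEuler F + mEuler G := by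
  ext i j : 2
  simp

theorem mEuler_smul {l : Type*} (c : LaurentSeries A) (F : Matrix l κ (LaurentSeries A)) :
    mEuler (c • F) = euler c • F + c • mEuler F := by
  ext i j : 2
  simp [euler_mul]

theorem mEuler_one {l : Type*} [DecidableEq l] :
    mEuler (1 : Matrix l l (LaurentSeries A)) = 0 := by
  ext i j : 2
  rcases eq_or_ne i j with rfl | h <;> simp [*]

/-- The operator `∂_z + z⁻¹ S`. -/
def delta (S : Matrix ι ι (LaurentSeries A)) (F : Matrix ι κ (LaurentSeries A)) :
    Matrix ι κ (LaurentSeries A) :=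
  (zInv : LaurentSeries A) • (mEuler F + S * F)

theorem delta_add (S : Matrix ι ι (LaurentSeries A)) (F G : Matrix ι κ (LaurentSeries A)) :
    delta S (F + G) = delta S F + delta S G := by
  simp only [delta, mEuler_add, Matrix.mul_add, smul_add]
  abel

/-- Differentiating `Θ Θ⁻¹ = 1` shows that the inhomogeneous term of `R` cancels the derivative
falling on `Θ`. -/
theorem delta_gauge [DecidableEq ι] {Θ Θi S R : Matrix ι ι (LaurentSeries A)} (h : Θ * Θi = 1)
    (hR : R = Θ * S * Θi + Θ * mEuler Θi) (F : Matrix ι κ (LaurentSeries A)) :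
    delta R (Θ * F) = Θ * delta S F := by
  have h' : Θi * Θ = 1 := mul_eq_one_comm.mp h
  have h0 : mEuler Θ * Θi = -(Θ * mEuler Θi) := by
    rw [eq_neg_iff_add_eq_zero, ← mEuler_mul, h, mEuler_one]
  have h1 : Θ * mEuler Θi * Θ = -mEuler Θ := by
    rw [← neg_eq_iff_eq_neg, ← Matrix.neg_mul, ← h0, Matrix.mul_assoc, h', Matrix.mul_one]
  rw [delta, delta, mEuler_mul, hR, Matrix.mul_smul, Matrix.mul_add, ← Matrix.mul_assoc _ Θ,
    Matrix.add_mul, h1, Matrix.mul_assoc _ Θi, h', Matrix.mul_one, Matrix.add_mul, Matrix.neg_mul,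
    Matrix.mul_assoc Θ S F]
  congr 1
  abel

theorem delta_gauge_iterate [DecidableEq ι] {Θ Θi S R : Matrix ι ι (LaurentSeries A)}
    (h : Θ * Θi = 1) (hR : R = Θ * S * Θi + Θ * mEuler Θi) (N : ℕ)
    (F : Matrix ι κ (LaurentSeries A)) :
    (delta R)^[N] (Θ * F) = Θ * (delta S)^[N] F := by
  induction N with
  | zero => rfl
  | succ N ih => rw [Function.iterate_succ_apply', ih, delta_gauge h hR,
      ← Function.iterate_succ_apply' (delta S)]

/-- Only `∂_z` fails to commute with `z`, so `[δ, z] = 1`. This commutator drives the telescoping in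
`sum_trace_delta_hessian`. -/
theorem delta_iterate_z_smul (S : Matrix ι ι (LaurentSeries A)) (N : ℕ)
    (F : Matrix ι κ (LaurentSeries A)) :
    (delta S)^[N + 1] ((z : LaurentSeries A) • F) =
      (z : LaurentSeries A) • (delta S)^[N + 1] F + ((N + 1 : ℕ) : LaurentSeries A) • (delta S)^[N] F := by
  have h1 : ∀ F : Matrix ι κ (LaurentSeries A), delta S ((z : LaurentSeries A) • F) = (z : LaurentSeries A) • delta S F + F := by
    intro F
    rw [delta, delta, mEuler_smul, euler_z, smul_comm (z : LaurentSeries A) zInv, Matrix.mul_smul, add_assoc,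
      ← smul_add, smul_add, smul_smul (zInv : LaurentSeries A) z F, zInv_mul_z, one_smul, add_comm]
  have h2 : ∀ (n : ℕ) (F : Matrix ι κ (LaurentSeries A)),
      delta S ((n : LaurentSeries A) • F) = (n : LaurentSeries A) • delta S F := by
    intro n F
    rw [delta, delta, mEuler_smul, Matrix.mul_smul, smul_comm (n : LaurentSeries A) (zInv : LaurentSeries A)]
    simp [smul_add]
  induction N with
  | zero => simp [h1]
  | succ N ih =>
    rw [Function.iterate_succ_apply', ih, delta_add, h1, h2,
      ← Function.iterate_succ_apply' (delta S), ← Function.iterate_succ_apply' (delta S)]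
    rw [Nat.cast_succ (N + 1), add_smul, one_smul, add_assoc,
      add_comm _ ((delta S)^[N + 1] F)]

theorem delta_mul_const {l : Type*} [Fintype κ] (S : Matrix ι ι (LaurentSeries A))
    (F : Matrix ι κ (LaurentSeries A)) (G : Matrix κ l (LaurentSeries A)) (hG : mEuler G = 0) :
    delta S (F * G) = delta S F * G := by
  rw [delta, delta, mEuler_mul, hG, Matrix.mul_zero, add_zero, Matrix.smul_mul, Matrix.add_mul,
    Matrix.mul_assoc]

theorem delta_iterate_mul_const {l : Type*} [Fintype κ] (S : Matrix ι ι (LaurentSeries A))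
    (N : ℕ) (F : Matrix ι κ (LaurentSeries A)) (G : Matrix κ l (LaurentSeries A))
    (hG : mEuler G = 0) :
    (delta S)^[N] (F * G) = (delta S)^[N] F * G := by
  induction N with
  | zero => rfl
  | succ N ih => rw [Function.iterate_succ_apply', ih, delta_mul_const S _ G hG,
      ← Function.iterate_succ_apply' (delta S)]

/-! ### The residue pairing -/

variable (K) in
/-- `f(-z)ᵀ Q g(z)`. -/
def pairing {l m : Type*} (Q : Matrix ι ι (LaurentSeries A)) (F : Matrix ι l (LaurentSeries A))
    (G : Matrix ι m (LaurentSeries A)) : Matrix l m (LaurentSeries A) :=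
  (F.map (neg K)).transpose * Q * G

/-- The pairing satisfies `⟨δ f, g⟩ = ⟨f, δ g⟩` up to a total derivative if the adjoint of `S` is
`1 - S`. -/
theorem coeff_pairing_delta [DecidableEq ι] {l m : Type*} {Q S : Matrix ι ι (LaurentSeries A)}
    (hQ : mEuler Q = 0) (hS : (S.map (neg K)).transpose * Q = Q * (1 - S))
    (F : Matrix ι l (LaurentSeries A)) (G : Matrix ι m (LaurentSeries A)) (i : l) (j : m) :
    (pairing K Q (delta S F) G i j).coeff (-2) = (pairing K Q F (delta S G) i j).coeff (-2) := by
  have e1 : ((delta S F).map (neg K)) =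
      -((zInv : LaurentSeries A) • (mEuler (F.map (neg K)) + S.map (neg K) * F.map (neg K))) := by
    ext a b : 2
    simp only [delta, Matrix.map_apply, Matrix.smul_apply, Matrix.add_apply, Matrix.neg_apply,
      smul_eq_mul, map_mul, map_add, neg_zInv, neg_euler, Matrix.mul_apply, map_sum]
    ring_nf
  have e2 : pairing K Q F (delta S G) - pairing K Q (delta S F) G =
      (zInv : LaurentSeries A) • (mEuler (pairing K Q F G) + pairing K Q F G) := by
    have e3 : mEuler (pairing K Q F G) =
        (mEuler (F.map (neg K))).transpose * Q * G + (F.map (neg K)).transpose * Q * mEuler G := by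
      rw [pairing, mEuler_mul, mEuler_mul, hQ, Matrix.mul_zero, add_zero]
      rfl
    have e4 : (F.map (neg K)).transpose * ((S.map (neg K)).transpose * Q) * G =
        (F.map (neg K)).transpose * Q * G - (F.map (neg K)).transpose * Q * (S * G) := by
      rw [hS]
      simp only [Matrix.mul_sub, Matrix.sub_mul, Matrix.mul_one, Matrix.mul_assoc]
    have e5 : pairing K Q (delta S F) G =
        -((zInv : LaurentSeries A) • ((mEuler (F.map (neg K))).transpose * Q * G +
          (F.map (neg K)).transpose * ((S.map (neg K)).transpose * Q) * G)) := by
      rw [pairing, e1]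
      simp only [Matrix.transpose_neg, Matrix.transpose_smul, Matrix.transpose_add,
        Matrix.transpose_mul, Matrix.neg_mul, Matrix.smul_mul, Matrix.add_mul, Matrix.mul_assoc]
    rw [e5, e4, e3]
    simp only [pairing, delta, Matrix.mul_smul, Matrix.mul_add]
    rw [sub_neg_eq_add, ← smul_add]
    congr 1
    abel
  -- The difference has the form `z⁻¹ (z d/dz + 1) P`, so its coefficient at `z⁻²` is `(-1 + 1) P₋₁
  -- = 0`. The exponent is `-2` because the residue is taken of `z` times the pairing.
  have e6 := congrArg (fun M => (M i j).coeff (-2)) e2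
  simp only [Matrix.sub_apply, Matrix.smul_apply, smul_eq_mul, HahnSeries.coeff_sub,
    coeff_zInv_mul, Matrix.add_apply, HahnSeries.coeff_add, Matrix.map_apply, coeff_euler] at e6
  norm_num at e6
  exact (sub_eq_zero.mp e6).symm

theorem coeff_pairing_delta_iterate [DecidableEq ι] {l m : Type*}
    {Q S : Matrix ι ι (LaurentSeries A)}
    (hQ : mEuler Q = 0) (hS : (S.map (neg K)).transpose * Q = Q * (1 - S)) (N : ℕ)
    (F : Matrix ι l (LaurentSeries A)) (G : Matrix ι m (LaurentSeries A)) (i : l) (j : m) :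
    (pairing K Q ((delta S)^[N] F) G i j).coeff (-2) =
      (pairing K Q F ((delta S)^[N] G) i j).coeff (-2) := by
  induction N generalizing F with
  | zero => rfl
  | succ N ih =>
    rw [Function.iterate_succ_apply, ih, coeff_pairing_delta hQ hS,
      ← Function.iterate_succ_apply' (delta S)]

/-- Exchanging the arguments amounts to `z ↦ -z` when `Q` is symmetric and even, and this leaves
even coefficients unchanged. -/
theorem coeff_pairing_symm {l m : Type*} {Q : Matrix ι ι (LaurentSeries A)}
    (hQ : Q.transpose = Q) (hQ' : Q.map (neg K) = Q)
    (F : Matrix ι l (LaurentSeries A)) (G : Matrix ι m (LaurentSeries A)) (i : l) (j : m) :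
    (pairing K Q F G i j).coeff (-2) = (pairing K Q G F j i).coeff (-2) := by
  have hF : (((F.map (neg K)).transpose).map (neg K)).transpose = F := by
    ext a b : 2
    simp
  have h : pairing K Q G F = ((pairing K Q F G).map (neg K)).transpose := by
    rw [pairing, pairing, Matrix.map_mul, Matrix.map_mul, hQ', Matrix.transpose_mul,
      Matrix.transpose_mul, hQ, hF, Matrix.mul_assoc]
  rw [h, Matrix.transpose_apply, Matrix.map_apply, coeff_neg]
  norm_num

theorem pairing_mul_mul {l m : Type*} {Q Θ : Matrix ι ι (LaurentSeries A)}
    (h : (Θ.map (neg K)).transpose * Q * Θ = Q)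
    (F : Matrix ι l (LaurentSeries A)) (G : Matrix ι m (LaurentSeries A)) :
    pairing K Q (Θ * F) (Θ * G) = pairing K Q F G := by
  rw [pairing, pairing, Matrix.map_mul, Matrix.transpose_mul]
  conv_rhs => rw [← h]
  simp only [Matrix.mul_assoc]

end Laurent

end JetFrobenius

end

noncomputable section

namespace JetFrobenius

open MvPowerSeries

/-! ## Formal connections and Laurent series -/

theorem finsum_int_eq_finsum_nat {M : Type*} [AddCommMonoid M] (f : ℤ → M)
    (h : ∀ m < 0, f m = 0) : ∑ᶠ m : ℤ, f m = ∑ᶠ j : ℕ, f j := by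
  rw [← finsum_mem_range (g := fun j : ℕ => (j : ℤ)) (f := f) Nat.cast_injective,
    ← finsum_mem_univ]
  refine finsum_mem_inter_support_eq' _ _ _ fun m hm => ?_
  simp only [Set.mem_univ, Set.mem_range, true_iff]
  exact ⟨m.toNat, Int.toNat_of_nonneg (not_lt.mp fun hlt => hm (h m hlt))⟩

namespace Laurent

variable {A : Type*} [CommRing A]

theorem coeff_ofPowerSeries_of_neg (S : PowerSeries A) {n : ℤ} (hn : n < 0) :
    (HahnSeries.ofPowerSeries ℤ A S).coeff n = 0 := by
  rw [HahnSeries.ofPowerSeries_apply, HahnSeries.embDomain_of_notMem_range]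
  rintro ⟨m, rfl⟩
  simp at hn
  omega

theorem coeff_ofPowerSeries (S : PowerSeries A) (n : ℤ) :
    (HahnSeries.ofPowerSeries ℤ A S).coeff n =
      if 0 ≤ n then PowerSeries.coeff n.toNat S else 0 := by
  split_ifs with h
  · obtain ⟨m, rfl⟩ := Int.eq_ofNat_of_zero_le h
    exact HahnSeries.ofPowerSeries_apply_coeff S m
  · exact coeff_ofPowerSeries_of_neg S (not_le.mp h)

theorem coeff_ofPowerSeries_mul (S : PowerSeries A) (f : LaurentSeries A) (n : ℤ) :
    (Function.support fun j : ℕ => PowerSeries.coeff j S * f.coeff (n - j)).Finite ∧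
      (HahnSeries.ofPowerSeries ℤ A S * f).coeff n =
        ∑ᶠ j : ℕ, PowerSeries.coeff j S * f.coeff (n - j) := by
  have e : ∀ j : ℕ, PowerSeries.coeff j S * f.coeff (n - j) =
      (HahnSeries.ofPowerSeries ℤ A S).coeff (j : ℤ) * f.coeff (n - (j : ℤ)) := fun j => by
    rw [HahnSeries.ofPowerSeries_apply_coeff]
  obtain ⟨hf, hs⟩ := coeff_mul_eq_finsum (HahnSeries.ofPowerSeries ℤ A S) f n
  simp only [e]
  refine ⟨hf.preimage (f := fun j : ℕ => (j : ℤ)) Nat.cast_injective.injOn, ?_⟩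
  rw [hs, finsum_int_eq_finsum_nat]
  intro m hm
  rw [coeff_ofPowerSeries_of_neg S hm, zero_mul]

end Laurent

section Connection

variable {K ι : Type*} [Field K] [Fintype ι]

/-- The matrix of Laurent series `∑ j, z^j R_j`. -/
def symbol (A : Type*) [CommRing A] [Algebra (JetFn K ι) A]
    (R : ℕ → Matrix ι ι (JetFn K ι)) : Matrix ι ι (LaurentSeries A) :=
  fun c d => HahnSeries.ofPowerSeries ℤ A (PowerSeries.mk fun j => algebraMap _ A (R j c d))

/-- Dictionary between operators on sequences and operators on genuine Laurent series. The algebra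
`A` is arbitrary so that it can also be a quotient of the ring of jets. -/
theorem zConnection_coeff {A κ : Type*} [CommRing A] [Algebra (JetFn K ι) A]
    (R : ℕ → Matrix ι ι (JetFn K ι)) (F : Matrix ι κ (LaurentSeries A)) (x : κ) :
    zConnection R (fun n c => (F c x).coeff n) =
      fun n c => (Laurent.delta (symbol A R) F c x).coeff n := by
  funext n c
  have h : ∀ b, (symbol A R c b * F b x).coeff (n + 1) =
      ∑ᶠ j : ℕ, R j c b • (F b x).coeff (n + 1 - j) := fun b => by
    rw [symbol, (Laurent.coeff_ofPowerSeries_mul _ _ _).2]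
    refine finsum_congr fun j => ?_
    rw [PowerSeries.coeff_mk, Algebra.smul_def]
  rw [zConnection, Laurent.delta, Matrix.smul_apply, smul_eq_mul, Laurent.coeff_zInv_mul,
    Matrix.add_apply, HahnSeries.coeff_add,
    show Laurent.mEuler F c x = Laurent.euler (F c x) from rfl, Laurent.coeff_euler,
    Matrix.mul_apply, HahnSeries.coeff_sum, finsum_sum_comm]
  · simp only [h]
  · intro b _
    refine (Laurent.coeff_ofPowerSeries_mul (PowerSeries.mk fun j => algebraMap _ A (R j c b))
      (F b x) (n + 1)).1.subset fun j hj => ?_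
    rw [Function.mem_support] at hj ⊢
    rwa [PowerSeries.coeff_mk, ← Algebra.smul_def]

theorem zConnection_iterate_coeff {A κ : Type*} [CommRing A] [Algebra (JetFn K ι) A]
    (R : ℕ → Matrix ι ι (JetFn K ι)) (N : ℕ) (F : Matrix ι κ (LaurentSeries A)) (x : κ) :
    (zConnection R)^[N] (fun n c => (F c x).coeff n) =
      fun n c => ((Laurent.delta (symbol A R))^[N] F c x).coeff n := by
  induction N with
  | zero => rfl
  | succ N ih =>
    rw [Function.iterate_succ_apply', ih, zConnection_coeff, Function.iterate_succ_apply']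

variable {V W : Type*} [AddCommGroup V] [Module (JetFn K ι) V] [AddCommGroup W]
  [Module (JetFn K ι) W]

/-- For an arbitrary sequence in an arbitrary module the `finsum` takes its default value `0` when
infinitely many terms survive. Finiteness of `R` removes this case and makes the operator additive
and natural in the module. -/
theorem zConnection_eq_sum {R : ℕ → Matrix ι ι (JetFn K ι)} {J : ℕ} (hR : ∀ j, J ≤ j → R j = 0)
    (f : ℤ → ι → V) (n : ℤ) (c : ι) :
    zConnection R f n c = (n + 1) • f (n + 1) c +
      ∑ j ∈ Finset.range J, ∑ b, R j c b • f (n + 1 - j) b := by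
  rw [zConnection, finsum_eq_sum_of_support_subset]
  intro j hj
  by_contra h
  rw [Finset.coe_range, Set.mem_Iio, not_lt] at h
  refine hj (Finset.sum_eq_zero fun b _ => ?_)
  rw [hR j h, Matrix.zero_apply, zero_smul]

theorem zConnection_map {R : ℕ → Matrix ι ι (JetFn K ι)} {J : ℕ} (hR : ∀ j, J ≤ j → R j = 0)
    (φ : V →+ W) (hφ : ∀ j a b v, φ (R j a b • v) = R j a b • φ v) (f : ℤ → ι → V) :
    zConnection R (fun n c => φ (f n c)) = fun n c => φ (zConnection R f n c) := by
  funext n c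
  simp only [zConnection_eq_sum hR, map_add, map_zsmul, map_sum, hφ]

theorem zConnection_iterate_map {R : ℕ → Matrix ι ι (JetFn K ι)} {J : ℕ}
    (hR : ∀ j, J ≤ j → R j = 0) (φ : V →+ W) (hφ : ∀ j a b v, φ (R j a b • v) = R j a b • φ v)
    (N : ℕ) (f : ℤ → ι → V) :
    (zConnection R)^[N] (fun n c => φ (f n c)) = fun n c => φ ((zConnection R)^[N] f n c) := by
  induction N with
  | zero => rfl
  | succ N ih => rw [Function.iterate_succ_apply', ih, zConnection_map hR φ hφ,
      Function.iterate_succ_apply']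

theorem zConnection_add {R : ℕ → Matrix ι ι (JetFn K ι)} {J : ℕ} (hR : ∀ j, J ≤ j → R j = 0)
    (f g : ℤ → ι → V) :
    zConnection R (f + g) = zConnection R f + zConnection R g := by
  funext n c
  simp only [zConnection_eq_sum hR, Pi.add_apply, smul_add, Finset.sum_add_distrib]
  abel

theorem zConnection_iterate_add {R : ℕ → Matrix ι ι (JetFn K ι)} {J : ℕ}
    (hR : ∀ j, J ≤ j → R j = 0) (N : ℕ) (f g : ℤ → ι → V) :
    (zConnection R)^[N] (f + g) = (zConnection R)^[N] f + (zConnection R)^[N] g := by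
  induction N with
  | zero => rfl
  | succ N ih => simp only [Function.iterate_succ_apply', ih, zConnection_add hR]

end Connection

/-! ## The weight filtration -/

section Weight

variable {K ι : Type*} [Field K]

/-- The weight of a monomial: the variable `(n, a)` has weight `n`. -/
def jetWeight : (ℕ × ι →₀ ℕ) →+ ℕ := Finsupp.weight Prod.fst

theorem jetWeight_single (p : ℕ × ι) : jetWeight (Finsupp.single p 1) = p.1 := by
  simp [jetWeight, Finsupp.weight_single]

/-- The ideal of functions without monomials of weight less than `w`. -/
def wIdeal (w : ℕ) : Ideal (JetFn K ι) where
  carrier := {g | ∀ α, jetWeight α < w → coeff α g = 0}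
  add_mem' hf hg α h := by rw [map_add, hf α h, hg α h, add_zero]
  zero_mem' α _ := map_zero _
  smul_mem' c g hg α h := by
    classical
    rw [smul_eq_mul, coeff_mul]
    refine Finset.sum_eq_zero fun x hx => ?_
    rw [hg x.2, mul_zero]
    rw [← Finset.HasAntidiagonal.mem_antidiagonal.mp hx, map_add] at h
    omega

theorem mem_wIdeal_zero (g : JetFn K ι) : g ∈ wIdeal 0 := fun _ h => (Nat.not_lt_zero _ h).elim

theorem wIdeal_anti {v w : ℕ} (h : v ≤ w) {g : JetFn K ι} (hg : g ∈ wIdeal w) : g ∈ wIdeal v :=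
  fun α hα => hg α (hα.trans_le h)

theorem mul_mem_wIdeal_add {v w : ℕ} {f g : JetFn K ι} (hf : f ∈ wIdeal v) (hg : g ∈ wIdeal w) :
    f * g ∈ wIdeal (v + w) := by
  classical
  intro α h
  rw [coeff_mul]
  refine Finset.sum_eq_zero fun x hx => ?_
  rw [← Finset.HasAntidiagonal.mem_antidiagonal.mp hx, map_add] at h
  rcases lt_or_ge (jetWeight x.1) v with h1 | h1
  · rw [hf _ h1, zero_mul]
  · rw [hg _ (by omega), mul_zero]

theorem eq_zero_of_forall_mem_wIdeal {g : JetFn K ι} (h : ∀ w, g ∈ wIdeal w) : g = 0 := by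
  ext α
  exact h _ α (Nat.lt_succ_self _)

/-- The filtration is separated. Passing to all quotients is what makes two-sided sequences
accessible, since there they are bounded below. -/
theorem eq_of_forall_mk_eq {f g : JetFn K ι}
    (h : ∀ w, Ideal.Quotient.mk (wIdeal w) f = Ideal.Quotient.mk (wIdeal w) g) : f = g :=
  sub_eq_zero.mp (eq_zero_of_forall_mem_wIdeal fun w => Ideal.Quotient.eq.mp (h w))

theorem pderiv_mem_wIdeal (p : ℕ × ι) {w : ℕ} {g : JetFn K ι} (hg : g ∈ wIdeal (w + p.1)) :
    pderiv K p g ∈ wIdeal w := fun α h => by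
  rw [coeff_pderiv, hg _ (by rw [map_add, jetWeight_single]; omega), zero_mul]

theorem X_mem_wIdeal (p : ℕ × ι) : (X p : JetFn K ι) ∈ wIdeal p.1 := by
  classical
  intro α h
  rw [coeff_X, if_neg]
  rintro rfl
  rw [jetWeight_single] at h
  exact lt_irrefl _ h

/-! ### Summable families -/

/-- A family of functions is summable if it tends to zero for the weight filtration. -/
def JetSummable {J : Type*} (G : J → JetFn K ι) : Prop := ∀ w, {j | G j ∉ wIdeal w}.Finite

variable {J : Type*} {G H : J → JetFn K ι}

theorem JetSummable.add (hG : JetSummable G) (hH : JetSummable H) :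
    JetSummable fun j => G j + H j := fun w =>
  ((hG w).union (hH w)).subset fun j hj => by
    by_contra h
    rw [Set.mem_union, not_or, Set.mem_ofPred, Set.mem_ofPred, not_not, not_not] at h
    exact hj (Ideal.add_mem _ h.1 h.2)

theorem JetSummable.mul_left (c : J → JetFn K ι) (hG : JetSummable G) :
    JetSummable fun j => c j * G j := fun w =>
  (hG w).subset fun _ hj h => hj (Ideal.mul_mem_left _ _ h)

theorem JetSummable.mul_right (c : J → JetFn K ι) (hG : JetSummable G) :
    JetSummable fun j => G j * c j := fun w =>
  (hG w).subset fun _ hj h => hj (Ideal.mul_mem_right _ _ h)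

theorem JetSummable.sum {T : Type*} (s : Finset T) {G : T → J → JetFn K ι}
    (hG : ∀ x ∈ s, JetSummable (G x)) : JetSummable fun j => ∑ x ∈ s, G x j := fun w =>
  (s.finite_toSet.biUnion fun x hx => hG x hx w).subset fun j hj => by
    by_contra h
    simp only [Set.mem_iUnion, not_exists, Set.mem_ofPred, not_not] at h
    exact hj (Ideal.sum_mem _ fun x hx => h x hx)

theorem jetSummable_of_finite (h : (Function.support G).Finite) : JetSummable G := fun _ =>
  h.subset fun j hj h0 => hj (by rw [h0]; exact Ideal.zero_mem _)

theorem coeff_formalSum (G : J → JetFn K ι) (α : ℕ × ι →₀ ℕ) :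
    coeff α (formalSum G) = ∑ᶠ j, coeff α (G j) := rfl

/-- A formal sum agrees modulo `wIdeal w` with any partial sum containing all terms outside of
`wIdeal w`. -/
theorem formalSum_sub_sum_mem {w : ℕ} (s : Finset J) (hs : ∀ j, j ∉ s → G j ∈ wIdeal w) :
    formalSum G - ∑ j ∈ s, G j ∈ wIdeal w := fun α hα => by
  rw [map_sub, coeff_formalSum, finsum_eq_sum_of_support_subset (s := s), map_sum, sub_self]
  intro j hj
  by_contra h
  exact hj (hs j h α hα)

/-- `formalSum` is defined coefficientwise with no convergence requirement; this identifies it with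
an honest finite sum at each level of the filtration. -/
theorem mk_formalSum {w : ℕ} (hG : {j | G j ∉ wIdeal w}.Finite) :
    Ideal.Quotient.mk (wIdeal w) (formalSum G) = ∑ᶠ j, Ideal.Quotient.mk (wIdeal w) (G j) := by
  rw [finsum_eq_sum_of_support_subset (s := hG.toFinset), ← map_sum]
  · refine Ideal.Quotient.eq.mpr (formalSum_sub_sum_mem _ fun j hj => ?_)
    simpa using hj
  · intro j hj
    simpa [Ideal.Quotient.eq_zero_iff_mem] using hj

theorem mk_support (w : ℕ) (G : J → JetFn K ι) :
    (Function.support fun j => Ideal.Quotient.mk (wIdeal w) (G j)) = {j | G j ∉ wIdeal w} := by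
  ext j
  simp [Ideal.Quotient.eq_zero_iff_mem]

theorem formalSum_add (hG : JetSummable G) (hH : JetSummable H) :
    formalSum (fun j => G j + H j) = formalSum G + formalSum H := by
  refine eq_of_forall_mk_eq fun w => ?_
  rw [map_add, mk_formalSum ((hG.add hH) w), mk_formalSum (hG w), mk_formalSum (hH w)]
  simp only [map_add]
  exact finsum_add_distrib (by rw [Function.HasFiniteSupport, mk_support]; exact hG w)
    (by rw [Function.HasFiniteSupport, mk_support]; exact hH w)

theorem mul_formalSum (c : JetFn K ι) (hG : JetSummable G) :
    formalSum (fun j => c * G j) = c * formalSum G := by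
  refine eq_of_forall_mk_eq fun w => ?_
  rw [map_mul, mk_formalSum ((hG.mul_left fun _ => c) w), mk_formalSum (hG w), mul_finsum']
  · simp only [map_mul]
  · rw [Function.HasFiniteSupport, mk_support]; exact hG w

theorem formalSum_smul (c : K) (G : J → JetFn K ι) :
    formalSum (fun j => c • G j) = c • formalSum G := by
  ext α
  simp only [coeff_formalSum, coeff_smul]
  -- A nonzero scalar does not change supports, so no summability is needed.
  rcases eq_or_ne c 0 with rfl | hc
  · simp
  · exact (smul_finsum c fun j => coeff α (G j)).symm

theorem formalSum_finsetSum {T : Type*} (s : Finset T) {G : T → J → JetFn K ι}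
    (hG : ∀ x ∈ s, JetSummable (G x)) :
    formalSum (fun j => ∑ x ∈ s, G x j) = ∑ x ∈ s, formalSum (G x) := by
  classical
  induction s using Finset.induction_on with
  | empty => ext α; simp [coeff_formalSum]
  | insert x s hx ih =>
    simp only [Finset.sum_insert hx]
    rw [formalSum_add (hG x (Finset.mem_insert_self _ _))
      (JetSummable.sum s fun y hy => hG y (Finset.mem_insert_of_mem hy)),
      ih fun y hy => hG y (Finset.mem_insert_of_mem hy)]

theorem formalSum_eq_sum (s : Finset J) (h : ∀ j, j ∉ s → G j = 0) :
    formalSum G = ∑ j ∈ s, G j := by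
  refine sub_eq_zero.mp (eq_zero_of_forall_mem_wIdeal fun w => formalSum_sub_sum_mem s fun j hj => ?_)
  rw [h j hj]
  exact Ideal.zero_mem _

theorem formalSum_mem {w : ℕ} (h : ∀ j, G j ∈ wIdeal w) : formalSum G ∈ wIdeal w := by
  simpa using formalSum_sub_sum_mem ∅ fun j _ => h j

theorem pderiv_formalSum (p : ℕ × ι) (hG : JetSummable G) :
    pderiv K p (formalSum G) = formalSum fun j => pderiv K p (G j) := by
  ext α
  simp only [coeff_pderiv, coeff_formalSum]
  rw [finsum_mul']
  -- The coefficient at `α` of the derivative reads a single coefficient of each term, so one level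
  -- above its weight leaves finitely many terms.
  refine (hG (jetWeight (α + Finsupp.single p 1) + 1)).subset fun j hj h => hj (h _ ?_)
  exact Nat.lt_succ_self _

end Weight

end JetFrobenius

end

noncomputable section

namespace JetFrobenius

open MvPowerSeries

/-! ## Vector fields on the jet-space -/

section VectorField

variable {K ι : Type*} [Field K]

theorem pderiv_comm {σ : Type*} (p q : σ) (f : MvPowerSeries σ K) :
    pderiv K p (pderiv K q f) = pderiv K q (pderiv K p f) := by
  classical
  ext α
  simp only [coeff_pderiv, Finsupp.add_apply, add_right_comm α]
  rcases eq_or_ne p q with rfl | h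
  · ring
  · rw [Finsupp.single_eq_of_ne h, Finsupp.single_eq_of_ne h.symm]
    push_cast
    ring

/-- The embedding of the coordinates of the manifold in those of the jet-space. -/
def coordEmb (ι : Type*) : ι ↪ ℕ × ι := ⟨fun a => (0, a), fun _ _ h => (Prod.ext_iff.mp h).2⟩

/-- The vector field `∑ p, v p ∂/∂u_p` lowers the weight by at most `m`. -/
def LowersWeight (m : ℕ) (v : ℕ × ι → JetFn K ι) : Prop := ∀ p, v p ∈ wIdeal (p.1 - m)

theorem LowersWeight.mem {m : ℕ} {v : ℕ × ι → JetFn K ι} (hv : LowersWeight m v) {w : ℕ}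
    {p : ℕ × ι} (hp : w + m ≤ p.1) : v p ∈ wIdeal w :=
  wIdeal_anti (by omega) (hv p)

/-- Components with jet order at least `w + m` are already deep enough. Below that, the weight lost
to `∂/∂u_n` is regained, up to `m`, from the coefficient of the field. -/
theorem LowersWeight.vectorField_mem {m : ℕ} {v : ℕ × ι → JetFn K ι} (hv : LowersWeight m v) {w : ℕ}
    {f : JetFn K ι} (hf : f ∈ wIdeal (w + m)) : vectorField v f ∈ wIdeal w :=
  formalSum_mem fun p => by
    rcases le_or_gt (w + m) p.1 with h | h
    · exact Ideal.mul_mem_right _ _ (hv.mem h)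
    · refine wIdeal_anti (v := w) (w := (p.1 - m) + (w + m - p.1)) (by omega)
        (mul_mem_wIdeal_add (hv p) (pderiv_mem_wIdeal p ?_))
      rwa [Nat.sub_add_cancel h.le]

variable [Fintype ι]

theorem pullback_eq_rename : (pullback : Fn K ι →ₐ[K] JetFn K ι) = rename (coordEmb ι) := rfl

theorem pullback_C (c : K) : (pullback (C c : Fn K ι) : JetFn K ι) = C c := rename_C _ _

theorem coeff_pullback_eq_zero {g : Fn K ι} {α : ℕ × ι →₀ ℕ} {n : ℕ} {a : ι}
    (h : α (n + 1, a) ≠ 0) : coeff α (pullback g) = 0 := by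
  rw [pullback_eq_rename]
  refine coeff_rename_eq_zero (coordEmb ι) g fun hα => ?_
  obtain ⟨β, rfl⟩ := hα
  refine h (Finsupp.mapDomain_of_notMem_range _ _ ?_)
  rintro ⟨b, hb⟩
  exact (Nat.succ_ne_zero n).symm (congrArg Prod.fst hb)

theorem pderiv_succ_pullback (n : ℕ) (a : ι) (g : Fn K ι) :
    pderiv K (n + 1, a) (pullback g) = 0 := by
  ext α
  rw [coeff_pderiv, coeff_pullback_eq_zero (n := n) (a := a), zero_mul, map_zero]
  simp

theorem pderiv_pullback (a : ι) (g : Fn K ι) :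
    pderiv K (0, a) (pullback g) = pullback (pderiv K a g) := by
  classical
  ext α
  by_cases h : α ∈ Set.range (Finsupp.embDomain (coordEmb ι))
  · obtain ⟨β, rfl⟩ := h
    have e : β.embDomain (coordEmb ι) + Finsupp.single (0, a) 1 =
        (β + Finsupp.single a 1).embDomain (coordEmb ι) := by
      rw [Finsupp.embDomain_add, Finsupp.embDomain_single]
      rfl
    rw [pullback_eq_rename, coeff_pderiv, e, coeff_embDomain_rename, coeff_embDomain_rename,
      coeff_pderiv]
    congr 3
    exact Finsupp.embDomain_apply_self (coordEmb ι) β a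
  · obtain ⟨⟨n, b⟩, hp, hn⟩ : ∃ p, α p ≠ 0 ∧ p ∉ Set.range (coordEmb ι) := by
      by_contra! h'
      exact h ((Finsupp.mem_range_embDomain_iff _ _).mpr fun p hp =>
        h' p (Finsupp.mem_support_iff.mp hp))
    rcases n with _ | n
    · exact absurd ⟨b, rfl⟩ hn
    · rw [coeff_pderiv, coeff_pullback_eq_zero hp, coeff_pullback_eq_zero (n := n) (a := b),
        zero_mul]
      simp [hp]

variable {m : ℕ} {v : ℕ × ι → JetFn K ι}

theorem finite_setOf_fst_lt (ι : Type*) [Finite ι] (m : ℕ) : {p : ℕ × ι | p.1 < m}.Finite :=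
  ((Set.finite_lt_nat m).prod (Set.finite_univ (α := ι))).subset fun _ hp => ⟨hp, Set.mem_univ _⟩

theorem LowersWeight.jetSummable (hv : LowersWeight m v) : JetSummable v := fun w =>
  (finite_setOf_fst_lt ι (w + m)).subset fun _ hp => by
    by_contra h
    exact hp (hv.mem (not_lt.mp h))

theorem LowersWeight.jetSummable_mul (hv : LowersWeight m v) (c : ℕ × ι → JetFn K ι) :
    JetSummable fun p => v p * c p := hv.jetSummable.mul_right c

/-- The derivation of the ring of functions given by a vector field. -/
def fieldDerivation (v : ℕ × ι → JetFn K ι) (hv : LowersWeight m v) :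
    Derivation K (JetFn K ι) (JetFn K ι) :=
  Derivation.mk'
    { toFun := vectorField v
      map_add' := fun f g => by
        rw [vectorField, vectorField, vectorField,
          ← formalSum_add (hv.jetSummable_mul _) (hv.jetSummable_mul _)]
        simp only [map_add, mul_add]
      map_smul' := fun c f => by
        rw [vectorField, vectorField, RingHom.id_apply, ← formalSum_smul]
        simp only [Derivation.map_smul, mul_smul_comm] }
    fun f g => by
      change vectorField v (f * g) = f • vectorField v g + g • vectorField v f
      rw [vectorField, vectorField, vectorField, smul_eq_mul, smul_eq_mul,
        ← mul_formalSum _ (hv.jetSummable_mul _), ← mul_formalSum _ (hv.jetSummable_mul _),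
        ← formalSum_add ((hv.jetSummable_mul _).mul_left _) ((hv.jetSummable_mul _).mul_left _)]
      congr 1
      funext p
      rw [Derivation.leibniz, smul_eq_mul, smul_eq_mul]
      ring

@[simp] theorem fieldDerivation_apply (hv : LowersWeight m v) (f : JetFn K ι) :
    fieldDerivation v hv f = vectorField v f := rfl

theorem vectorField_eq_sum_of_pderiv_eq_zero (v : ℕ × ι → JetFn K ι) {f : JetFn K ι}
    (hf : ∀ n a, pderiv K (n + 1, a) f = 0) :
    vectorField v f = ∑ a, v (0, a) * pderiv K (0, a) f := by
  classical
  rw [vectorField, formalSum_eq_sum (Finset.univ.map (coordEmb ι)), Finset.sum_map]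
  · rfl
  · rintro ⟨n, a⟩ h
    rcases n with _ | n
    · exact (h (Finset.mem_map.mpr ⟨a, Finset.mem_univ _, rfl⟩)).elim
    · rw [hf, mul_zero]

theorem vectorField_pullback (v : ℕ × ι → JetFn K ι) (g : Fn K ι) :
    vectorField v (pullback g) = ∑ a, v (0, a) * pullback (pderiv K a g) := by
  rw [vectorField_eq_sum_of_pderiv_eq_zero _ fun n a => pderiv_succ_pullback n a g]
  simp only [pderiv_pullback]

theorem vectorField_sum {T : Type*} (s : Finset T) (c : T → JetFn K ι)
    (v : T → ℕ × ι → JetFn K ι) (hv : ∀ x ∈ s, ∃ m, LowersWeight m (v x)) (f : JetFn K ι) :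
    vectorField (fun p => ∑ x ∈ s, c x * v x p) f = ∑ x ∈ s, c x * vectorField (v x) f := by
  have h : ∀ x ∈ s, JetSummable fun p => v x p * pderiv K p f := fun x hx => by
    obtain ⟨m, hm⟩ := hv x hx
    exact hm.jetSummable_mul _
  calc vectorField (fun p => ∑ x ∈ s, c x * v x p) f
      = formalSum fun p => ∑ x ∈ s, c x * (v x p * pderiv K p f) := by
        simp only [vectorField, Finset.sum_mul, mul_assoc]
    _ = ∑ x ∈ s, formalSum fun p => c x * (v x p * pderiv K p f) :=
        formalSum_finsetSum s fun x hx => (h x hx).mul_left _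
    _ = _ := Finset.sum_congr rfl fun x hx => mul_formalSum _ (h x hx)

/-- Continuity for the filtration: both sides agree modulo weight `w` with one finite partial sum,
chosen at level `w + m` because the field may lower the weight by `m`. -/
theorem LowersWeight.vectorField_formalSum {J : Type*} (hv : LowersWeight m v)
    {G : J → JetFn K ι} (hG : JetSummable G) :
    vectorField v (formalSum G) = formalSum fun j => vectorField v (G j) := by
  classical
  refine sub_eq_zero.mp (eq_zero_of_forall_mem_wIdeal fun w => ?_)
  have h1 := hv.vectorField_mem (formalSum_sub_sum_mem (G := G) (hG (w + m)).toFinset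
    fun j hj => by simpa using hj)
  have h2 := formalSum_sub_sum_mem (w := w) (G := fun j => vectorField v (G j))
    (hG (w + m)).toFinset fun j hj => hv.vectorField_mem (by simpa using hj)
  rw [← fieldDerivation_apply hv, map_sub, map_sum] at h1
  have h3 := Ideal.sub_mem _ h1 h2
  simpa using h3

end VectorField

namespace FrobeniusManifold

variable {K ι : Type*} [Field K] [Fintype ι] [DecidableEq ι] (M : FrobeniusManifold K ι)

/-! ### The total derivative -/

/-- Only `u_1` has a constant term, namely `e`; giving up one unit of weight makes the bound uniform
in `n`. -/
theorem u_mem_wIdeal (n : ℕ) (a : ι) : M.u (n + 1) a ∈ wIdeal n := by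
  rw [u]
  rcases n with _ | n
  · exact mem_wIdeal_zero _
  · rw [if_neg (by omega), map_zero, add_zero]
    exact wIdeal_anti (by simp) (X_mem_wIdeal (n + 2, a))

theorem dt_lowersWeight : LowersWeight 0 fun p : ℕ × ι => M.u (p.1 + 1) p.2 := fun p =>
  M.u_mem_wIdeal p.1 p.2

/-- The total derivative as a derivation. -/
def dtD : Derivation K (JetFn K ι) (JetFn K ι) := fieldDerivation _ M.dt_lowersWeight

theorem dtD_apply (f : JetFn K ι) : M.dtD f = M.dt f := rfl

theorem dilaton_lowersWeight :
    LowersWeight 1 fun p : ℕ × ι => (p.1 : JetFn K ι) * M.u p.1 p.2 := fun p => by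
  refine Ideal.mul_mem_left _ _ ?_
  obtain ⟨n, a⟩ := p
  rcases n with _ | n
  · exact mem_wIdeal_zero _
  · exact M.u_mem_wIdeal n a

theorem dilaton_pullback (g : Fn K ι) : M.dilaton (pullback g) = 0 := by
  rw [dilaton, vectorField_pullback]
  simp

/-- The derivative along the unit field. -/
def unitDeriv (f : JetFn K ι) : JetFn K ι := ∑ a, M.e a • pderiv K (0, a) f

theorem unitDeriv_add (f g : JetFn K ι) : M.unitDeriv (f + g) = M.unitDeriv f + M.unitDeriv g := by
  simp only [unitDeriv, map_add, smul_add, Finset.sum_add_distrib]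

theorem unitDeriv_sum {T : Type*} (s : Finset T) (f : T → JetFn K ι) :
    M.unitDeriv (∑ x ∈ s, f x) = ∑ x ∈ s, M.unitDeriv (f x) := by
  simp only [unitDeriv, map_sum, Finset.smul_sum]
  exact Finset.sum_comm

theorem unitDeriv_mul (f g : JetFn K ι) :
    M.unitDeriv (f * g) = M.unitDeriv f * g + f * M.unitDeriv g := by
  simp only [unitDeriv, Derivation.leibniz, smul_eq_mul, smul_add, Finset.sum_add_distrib,
    Finset.sum_mul, Finset.mul_sum, smul_mul_assoc, mul_smul_comm]
  rw [add_comm]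
  congr 1
  exact Finset.sum_congr rfl fun a _ => by rw [mul_comm]

theorem unitDeriv_pullback (g : Fn K ι) :
    M.unitDeriv (pullback g) = pullback (∑ a, M.e a • pderiv K a g) := by
  simp only [unitDeriv, pderiv_pullback, map_sum, map_smul]

theorem pderiv_zero_u_succ (n : ℕ) (a b : ι) : pderiv K (0, a) (M.u (n + 1) b) = 0 := by
  rw [u, map_add, pderiv_C, add_zero, pderiv_X_of_ne]
  simp

/-- The coefficients `u_{n+1}` of `∂` do not involve the coordinates of order zero, so `∂` commutes
with every `∂/∂u^a_0`. -/
theorem unitDeriv_dt {f : JetFn K ι} (hf : M.unitDeriv f = 0) : M.unitDeriv (M.dt f) = 0 := by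
  have h : ∀ a, pderiv K (0, a) (M.dt f) = M.dtD (pderiv K (0, a) f) := fun a => by
    rw [dtD_apply, dt, vectorField, pderiv_formalSum _ (M.dt_lowersWeight.jetSummable_mul _)]
    rw [vectorField]
    congr 1
    funext p
    rw [Derivation.leibniz, M.pderiv_zero_u_succ, smul_zero, add_zero, smul_eq_mul, pderiv_comm]
  have h' : M.unitDeriv (M.dt f) = M.dtD (M.unitDeriv f) := by
    simp only [unitDeriv, h, map_sum, Derivation.map_smul]
  rw [h', hf, map_zero]

/-- On functions which are constant along the unit field, the total derivative raises the weight. -/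
theorem dt_mem_wIdeal {w : ℕ} {f : JetFn K ι} (h : M.unitDeriv f = 0) (hf : f ∈ wIdeal w) :
    M.dt f ∈ wIdeal (w + 1) := by
  -- The only part of `∂` that does not raise the weight comes from the constant term `e` of `u_1`.
  -- It is the derivative along the unit field, which vanishes on `f`.
  have e : M.dt f = formalSum fun p : ℕ × ι => (X (p.1 + 1, p.2) : JetFn K ι) * pderiv K p f := by
    have h1 : ∀ p : ℕ × ι, M.u (p.1 + 1) p.2 * pderiv K p f =
        (X (p.1 + 1, p.2) : JetFn K ι) * pderiv K p f +
          C (if p.1 + 1 = 1 then M.e p.2 else 0) * pderiv K p f := fun p => by rw [u, add_mul]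
    have h2 : ∀ p : ℕ × ι, p ∉ Finset.univ.map (coordEmb ι) →
        (C (if p.1 + 1 = 1 then M.e p.2 else 0) : JetFn K ι) * pderiv K p f = 0 := by
      rintro ⟨n, a⟩ hp
      rcases n with _ | n
      · exact (hp (Finset.mem_map.mpr ⟨a, Finset.mem_univ _, rfl⟩)).elim
      · simp
    rw [dt, vectorField]
    simp only [h1]
    rw [formalSum_add, formalSum_eq_sum _ h2, Finset.sum_map, add_eq_left, ← h, unitDeriv]
    · exact Finset.sum_congr rfl fun a _ => by simp [show coordEmb ι a = (0, a) from rfl, smul_eq_C_mul]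
    · have : LowersWeight 0 fun p : ℕ × ι => (X (p.1 + 1, p.2) : JetFn K ι) := fun p =>
        wIdeal_anti (by simp) (X_mem_wIdeal _)
      exact this.jetSummable_mul _
    · exact jetSummable_of_finite ((Finset.finite_toSet (Finset.univ.map (coordEmb ι))).subset
        fun p hp => by
          by_contra hc
          exact hp (h2 p hc))
  rw [e]
  refine formalSum_mem fun p => ?_
  rcases le_or_gt p.1 w with hp | hp
  · refine wIdeal_anti (w := p.1 + 1 + (w - p.1)) (by omega)
      (mul_mem_wIdeal_add (X_mem_wIdeal (p.1 + 1, p.2)) (pderiv_mem_wIdeal p ?_))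
    rwa [Nat.sub_add_cancel hp]
  · exact Ideal.mul_mem_right _ _ (wIdeal_anti (by simpa using hp.le) (X_mem_wIdeal (p.1 + 1, p.2)))

end FrobeniusManifold

end JetFrobenius

end

noncomputable section

namespace JetFrobenius

open MvPowerSeries

/-! ## The fields `σ_{k,a}` and `∂_{k,a}` -/

namespace FrobeniusManifold

variable {K ι : Type*} [Field K] [Fintype ι] [DecidableEq ι] (M : FrobeniusManifold K ι)

theorem 𝓧_apply (a b : ι) : M.𝓧 a b = ∑ d, M.u 1 d * pullback (M.A d a b) := by
  simp only [𝓧, Matrix.sum_apply, Matrix.smul_apply, Matrix.map_apply, smul_eq_mul]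

theorem dt_pullback (g : Fn K ι) :
    M.dt (pullback g) = ∑ a, M.u 1 a * pullback (pderiv K a g) := by
  rw [dt, vectorField_pullback]

theorem map_dt_zero {l m : Type*} : (0 : Matrix l m (JetFn K ι)).map M.dt = 0 := by
  ext a b : 1
  exact M.dtD.map_zero

theorem map_dt_mul {l m : Type*} (F : Matrix l ι (JetFn K ι)) (G : Matrix ι m (JetFn K ι)) :
    (F * G).map M.dt = F.map M.dt * G + F * G.map M.dt := by
  ext a b : 1
  simp only [Matrix.map_apply, Matrix.mul_apply, Matrix.add_apply, ← dtD_apply, map_sum,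
    Derivation.leibniz, smul_eq_mul, ← Finset.sum_add_distrib]
  exact Finset.sum_congr rfl fun _ _ => by ring

theorem map_dt_sum {l m T : Type*} (s : Finset T) (F : T → Matrix l m (JetFn K ι)) :
    (∑ x ∈ s, F x).map M.dt = ∑ x ∈ s, (F x).map M.dt := by
  ext a b : 1
  simp only [Matrix.map_apply, Matrix.sum_apply, ← dtD_apply, map_sum]

/-- Closedness exchanges the indices, so the derivative of `A_d` along `e` is `∂_d` of `A_e`, a
constant matrix. -/
theorem sum_e_smul_pderiv (d a b : ι) : ∑ c, M.e c • pderiv K c (M.A d a b) = 0 := by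
  simp only [M.closed _ d, ← Derivation.map_smul, ← map_sum, M.unit]
  split_ifs <;> simp

theorem unitDeriv_𝓧 (a b : ι) : M.unitDeriv (M.𝓧 a b) = 0 := by
  rw [𝓧_apply, unitDeriv_sum]
  refine Finset.sum_eq_zero fun d _ => ?_
  rw [unitDeriv_mul, unitDeriv_pullback, sum_e_smul_pderiv, map_zero, mul_zero, add_zero, unitDeriv]
  simp [pderiv_zero_u_succ M 0]

/-- On the part with no variables of order one, `u_1` is `e`, and `A_e` is the identity. -/
theorem 𝓧_sub_one_mem (a b : ι) :
    M.𝓧 a b - (1 : Matrix ι ι (JetFn K ι)) a b ∈ wIdeal 1 := by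
  have h : M.𝓧 a b - (1 : Matrix ι ι (JetFn K ι)) a b =
      ∑ d, (X (1, d) : JetFn K ι) * pullback (M.A d a b) := by
    have h1 : ∑ d, C (M.e d) * pullback (M.A d a b) = (1 : Matrix ι ι (JetFn K ι)) a b := by
      have := congrArg (pullback (K := K) (ι := ι)) (M.unit a b)
      rw [map_sum] at this
      simp only [map_smul] at this
      simp only [smul_eq_C_mul] at this
      rw [this, Matrix.one_apply]
      split_ifs <;> simp
    rw [𝓧_apply, ← h1, sub_eq_iff_eq_add, ← Finset.sum_add_distrib]
    exact Finset.sum_congr rfl fun d _ => by rw [u, if_pos rfl, add_mul]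
  rw [h]
  exact Ideal.sum_mem _ fun d _ => Ideal.mul_mem_right _ _ (X_mem_wIdeal (1, d))

theorem faaDiBruno_succ_zero (n : ℕ) : M.faaDiBruno (n + 1) 0 = (M.faaDiBruno n 0).map M.dt := by
  rw [faaDiBruno]

theorem faaDiBruno_succ_succ (n k : ℕ) : M.faaDiBruno (n + 1) (k + 1) =
    (M.faaDiBruno n (k + 1)).map M.dt + M.𝓧 * M.faaDiBruno n k := by
  rw [faaDiBruno]

theorem faaDiBruno_eq_zero {n k : ℕ} (h : n < k) : M.faaDiBruno n k = 0 := by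
  induction n generalizing k with
  | zero =>
    obtain ⟨k, rfl⟩ := Nat.exists_eq_succ_of_ne_zero (by omega : k ≠ 0)
    rw [faaDiBruno]
  | succ n ih =>
    obtain ⟨k, rfl⟩ := Nat.exists_eq_succ_of_ne_zero (by omega : k ≠ 0)
    rw [Nat.succ_eq_add_one, faaDiBruno_succ_succ, ih (by omega), ih (by omega), map_dt_zero,
      Matrix.mul_zero, add_zero]

theorem unitDeriv_faaDiBruno (n k : ℕ) (a b : ι) : M.unitDeriv (M.faaDiBruno n k a b) = 0 := by
  induction n generalizing k a b with
  | zero =>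
    rcases k with _ | k
    · rw [faaDiBruno, unitDeriv_𝓧]
    · rw [faaDiBruno, Matrix.zero_apply, unitDeriv]
      simp
  | succ n ih =>
    rcases k with _ | k
    · rw [faaDiBruno_succ_zero, Matrix.map_apply, unitDeriv_dt _ (ih _ _ _)]
    · rw [faaDiBruno_succ_succ, Matrix.add_apply, Matrix.map_apply, unitDeriv_add,
        unitDeriv_dt _ (ih _ _ _), zero_add, Matrix.mul_apply, unitDeriv_sum]
      refine Finset.sum_eq_zero fun c _ => ?_
      rw [unitDeriv_mul, unitDeriv_𝓧, ih, zero_mul, mul_zero, add_zero]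

/-- The top coefficient of `(∂ + z 𝓧)^n 𝓧` is the power `𝓧^{n+1}`, and `𝓧` is congruent to `1`. -/
theorem faaDiBruno_self_sub_one_mem (n : ℕ) (a b : ι) :
    M.faaDiBruno n n a b - (1 : Matrix ι ι (JetFn K ι)) a b ∈ wIdeal 1 := by
  induction n generalizing a b with
  | zero => rw [faaDiBruno]; exact M.𝓧_sub_one_mem a b
  | succ n ih =>
    have e : M.faaDiBruno (n + 1) (n + 1) - 1 =
        (M.𝓧 - 1) * M.faaDiBruno n n + (M.faaDiBruno n n - 1) := by
      rw [faaDiBruno_succ_succ, faaDiBruno_eq_zero M (Nat.lt_succ_self n), map_dt_zero, zero_add]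
      noncomm_ring
    rw [← Matrix.sub_apply, e, Matrix.add_apply, Matrix.mul_apply]
    exact Ideal.add_mem _ (Ideal.sum_mem _ fun c _ => Ideal.mul_mem_right _ _ (M.𝓧_sub_one_mem a c))
      (ih a b)

theorem dt_one : M.dt 1 = 0 := M.dtD.map_one_eq_zero

theorem dt_faaDiBruno_self_mem (n : ℕ) (a b : ι) : M.dt (M.faaDiBruno n n a b) ∈ wIdeal 2 := by
  have h1 : M.dt ((1 : Matrix ι ι (JetFn K ι)) a b) = 0 ∧
      M.unitDeriv ((1 : Matrix ι ι (JetFn K ι)) a b) = 0 := by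
    rw [Matrix.one_apply]
    split_ifs
    · exact ⟨M.dt_one, by simp [unitDeriv]⟩
    · exact ⟨M.dtD.map_zero, by simp [unitDeriv]⟩
  -- Subtracting the constant `1`, which `∂` kills, leaves weight one; the total derivative then
  -- adds one more unit.
  have h2 : M.dt (M.faaDiBruno n n a b - (1 : Matrix ι ι (JetFn K ι)) a b) ∈ wIdeal 2 := by
    refine M.dt_mem_wIdeal ?_ (M.faaDiBruno_self_sub_one_mem n a b)
    rw [sub_eq_add_neg, unitDeriv_add, unitDeriv_faaDiBruno, zero_add]
    have := h1.2
    simp only [unitDeriv, map_neg, smul_neg, Finset.sum_neg_distrib] at this ⊢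
    rw [this, neg_zero]
  rwa [← dtD_apply, map_sub, dtD_apply, dtD_apply, h1.1, sub_zero] at h2

/-- The coefficient of `z^k` contains `n - k` total derivatives, each gaining one unit of weight on
functions constant along `e`. The extra unit appears because the first derivative to act sees only
the non-constant part of a power of `𝓧`. -/
theorem faaDiBruno_mem {n k : ℕ} (h : k < n) (a b : ι) :
    M.faaDiBruno n k a b ∈ wIdeal (n - k + 1) := by
  have hdt : ∀ n k, (k < n → ∀ a b, M.faaDiBruno n k a b ∈ wIdeal (n - k + 1)) → k ≤ n → ∀ a b,
      M.dt (M.faaDiBruno n k a b) ∈ wIdeal (n + 1 - k + 1) := by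
    intro n k ih hk a b
    rcases hk.lt_or_eq with hk | rfl
    · have := M.dt_mem_wIdeal (M.unitDeriv_faaDiBruno n k a b) (ih hk a b)
      rwa [show n + 1 - k + 1 = n - k + 1 + 1 by omega]
    · rw [show k + 1 - k + 1 = 2 by omega]
      exact M.dt_faaDiBruno_self_mem k a b
  induction n generalizing k a b with
  | zero => omega
  | succ n ih =>
    rcases k with _ | k
    · rw [faaDiBruno_succ_zero, Matrix.map_apply]
      exact hdt n 0 (fun h a b => ih h a b) (Nat.zero_le n) a b
    · rw [faaDiBruno_succ_succ, Matrix.add_apply, Matrix.map_apply, Matrix.mul_apply]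
      refine Ideal.add_mem _ (hdt n (k + 1) (fun h a b => ih h a b) (by omega) a b)
        (Ideal.sum_mem _ fun c _ => Ideal.mul_mem_left _ _ ?_)
      rw [show n + 1 - (k + 1) + 1 = n - k + 1 by omega]
      exact ih (by omega) c b

theorem faaDiBruno_lowersWeight (k : ℕ) (a : ι) :
    LowersWeight k fun p : ℕ × ι => M.faaDiBruno p.1 k a p.2 := fun p => by
  rcases lt_or_ge k p.1 with h | h
  · exact wIdeal_anti (Nat.le_succ _) (M.faaDiBruno_mem h a p.2)
  · rw [Nat.sub_eq_zero_of_le h]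
    exact mem_wIdeal_zero _

theorem σ_natCast (k : ℕ) (a : ι) :
    M.σ k a = vectorField fun p => M.faaDiBruno p.1 k a p.2 := by
  rw [σ, if_pos (Int.natCast_nonneg k), Int.toNat_natCast]

theorem σ_of_neg {k : ℤ} (hk : k < 0) (a : ι) : M.σ k a = 0 := by
  rw [σ, if_neg (not_le.mpr hk)]

/-- The vector field `σ_{k,a}` as a derivation. -/
def σD (k : ℕ) (a : ι) : Derivation K (JetFn K ι) (JetFn K ι) :=
  fieldDerivation _ (M.faaDiBruno_lowersWeight k a)

theorem σD_apply (k : ℕ) (a : ι) (f : JetFn K ι) : M.σD k a f = M.σ k a f := by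
  rw [σ_natCast]
  rfl

theorem σ_zero_pullback (a : ι) (g : Fn K ι) :
    M.σ 0 a (pullback g) = ∑ d, M.𝓧 a d * pullback (pderiv K d g) := by
  have h := M.σ_natCast 0 a
  rw [Nat.cast_zero] at h
  rw [h, vectorField_pullback]
  simp only [faaDiBruno]

theorem σ_succ_pullback (k : ℕ) (a : ι) (g : Fn K ι) :
    M.σ (k + 1 : ℕ) a (pullback g) = 0 := by
  rw [σ_natCast, vectorField_pullback]
  simp [faaDiBruno]

/-- A function of dilaton weight `-1` which is annihilated by the `σ_{l,a}` with `1 ≤ l < m` has no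
monomials of weight less than `m`. -/
theorem mem_wIdeal_of_σ_eq_zero [CharZero K] {m : ℕ} (hm : 2 ≤ m) {g : JetFn K ι}
    (hσ : ∀ l : ℕ, 1 ≤ l → l < m → ∀ a, M.σ l a g = 0) (hQ : M.dilaton g = -g) :
    g ∈ wIdeal m := by
  classical
  -- The system is triangular: `σ_{l,a}` is `∂/∂u^a_l` plus corrections. A correction with
  -- coefficient of positive weight sees only monomials of `g` of weight strictly between `0` and
  -- `w`. Hence a variable of order `l ≥ 1` can be stripped from the monomial.
  have key : ∀ w, ∀ α : ℕ × ι →₀ ℕ, jetWeight α = w → 0 < w → w < m → coeff α g = 0 := by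
    intro w
    induction w using Nat.strong_induction_on with
    | _ w ih =>
    intro α hα hw hwm
    obtain ⟨⟨l, a⟩, hp, hl⟩ : ∃ p : ℕ × ι, α p ≠ 0 ∧ 1 ≤ p.1 := by
      by_contra! h
      have : jetWeight α = 0 := by
        rw [jetWeight, Finsupp.weight_apply, Finsupp.sum]
        refine Finset.sum_eq_zero fun p hp => ?_
        rw [Nat.lt_one_iff.mp (h p (Finsupp.mem_support_iff.mp hp)), smul_zero]
      omega
    obtain ⟨β, rfl⟩ : ∃ β, α = β + Finsupp.single (l, a) 1 :=
      ⟨α - Finsupp.single (l, a) 1, (tsub_add_cancel_of_le (by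
        rw [Finsupp.single_le_iff]; exact Nat.one_le_iff_ne_zero.mpr hp)).symm⟩
    rw [map_add, jetWeight_single] at hα
    dsimp only at hα hl
    have h0 : coeff β (M.σ l a g) = 0 := by rw [hσ l hl (by omega) a, map_zero]
    rw [σ_natCast, vectorField, coeff_formalSum, finsum_eq_single _ (l, a)] at h0
    · have h1 : coeff β ((M.faaDiBruno l l a a - 1) * pderiv K (l, a) g) = 0 := by
        rw [coeff_mul]
        refine Finset.sum_eq_zero fun x hx => ?_
        have hx := congrArg jetWeight (Finset.HasAntidiagonal.mem_antidiagonal.mp hx)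
        rw [map_add] at hx
        rcases Nat.eq_zero_or_pos (jetWeight x.1) with h | h
        · have := M.faaDiBruno_self_sub_one_mem l a a x.1 (by omega)
          rw [Matrix.one_apply_eq] at this
          rw [this, zero_mul]
        · rw [coeff_pderiv, ih (jetWeight x.2 + l) (by omega) _ _ (by omega) (by omega), zero_mul,
            mul_zero]
          rw [map_add, jetWeight_single]
      rw [sub_mul, one_mul, map_sub, h0, zero_sub, neg_eq_zero, coeff_pderiv] at h1
      exact (mul_eq_zero.mp h1).resolve_right (Nat.cast_add_one_ne_zero (β (l, a)))
    · rintro ⟨n, b⟩ hq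
      dsimp only
      rw [coeff_mul]
      refine Finset.sum_eq_zero fun x hx => ?_
      have hx := congrArg jetWeight (Finset.HasAntidiagonal.mem_antidiagonal.mp hx)
      rw [map_add] at hx
      rcases lt_trichotomy n l with hn | rfl | hn
      · rw [faaDiBruno_eq_zero M hn, Matrix.zero_apply, map_zero, zero_mul]
      · rcases Nat.eq_zero_or_pos (jetWeight x.1) with h | h
        · have hab : a ≠ b := fun hab => hq (by rw [hab])
          have := M.faaDiBruno_self_sub_one_mem n a b x.1 (by omega)
          rw [Matrix.one_apply_ne hab, sub_zero] at this
          rw [this, zero_mul]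
        · rw [coeff_pderiv, ih (jetWeight x.2 + n) (by omega) _ _ (by omega) (by omega), zero_mul,
            mul_zero]
          rw [map_add, jetWeight_single]
      · rcases Nat.lt_or_ge (jetWeight x.1) (n - l + 1) with h | h
        · rw [M.faaDiBruno_mem hn a b x.1 h, zero_mul]
        · rw [coeff_pderiv, ih (jetWeight x.2 + n) (by omega) _ _ (by omega) (by omega), zero_mul,
            mul_zero]
          rw [map_add, jetWeight_single]
  intro α hα
  rcases Nat.eq_zero_or_pos (jetWeight α) with h | h
  -- In weight zero, only the constant `e` in `u_1` could let the dilaton field contribute. It reads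
  -- a coefficient of `g` of weight one, which vanishes by `key`; this is where `m ≥ 2` is needed.
  · have h0 : coeff α (M.dilaton g) = 0 := by
      rw [dilaton, vectorField, coeff_formalSum]
      refine finsum_eq_zero_of_forall_eq_zero ?_
      rintro ⟨n, b⟩
      dsimp only
      rcases n with _ | n
      · simp
      · rw [mul_assoc, u, add_mul, mul_add, map_add]
        have h1 : coeff α (((n + 1 : ℕ) : JetFn K ι) *
            ((X (n + 1, b) : JetFn K ι) * pderiv K (n + 1, b) g)) = 0 :=
          Ideal.mul_mem_left _ _ (Ideal.mul_mem_right _ (wIdeal (K := K) (ι := ι) (n + 1))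
            (X_mem_wIdeal (n + 1, b))) α (by omega)
        rw [h1, zero_add]
        rcases n with _ | n
        · rw [if_pos rfl, ← map_natCast (C : K →+* JetFn K ι), coeff_C_mul, coeff_C_mul, coeff_pderiv,
            key 1 _ _ one_pos (by omega), zero_mul, mul_zero, mul_zero]
          rw [map_add, jetWeight_single, h, zero_add]
        · rw [if_neg (by omega), map_zero, zero_mul, mul_zero, map_zero]
    rwa [hQ, map_neg, neg_eq_zero] at h0
  · exact key _ α rfl h hα

/-! ### The affine structure -/

/-- The coefficients of `Θ(z)`, pulled back to the jet-space. -/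
def jetCoeff (Θ : Matrix ι ι (PowerSeries (Fn K ι))) (j : ℕ) : Matrix ι ι (JetFn K ι) :=
  (zCoeff j Θ).map pullback

variable {Θ : Matrix ι ι (PowerSeries (Fn K ι))}

variable {M} in
theorem jetCoeff_zero (hΘ : M.IsFundamentalSolution Θ) : jetCoeff Θ 0 = 1 := by
  rw [jetCoeff, hΘ.1, Matrix.map_one _ (map_zero _) (map_one _)]

variable {M} in
theorem map_dt_jetCoeff_succ (hΘ : M.IsFundamentalSolution Θ) (j : ℕ) :
    (jetCoeff Θ (j + 1)).map M.dt = jetCoeff Θ j * M.𝓧 := by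
  ext a b : 1
  have h : ∀ d, pderiv K d (zCoeff (j + 1) Θ a b) = (zCoeff j Θ * M.A d) a b := fun d => by
    rw [← hΘ.2 d j, Matrix.map_apply]
  rw [Matrix.map_apply, jetCoeff, Matrix.map_apply, dt_pullback, Matrix.mul_apply]
  simp only [h, Matrix.mul_apply, map_sum, map_mul, 𝓧_apply, Finset.mul_sum]
  rw [Finset.sum_comm]
  exact Finset.sum_congr rfl fun c _ => Finset.sum_congr rfl fun d _ => by
    rw [jetCoeff, Matrix.map_apply]; ring

variable {M} in
-- From `∂Θ = z Θ 𝓧` one gets `∂ (Θ F) = Θ (∂ + z 𝓧) F`, hence `∂^{n+1} Θ = z Θ (∂ + z 𝓧)^n 𝓧`. This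
-- is the source of `∂(z) = Θ(z) σ(z)`.
theorem iterate_dt_jetCoeff (hΘ : M.IsFundamentalSolution Θ) (n k : ℕ) (a b : ι) :
    M.dt^[n + 1] (jetCoeff Θ (k + 1) a b) =
      (∑ ij ∈ Finset.HasAntidiagonal.antidiagonal k, jetCoeff Θ ij.1 * M.faaDiBruno n ij.2) a b := by
  induction n generalizing a b with
  | zero =>
    have h := congrFun (congrFun (map_dt_jetCoeff_succ hΘ k) a) b
    rw [Matrix.map_apply] at h
    rw [Function.iterate_one, h, Finset.sum_eq_single (k, 0), faaDiBruno]
    · rintro ⟨i, j⟩ hij hne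
      rw [Finset.HasAntidiagonal.mem_antidiagonal] at hij
      dsimp only at hij ⊢
      rw [faaDiBruno_eq_zero M (by by_contra h; exact hne (by ext <;> dsimp only <;> omega)),
        Matrix.mul_zero]
    · simp
  | succ n ih =>
    have e : ∀ N : Matrix ι ι (JetFn K ι), M.dt (N a b) = N.map M.dt a b := fun _ => rfl
    rw [Function.iterate_succ_apply', ih, e, map_dt_sum]
    refine congrFun (congrFun ?_ a) b
    simp only [map_dt_mul]
    rw [Finset.sum_add_distrib]
    have h0 : (jetCoeff Θ 0).map M.dt = 0 := by
      rw [jetCoeff_zero hΘ]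
      ext a b : 1
      rw [Matrix.map_apply, Matrix.one_apply]
      split_ifs
      · exact M.dt_one
      · exact M.dtD.map_zero
    rcases k with _ | k
    · simp [h0, faaDiBruno_succ_zero]
      rfl
    · conv_rhs => rw [Finset.Nat.sum_antidiagonal_succ']
      rw [Finset.Nat.sum_antidiagonal_succ (f := fun ij => (jetCoeff Θ ij.1).map M.dt * _),
        Finset.Nat.sum_antidiagonal_succ' (f := fun ij => jetCoeff Θ ij.1 * _)]
      simp only [h0, Matrix.zero_mul, zero_add, map_dt_jetCoeff_succ hΘ, faaDiBruno_succ_zero,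
        faaDiBruno_succ_succ, Matrix.mul_add, Finset.sum_add_distrib, Matrix.mul_assoc]
      abel

variable {M} in
theorem flatField_eq_sum (hΘ : M.IsFundamentalSolution Θ) (k : ℕ) (a : ι) (f : JetFn K ι) :
    M.flatField Θ k a f = ∑ ij ∈ Finset.HasAntidiagonal.antidiagonal k, ∑ c,
      jetCoeff Θ ij.1 a c * M.σ ij.2 c f := by
  have h : (fun p : ℕ × ι => M.dt^[p.1 + 1] (pullback (zCoeff (k + 1) Θ a p.2))) =
      fun p => ∑ x ∈ Finset.HasAntidiagonal.antidiagonal k ×ˢ Finset.univ,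
        jetCoeff Θ x.1.1 a x.2 * M.faaDiBruno p.1 x.1.2 x.2 p.2 := by
    funext p
    have := iterate_dt_jetCoeff hΘ p.1 k a p.2
    rw [jetCoeff, Matrix.map_apply] at this
    rw [this, Finset.sum_product, Matrix.sum_apply]
    rfl
  rw [flatField, h, vectorField_sum, Finset.sum_product]
  · simp only [σ_natCast]
  · exact fun x _ => ⟨x.1.2, M.faaDiBruno_lowersWeight _ _⟩

variable {M} in
theorem flatField_lowersWeight (hΘ : M.IsFundamentalSolution Θ) (k : ℕ) (a : ι) :
    LowersWeight k fun p : ℕ × ι => M.dt^[p.1 + 1] (pullback (zCoeff (k + 1) Θ a p.2)) := by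
  intro p
  have h := iterate_dt_jetCoeff hΘ p.1 k a p.2
  rw [jetCoeff, Matrix.map_apply] at h
  change M.dt^[p.1 + 1] (pullback (zCoeff (k + 1) Θ a p.2)) ∈ _
  rw [h, Matrix.sum_apply]
  refine Ideal.sum_mem _ fun ij hij => ?_
  rw [Matrix.mul_apply]
  refine Ideal.sum_mem _ fun c _ => Ideal.mul_mem_left _ _ ?_
  rw [Finset.HasAntidiagonal.mem_antidiagonal] at hij
  exact wIdeal_anti (by omega) (M.faaDiBruno_lowersWeight ij.2 c p)

/-- The vector field `∂_{k,a}` as a derivation. -/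
def flatD (hΘ : M.IsFundamentalSolution Θ) (k : ℕ) (a : ι) :
    Derivation K (JetFn K ι) (JetFn K ι) :=
  fieldDerivation _ (flatField_lowersWeight hΘ k a)

theorem flatD_apply (hΘ : M.IsFundamentalSolution Θ) (k : ℕ) (a : ι) (f : JetFn K ι) :
    M.flatD hΘ k a f = M.flatField Θ k a f := rfl

end FrobeniusManifold

end JetFrobenius

end

noncomputable section

set_option linter.unusedSectionVars false

namespace JetFrobenius

open MvPowerSeries

namespace FrobeniusManifold

variable {K ι : Type*} [Field K] [Fintype ι] [DecidableEq ι] {M : FrobeniusManifold K ι}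
  {Θ : Matrix ι ι (PowerSeries (Fn K ι))} {t : ℤ → ι → JetFn K ι}

/-! ### Flat coordinates -/

theorem sum_jetCoeff_mul (S T : Matrix ι ι (PowerSeries (Fn K ι))) (n : ℕ) :
    ∑ ij ∈ Finset.HasAntidiagonal.antidiagonal n, jetCoeff S ij.1 * jetCoeff T ij.2 =
      jetCoeff (S * T) n := by
  ext a b : 1
  simp only [Matrix.sum_apply, Matrix.mul_apply, jetCoeff, zCoeff, Matrix.map_apply, map_sum,
    PowerSeries.coeff_mul, map_mul]
  exact Finset.sum_comm

theorem jetCoeff_one (n : ℕ) : jetCoeff (1 : Matrix ι ι (PowerSeries (Fn K ι))) n =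
    if n = 0 then 1 else 0 := by
  ext a b : 1
  simp only [jetCoeff, zCoeff, Matrix.map_apply, Matrix.one_apply]
  rcases eq_or_ne n 0 with rfl | hn <;> rcases eq_or_ne a b with rfl | hab <;>
    simp [PowerSeries.coeff_one, *]

theorem inv_eq_adjoint (h : M.adjoint Θ * Θ = 1) : Θ⁻¹ = M.adjoint Θ :=
  Matrix.inv_eq_left_inv h

theorem inv_mul_self (h : M.adjoint Θ * Θ = 1) : Θ⁻¹ * Θ = 1 := by
  rw [inv_eq_adjoint h, h]

theorem mul_inv_self (h : M.adjoint Θ * Θ = 1) : Θ * Θ⁻¹ = 1 :=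
  mul_eq_one_comm.mp (inv_mul_self h)

/-- Left cancellation of a power series with leading coefficient `1`, in a form suited to
coefficients obtained from vector fields. -/
theorem eq_of_sum_antidiagonal_mul_eq {R : Type*} [Ring R] {θ S T : ℕ → R} (h0 : θ 0 = 1)
    (h : ∀ n, ∑ ij ∈ Finset.HasAntidiagonal.antidiagonal n, θ ij.1 * S ij.2 =
      ∑ ij ∈ Finset.HasAntidiagonal.antidiagonal n, θ ij.1 * T ij.2) (n : ℕ) : S n = T n := by
  induction n using Nat.strong_induction_on with
  | _ n ih =>
  have h1 : ∑ ij ∈ Finset.HasAntidiagonal.antidiagonal n, θ ij.1 * (S ij.2 - T ij.2) = 0 := by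
    simp only [mul_sub, Finset.sum_sub_distrib, h n, sub_self]
  rw [Finset.sum_eq_single (0, n)] at h1
  · rw [h0, one_mul] at h1
    exact sub_eq_zero.mp h1
  · rintro ⟨i, j⟩ hij hne
    rw [Finset.HasAntidiagonal.mem_antidiagonal] at hij
    dsimp only at hij ⊢
    rw [ih j (by by_contra hj; exact hne (by ext <;> dsimp only <;> omega)), sub_self, mul_zero]
  · simp

/-- Since `∂(y) = Θ(y) σ(y)`, cancelling `Θ(y)` in the defining equation of `t(z)` leaves `σ(y) t(z)
= ∑ y^l z^{-l-1} Θ(z)⁻¹`. -/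
theorem σ_flatCoordinate (hΘ : M.IsFundamentalSolution Θ)
    (ht : M.IsFlatGeneratingFunction Θ t) (m : ℤ) (l : ℕ) (a b : ι) :
    M.σ l a (t m b) = if m ≤ l then jetCoeff Θ⁻¹ (l - m).toNat a b else 0 := by
  have h := eq_of_sum_antidiagonal_mul_eq (θ := jetCoeff Θ)
    (S := fun l => (Matrix.of fun a b => M.σ l a (t m b) : Matrix ι ι (JetFn K ι)))
    (T := fun l => if m ≤ l then jetCoeff Θ⁻¹ (l - m).toNat else 0) (jetCoeff_zero hΘ) ?_ l
  · have h' := congrFun (congrFun h a) b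
    rw [Matrix.of_apply] at h'
    rw [h']
    split_ifs <;> rfl
  · intro n
    ext a b : 1
    have h1 := ht.2 n a m b
    rw [flatField_eq_sum hΘ] at h1
    rw [Matrix.sum_apply, Matrix.sum_apply]
    simp only [Matrix.mul_apply, Matrix.of_apply]
    rw [h1, Finset.Nat.sum_antidiagonal_eq_sum_range_succ_mk, ← Finset.sum_range_reflect,
      Matrix.sum_apply, map_sum]
    refine Finset.sum_congr rfl fun i hi => ?_
    rw [Finset.mem_range] at hi
    have e : n + 1 - 1 - i = n - i := by omega
    have e' : n - (n - i) = i := by omega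
    dsimp only
    rw [e, e']
    split_ifs with hm
    · simp only [Matrix.mul_apply, map_sum, map_mul]
      rfl
    · simp

/-- The fields `σ_{l,a}` with `l < m` annihilate `t_m`. The resulting growth of weight makes `s(z)`
converge, and makes `t(-z)` a Laurent series modulo any weight. -/
theorem flatCoordinate_mem [CharZero K] (hΘ : M.IsFundamentalSolution Θ)
    (ht : M.IsFlatGeneratingFunction Θ t) {m : ℕ} (hm : 2 ≤ m) (b : ι) : t m b ∈ wIdeal m := by
  refine M.mem_wIdeal_of_σ_eq_zero hm (fun l _ hl a => ?_) (ht.1 m b)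
  rw [σ_flatCoordinate hΘ ht, if_neg]
  exact_mod_cast not_le.mpr hl

theorem flatCoordinate_mem_of_le [CharZero K] (hΘ : M.IsFundamentalSolution Θ)
    (ht : M.IsFlatGeneratingFunction Θ t) {w : ℕ} {k : ℤ} (h2 : 2 ≤ k) (hk : (w : ℤ) ≤ k) (b : ι) :
    t k b ∈ wIdeal w := by
  obtain ⟨m, rfl⟩ := Int.eq_ofNat_of_zero_le (by omega : 0 ≤ k)
  exact wIdeal_anti (by exact_mod_cast hk) (flatCoordinate_mem hΘ ht (by exact_mod_cast h2) b)

theorem sField_jetSummable [CharZero K] (hΘ : M.IsFundamentalSolution Θ)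
    (ht : M.IsFlatGeneratingFunction Θ t) (k : ℤ) (a : ι) :
    JetSummable fun j : ℕ => ∑ b, t (k + j) b * pullback (zCoeff j Θ b a) := by
  refine JetSummable.sum _ fun b _ => JetSummable.mul_right _ fun w => ?_
  refine (Set.finite_lt_nat (2 + w + k.natAbs)).subset fun j hj => ?_
  by_contra h
  rw [Set.mem_ofPred, not_lt] at h
  exact hj (flatCoordinate_mem_of_le hΘ ht (by omega) (by omega) b)

theorem dilaton_sField [CharZero K] (hΘ : M.IsFundamentalSolution Θ)
    (ht : M.IsFlatGeneratingFunction Θ t) (k : ℤ) (a : ι) :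
    M.dilaton (sField Θ t k a) = -sField Θ t k a := by
  rw [sField, dilaton, M.dilaton_lowersWeight.vectorField_formalSum (sField_jetSummable hΘ ht k a),
    ← neg_one_smul K (formalSum _), ← formalSum_smul]
  congr 1
  funext j
  rw [← fieldDerivation_apply M.dilaton_lowersWeight, map_sum, Finset.smul_sum]
  refine Finset.sum_congr rfl fun b _ => ?_
  rw [Derivation.leibniz, fieldDerivation_apply, fieldDerivation_apply, ← dilaton, dilaton_pullback,
    ht.1, smul_zero, zero_add, smul_eq_mul, neg_one_smul]
  ring

/-- For `l ≥ 1` the field passes through `Θ(z)`, which depends on no derivatives, and leaves the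
coefficient of `z^{l-k}` in `Θ⁻¹ Θ = 1`. This exponent is positive. -/
theorem σ_sField [CharZero K] (hΘ : M.IsSymmetricFundamentalSolution Θ)
    (ht : M.IsFlatGeneratingFunction Θ t) {k : ℤ} (hk : k ≤ 0) {l : ℕ} (hl : 1 ≤ l) (c a : ι) :
    M.σ l c (sField Θ t k a) = 0 := by
  obtain ⟨l, rfl⟩ := Nat.exists_eq_succ_of_ne_zero (by omega : l ≠ 0)
  obtain ⟨n, hn⟩ := Int.eq_ofNat_of_zero_le (by omega : 0 ≤ (l.succ : ℤ) - k)
  have h : ∀ j : ℕ, M.σ l.succ c (∑ b, t (k + j) b * pullback (zCoeff j Θ b a)) =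
      if j ≤ n then (jetCoeff Θ⁻¹ (n - j) * jetCoeff Θ j) c a else 0 := by
    intro j
    rw [← σD_apply, map_sum]
    simp only [Derivation.leibniz, σD_apply, σ_flatCoordinate hΘ.1 ht, smul_eq_mul,
      Nat.succ_eq_add_one, σ_succ_pullback, mul_zero, zero_add]
    split_ifs with h1 h2 h2
    · rw [Matrix.mul_apply]
      refine Finset.sum_congr rfl fun b _ => ?_
      rw [mul_comm, show (((l + 1 : ℕ) : ℤ) - (k + j)).toNat = n - j by omega]
      rfl
    · omega
    · omega
    · simp
  rw [sField, σ_natCast, (M.faaDiBruno_lowersWeight l.succ c).vectorField_formalSum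
    (sField_jetSummable hΘ.1 ht k a), ← σ_natCast]
  simp only [h]
  rw [formalSum_eq_sum (Finset.range (n + 1)) fun j hj => if_neg (by simpa using hj)]
  have h0 := sum_jetCoeff_mul Θ⁻¹ Θ n
  rw [inv_mul_self hΘ.2.2, jetCoeff_one, if_neg (by omega),
    Finset.Nat.sum_antidiagonal_eq_sum_range_succ_mk, ← Finset.sum_range_reflect] at h0
  have h1 := congrFun (congrFun h0 c) a
  rw [Matrix.sum_apply, Matrix.zero_apply] at h1
  rw [← h1]
  refine Finset.sum_congr rfl fun j hj => ?_
  rw [Finset.mem_range] at hj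
  rw [if_pos (by omega)]
  dsimp only
  rw [show n + 1 - 1 - j = n - j by omega, show n - (n - j) = j by omega]

/-- The Euler–Lagrange equation: `s(z) = O(z⁻²)`. -/
theorem sField_eq_zero [CharZero K] (hΘ : M.IsSymmetricFundamentalSolution Θ)
    (ht : M.IsFlatGeneratingFunction Θ t) {k : ℤ} (hk : k ≤ 0) (a : ι) :
    sField Θ t k a = 0 := by
  -- Every `σ_l` with `l ≥ 1` annihilates the function, so the triangular argument applies with no
  -- upper bound on the weight.
  refine eq_zero_of_forall_mem_wIdeal fun w => ?_
  exact wIdeal_anti (Nat.le_add_left w 2) (M.mem_wIdeal_of_σ_eq_zero (Nat.le_add_right 2 w)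
    (fun l hl _ c => σ_sField hΘ ht hk hl c a) (dilaton_sField hΘ.1 ht k a))

/-! ### Passage to Laurent series -/

variable (A : Type*) [CommRing A] [Algebra (JetFn K ι) A]

/-- Power series in `z` of functions on the manifold, as Laurent series over an algebra over the
ring of functions on the jet-space. -/
def toL : PowerSeries (Fn K ι) →+* LaurentSeries A :=
  (HahnSeries.ofPowerSeries ℤ A).comp
    (PowerSeries.map ((algebraMap (JetFn K ι) A).comp (pullback : Fn K ι →ₐ[K] JetFn K ι).toRingHom))

variable {A}

theorem toL_apply (f : PowerSeries (Fn K ι)) : toL A f = HahnSeries.ofPowerSeries ℤ A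
    (PowerSeries.mk fun j => algebraMap (JetFn K ι) A (pullback (PowerSeries.coeff j f))) := by
  rw [toL, RingHom.comp_apply]
  congr 1
  ext j
  rw [PowerSeries.coeff_mk, PowerSeries.coeff_map]
  rfl

theorem coeff_toL (f : PowerSeries (Fn K ι)) (n : ℤ) : (toL A f).coeff n =
    if 0 ≤ n then algebraMap (JetFn K ι) A (pullback (PowerSeries.coeff n.toNat f)) else 0 := by
  rw [toL_apply, Laurent.coeff_ofPowerSeries, PowerSeries.coeff_mk]

theorem toL_X : toL A (PowerSeries.X : PowerSeries (Fn K ι)) = Laurent.z := by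
  rw [toL, RingHom.comp_apply, PowerSeries.map_X, HahnSeries.ofPowerSeries_X]

theorem toL_C (x : Fn K ι) :
    toL A (PowerSeries.C x) = HahnSeries.C (algebraMap (JetFn K ι) A (pullback x)) := by
  rw [toL, RingHom.comp_apply, PowerSeries.map_C, HahnSeries.ofPowerSeries_C]
  rfl

theorem euler_toL (f : PowerSeries (Fn K ι)) : Laurent.euler (toL A f) =
    toL A (PowerSeries.X * PowerSeries.derivative (Fn K ι) f) := by
  ext n
  rw [Laurent.coeff_euler, coeff_toL, coeff_toL]
  split_ifs with h
  · obtain ⟨m, rfl⟩ := Int.eq_ofNat_of_zero_le h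
    rw [Int.toNat_natCast]
    rcases m with _ | m
    · simp
    · rw [PowerSeries.coeff_succ_X_mul, PowerSeries.coeff_derivative]
      simp only [map_mul, map_add, map_natCast, map_one, zsmul_eq_mul]
      push_cast
      ring
  · rw [smul_zero]

theorem neg_toL [Algebra K A] (f : PowerSeries (Fn K ι)) :
    Laurent.neg K (toL A f) = toL A (PowerSeries.evalNegHom f) := by
  ext n
  rw [Laurent.coeff_neg, coeff_toL, coeff_toL]
  split_ifs with h
  · obtain ⟨m, rfl⟩ := Int.eq_ofNat_of_zero_le h
    rw [Int.toNat_natCast, PowerSeries.evalNegHom, PowerSeries.coeff_rescale, zpow_natCast]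
    rw [Algebra.smul_def]
    simp only [map_mul, map_pow, map_neg, map_one]
  · rw [smul_zero]

theorem symbol_jetCoeff (S : Matrix ι ι (PowerSeries (Fn K ι))) :
    symbol A (jetCoeff S) = S.map (toL A) := by
  ext a b : 1
  rw [symbol, Matrix.map_apply, toL_apply]
  rfl

theorem map_toL_R (Θ : Matrix ι ι (PowerSeries (Fn K ι))) : (M.R Θ).map (toL A) =
    Θ.map (toL A) * M.deltaSymbol.map (toL A) * Θ⁻¹.map (toL A) +
      Θ.map (toL A) * Laurent.mEuler (Θ⁻¹.map (toL A)) := by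
  have h : Laurent.mEuler (Θ⁻¹.map (toL A)) = (Laurent.z : LaurentSeries A) •
      (Θ⁻¹.map (PowerSeries.derivative (Fn K ι))).map (toL A) := by
    ext a b : 1
    rw [Laurent.mEuler, Matrix.map_apply, Matrix.map_apply, euler_toL, map_mul, toL_X]
    rfl
  rw [R, Matrix.map_add _ (map_add _), Matrix.map_mul, Matrix.map_mul, h, Matrix.mul_smul,
    ← Matrix.map_mul (L := Θ) (M := Θ⁻¹.map (PowerSeries.derivative (Fn K ι)))]
  congr 1
  ext a b : 1
  exact (map_mul (toL A) _ _).trans (by rw [toL_X]; rfl)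

/-! ### The metric -/

/-- A constant matrix as a matrix of power series in `z`. -/
def constMatrix (N : Matrix ι ι K) : Matrix ι ι (PowerSeries (Fn K ι)) :=
  N.map fun x => PowerSeries.C (C x)

theorem constMatrix_mul (N N' : Matrix ι ι K) :
    (constMatrix (N * N') : Matrix ι ι (PowerSeries (Fn K ι))) = constMatrix N * constMatrix N' := by
  simp only [constMatrix]
  exact Matrix.map_mul (f := (PowerSeries.C : Fn K ι →+* _).comp (C : K →+* Fn K ι))

theorem constMatrix_one : (constMatrix 1 : Matrix ι ι (PowerSeries (Fn K ι))) = 1 :=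
  Matrix.map_one _ (by simp) (by simp)

theorem η_inv_mul_η : M.η⁻¹ * M.η = 1 := Matrix.nonsing_inv_mul _ M.η_nondeg

theorem η_mul_η_inv : M.η * M.η⁻¹ = 1 := Matrix.mul_nonsing_inv _ M.η_nondeg

theorem η_transpose : M.η.transpose = M.η := by
  ext a b
  exact M.η_symm b a

theorem η_inv_transpose : M.η⁻¹.transpose = M.η⁻¹ := by
  rw [Matrix.transpose_nonsing_inv, η_transpose]

/-- The shift `1 - r/2` in `μ` is half of the conformal weight `2 - r` of `η`, which makes `μ` skew
for the metric. -/
theorem μ_transpose_mul [CharZero K] : M.μ.transpose * M.η⁻¹ = -(M.η⁻¹ * M.μ) := by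
  have h : M.eulerLin * M.η + M.η * M.eulerLin.transpose = (2 - M.r) • M.η := by
    ext a b
    rw [Matrix.smul_apply, smul_eq_mul, ← M.η_euler a b, Matrix.add_apply, Matrix.mul_apply,
      Matrix.mul_apply]
    congr 1
    exact Finset.sum_congr rfl fun d _ => by rw [Matrix.transpose_apply, mul_comm]
  have h1 := congrArg (fun N => M.η⁻¹ * N * M.η⁻¹) h
  simp only [Matrix.mul_add, Matrix.add_mul, Matrix.mul_smul, Matrix.smul_mul, Matrix.mul_assoc,
    η_mul_η_inv, Matrix.mul_one] at h1
  rw [← Matrix.mul_assoc M.η⁻¹ M.η, η_inv_mul_η, Matrix.one_mul] at h1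
  rw [μ, Matrix.transpose_sub, Matrix.transpose_smul, Matrix.transpose_one, Matrix.sub_mul,
    Matrix.mul_sub, Matrix.smul_mul, Matrix.one_mul, Matrix.mul_smul, Matrix.mul_one,
    eq_sub_iff_add_eq'.mpr h1]
  module

/-- The invariance `η(X ∘ Y, Z) = η(X, Y ∘ Z)`, transferred to covectors by multiplying with `η⁻¹`
on both sides. -/
theorem A_transpose_mul (d : ι) : (M.A d).transpose * M.η⁻¹.map C = M.η⁻¹.map C * M.A d := by
  have h : M.A d * M.η.map C = M.η.map C * (M.A d).transpose := by
    ext a c : 1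
    have := M.η_mul a d c
    rw [Matrix.mul_apply, Matrix.mul_apply]
    simp only [Matrix.map_apply, Matrix.transpose_apply, ← smul_eq_C_mul, ← this, M.comm d a,
      mul_comm _ (C _ : Fn K ι)]
  have h1 := congrArg (fun N => M.η⁻¹.map C * N * M.η⁻¹.map C) h
  have e1 : M.η.map (C : K →+* Fn K ι) * M.η⁻¹.map C = 1 := by
    rw [← Matrix.map_mul, η_mul_η_inv, Matrix.map_one _ (map_zero _) (map_one _)]
  have e2 : M.η⁻¹.map (C : K →+* Fn K ι) * M.η.map C = 1 := mul_eq_one_comm.mp e1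
  simp only [Matrix.mul_assoc, e1, Matrix.mul_one] at h1
  rw [← Matrix.mul_assoc, e2, Matrix.one_mul] at h1
  exact h1.symm

theorem U_transpose_mul : M.U.transpose * M.η⁻¹.map C = M.η⁻¹.map C * M.U := by
  simp only [U, Matrix.transpose_sum, Matrix.transpose_smul, Matrix.sum_mul, Matrix.mul_sum,
    Matrix.smul_mul, Matrix.mul_smul, A_transpose_mul]

end FrobeniusManifold

end JetFrobenius

end

noncomputable section

set_option linter.unusedSectionVars false

namespace JetFrobenius

open MvPowerSeries

namespace FrobeniusManifold

variable {K ι : Type*} [Field K] [Fintype ι] [DecidableEq ι] {M : FrobeniusManifold K ι}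
  {Θ : Matrix ι ι (PowerSeries (Fn K ι))} {t : ℤ → ι → JetFn K ι}

/-! ### Symmetry of the fundamental solution and of the connection -/

section Symmetry

theorem constMatrix_transpose (N : Matrix ι ι K) :
    (constMatrix N : Matrix ι ι (PowerSeries (Fn K ι))).transpose = constMatrix N.transpose := rfl

theorem constMatrix_map_evalNegHom (N : Matrix ι ι K) :
    (constMatrix N : Matrix ι ι (PowerSeries (Fn K ι))).map PowerSeries.evalNegHom =
      constMatrix N := by
  ext a b : 1
  simp only [constMatrix, Matrix.map_apply, PowerSeries.evalNegHom]
  ext n : 1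
  rw [PowerSeries.coeff_rescale, PowerSeries.coeff_C]
  split_ifs with h
  · rw [h, pow_zero, one_mul]
  · rw [mul_zero]

theorem adjoint_eq : M.adjoint Θ = constMatrix M.η * (Θ.map PowerSeries.evalNegHom).transpose *
    constMatrix M.η⁻¹ := rfl

theorem constMatrix_η_inv_mul :
    (constMatrix M.η⁻¹ * constMatrix M.η : Matrix ι ι (PowerSeries (Fn K ι))) = 1 := by
  rw [← constMatrix_mul, η_inv_mul_η, constMatrix_one]

theorem transpose_mul_η_inv_mul_self (h : M.adjoint Θ * Θ = 1) :
    (Θ.map PowerSeries.evalNegHom).transpose * constMatrix M.η⁻¹ * Θ = constMatrix M.η⁻¹ := by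
  have h1 := congrArg (fun N => constMatrix M.η⁻¹ * N) h
  simp only [adjoint_eq, Matrix.mul_one] at h1
  simp only [← Matrix.mul_assoc, constMatrix_η_inv_mul, Matrix.one_mul] at h1
  exact h1

theorem self_mul_η_mul_transpose (h : M.adjoint Θ * Θ = 1) :
    Θ * (constMatrix M.η * (Θ.map PowerSeries.evalNegHom).transpose) = constMatrix M.η := by
  have h0 : Θ * M.adjoint Θ = 1 := mul_eq_one_comm.mp h
  have h1 := congrArg (fun N => N * constMatrix M.η) h0
  simp only [adjoint_eq, Matrix.one_mul] at h1
  simp only [Matrix.mul_assoc, constMatrix_η_inv_mul, Matrix.mul_one] at h1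
  exact h1

theorem deltaSymbol_eq : M.deltaSymbol = constMatrix (M.μ + (1 / 2 : K) • 1) +
    (PowerSeries.X : PowerSeries (Fn K ι)) • M.U.map PowerSeries.C := rfl

/-- Under the adjoint combined with `z ↦ -z`, both `μ` (skew) and `z U` (with `U` self-adjoint)
change sign while `1/2` stays. So the symbol `S` goes to `1 - S`, the hypothesis of
`coeff_pairing_delta`. -/
theorem deltaSymbol_transpose_mul [CharZero K] :
    (M.deltaSymbol.map PowerSeries.evalNegHom).transpose * constMatrix M.η⁻¹ =
      constMatrix M.η⁻¹ * (1 - M.deltaSymbol) := by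
  have e1 : M.deltaSymbol.map PowerSeries.evalNegHom = constMatrix (M.μ + (1 / 2 : K) • 1) -
      (PowerSeries.X : PowerSeries (Fn K ι)) • M.U.map PowerSeries.C := by
    rw [deltaSymbol_eq, Matrix.map_add _ (map_add _), constMatrix_map_evalNegHom, sub_eq_add_neg]
    congr 1
    ext a b : 1
    simp only [Matrix.map_apply, Matrix.smul_apply, Matrix.neg_apply, smul_eq_mul, map_mul,
      PowerSeries.evalNegHom_X, neg_mul]
    congr 2
    rw [PowerSeries.evalNegHom]
    ext n : 1
    rw [PowerSeries.coeff_rescale, PowerSeries.coeff_C]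
    split_ifs with h
    · rw [h, pow_zero, one_mul]
    · rw [mul_zero]
  have e2 : (M.U.map PowerSeries.C).transpose * constMatrix M.η⁻¹ =
      constMatrix M.η⁻¹ * M.U.map PowerSeries.C := by
    have h := congrArg (fun N => N.map (PowerSeries.C : Fn K ι →+* PowerSeries (Fn K ι)))
      M.U_transpose_mul
    simp only [Matrix.map_mul] at h
    exact h
  have e3 : (constMatrix (M.μ + (1 / 2 : K) • 1).transpose *
      constMatrix M.η⁻¹ : Matrix ι ι (PowerSeries (Fn K ι))) =
      constMatrix M.η⁻¹ - constMatrix M.η⁻¹ * constMatrix (M.μ + (1 / 2 : K) • 1) := by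
    rw [← constMatrix_mul, ← constMatrix_mul, Matrix.transpose_add, Matrix.transpose_smul,
      Matrix.transpose_one, Matrix.add_mul, μ_transpose_mul, Matrix.mul_add, Matrix.smul_mul,
      Matrix.mul_smul, Matrix.one_mul, Matrix.mul_one]
    have : -(M.η⁻¹ * M.μ) + (1 / 2 : K) • M.η⁻¹ =
        M.η⁻¹ - (M.η⁻¹ * M.μ + (1 / 2 : K) • M.η⁻¹) := by
      module
    rw [this]
    ext a b : 1
    simp only [constMatrix, Matrix.map_apply, Matrix.sub_apply, map_sub]
  rw [e1, deltaSymbol_eq, Matrix.transpose_sub, Matrix.transpose_smul, constMatrix_transpose,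
    Matrix.sub_mul, Matrix.smul_mul, e2, e3, Matrix.mul_sub, Matrix.mul_add, Matrix.mul_one,
    Matrix.mul_smul]
  abel

variable (A : Type*) [CommRing A] [Algebra (JetFn K ι) A] [Algebra K A]

theorem mEuler_constMatrix (N : Matrix ι ι K) :
    Laurent.mEuler ((constMatrix N : Matrix ι ι (PowerSeries (Fn K ι))).map (toL A)) = 0 := by
  ext a b : 1
  rw [Laurent.mEuler, Matrix.map_apply, Matrix.map_apply, euler_toL, constMatrix, Matrix.map_apply,
    PowerSeries.derivative_C, mul_zero, map_zero, Matrix.zero_apply]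

theorem map_neg_map_toL (N : Matrix ι ι (PowerSeries (Fn K ι))) :
    (N.map (toL A)).map (Laurent.neg K) = (N.map PowerSeries.evalNegHom).map (toL A) := by
  ext a b : 1
  simp only [Matrix.map_apply, neg_toL]

variable (M)

/-- The metric on the cotangent bundle, as a matrix of Laurent series. -/
def coMetric : Matrix ι ι (LaurentSeries A) := (constMatrix M.η⁻¹).map (toL A)

theorem coMetric_transpose : (M.coMetric A).transpose = M.coMetric A := by
  rw [coMetric, ← Matrix.transpose_map, constMatrix_transpose, η_inv_transpose]

theorem coMetric_map_neg : (M.coMetric A).map (Laurent.neg K) = M.coMetric A := by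
  rw [coMetric, map_neg_map_toL, constMatrix_map_evalNegHom]

theorem coMetric_delta [CharZero K] :
    ((M.deltaSymbol.map (toL A)).map (Laurent.neg K)).transpose * M.coMetric A =
      M.coMetric A * (1 - M.deltaSymbol.map (toL A)) := by
  have h := congrArg (fun N => N.map (toL A)) M.deltaSymbol_transpose_mul
  simp only [Matrix.map_mul, Matrix.map_sub _ (map_sub (toL A)),
    Matrix.map_one _ (map_zero (toL A)) (map_one (toL A))] at h
  rw [map_neg_map_toL]
  exact h

variable {M}

theorem coMetric_fundamental (h : M.adjoint Θ * Θ = 1) :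
    ((Θ.map (toL A)).map (Laurent.neg K)).transpose * M.coMetric A * Θ.map (toL A) =
      M.coMetric A := by
  have h := congrArg (fun N => N.map (toL A)) (transpose_mul_η_inv_mul_self h)
  simp only [Matrix.map_mul] at h
  rw [map_neg_map_toL]
  exact h

end Symmetry

/-! ### Finiteness and constancy of `R(z)` -/

/-- A nonzero `R_k` gives the eigenvalue `ε k` of `ad μ_s`, and an operator on a finite-dimensional
space has finitely many eigenvalues. Consequently iterates of `δ̃` involve only finite sums and
commute with additive maps. -/
theorem exists_deltaTildeCoeff_eq_zero [CharZero K] (h : M.IsConformal Θ) :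
    ∃ J, ∀ j, J ≤ j → M.deltaTildeCoeff Θ j = 0 := by
  obtain ⟨μs, -, -, -, -, -, ε, hε, hR⟩ := h
  have hε0 : ε ≠ 0 := by rcases hε with rfl | rfl <;> simp
  let ad : Module.End K (Matrix ι ι K) := LinearMap.mulLeft K μs - LinearMap.mulRight K μs
  have hfin : {k : ℕ | zCoeff k (M.R Θ) ≠ 0}.Finite := by
    refine ((Module.End.finite_hasEigenvalue ad).preimage
      (f := fun k : ℕ => ε * k) (fun a _ b _ hab => ?_)).subset fun k hk => ?_
    · exact Nat.cast_injective (mul_left_cancel₀ hε0 hab)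
    -- The entries of `R_k` are still power series here, so one extracts a coefficient matrix over
    -- `K` as eigenvector.
    · obtain ⟨α, hα⟩ : ∃ α, (zCoeff k (M.R Θ)).map (coeff α) ≠ 0 := by
        by_contra! hall
        refine hk ?_
        ext a b α
        exact congrFun (congrFun (hall α) a) b
      refine Module.End.hasEigenvalue_of_hasEigenvector (x := (zCoeff k (M.R Θ)).map (coeff α))
        ⟨Module.End.mem_eigenspace_iff.mpr ?_, hα⟩
      have h := congrArg (fun N => N.map (coeff (R := K) α)) (hR k)
      ext a b
      have h := congrFun (congrFun h a) b
      simp only [Matrix.map_apply, Matrix.sub_apply, Matrix.mul_apply, map_sub, map_sum,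
        coeff_C_mul, coeff_mul_C, Matrix.smul_apply, coeff_smul] at h
      simpa [ad, Matrix.mul_apply] using h
  obtain ⟨J, hJ⟩ := hfin.bddAbove
  refine ⟨J + 1, fun j hj => ?_⟩
  have : zCoeff j (M.R Θ) = 0 := by
    by_contra hne
    have := hJ hne
    omega
  rw [deltaTildeCoeff, this, Matrix.map_zero _ (map_zero _)]

theorem deltaCoeff_eq_zero {j : ℕ} (hj : 2 ≤ j) : M.deltaCoeff j = 0 := by
  have : zCoeff j M.deltaSymbol = 0 := by
    ext a b : 1
    rw [zCoeff, deltaSymbol_eq, Matrix.map_apply, Matrix.add_apply, Matrix.smul_apply, smul_eq_mul,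
      Matrix.map_apply, map_add, constMatrix, Matrix.map_apply, PowerSeries.coeff_C,
      if_neg (by omega), mul_comm, PowerSeries.coeff_C_mul, PowerSeries.coeff_X, if_neg (by omega),
      mul_zero, add_zero, Matrix.zero_apply]
  rw [deltaCoeff, this, Matrix.map_zero _ (map_zero _)]

end FrobeniusManifold

end JetFrobenius

end

/-! ### Derivations acting on coefficients, and residue pairings modulo weight -/

noncomputable section

set_option linter.unusedSectionVars false

namespace JetFrobenius

open MvPowerSeries

namespace Laurent

variable {A : Type*} [CommRing A] {K : Type*} [Field K] [Algebra K A]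

/-- A derivation applied to the coefficients of a Laurent series. -/
def mapD (D : Derivation K A A) : LaurentSeries A →+ LaurentSeries A where
  toFun f := ofFun (fun n => D (f.coeff n)) f.order fun n hn => by
    rw [HahnSeries.coeff_eq_zero_of_lt_order hn, map_zero]
  map_zero' := by ext n; simp
  map_add' f g := by ext n; simp

@[simp] theorem coeff_mapD (D : Derivation K A A) (f : LaurentSeries A) (n : ℤ) :
    (mapD D f).coeff n = D (f.coeff n) := rfl

theorem mapD_mul (D : Derivation K A A) (f g : LaurentSeries A) :
    mapD D (f * g) = mapD D f * g + f * mapD D g := by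
  ext n
  rw [HahnSeries.coeff_add, coeff_mapD]
  simp only [coeff_mul_eq_sum]
  rw [← finsum_add_distrib (coeff_mul_eq_finsum _ _ n).1 (coeff_mul_eq_finsum _ _ n).1]
  have h := (coeff_mul_eq_finsum f g n).1
  have h1 := AddMonoidHom.map_finsum D.toLinearMap.toAddMonoidHom h
  refine h1.trans (finsum_congr fun m => ?_)
  exact (D.leibniz _ _).trans (by simp only [smul_eq_mul, coeff_mapD]; ring)

theorem mapD_euler (D : Derivation K A A) (f : LaurentSeries A) :
    mapD D (euler f) = euler (mapD D f) := by
  ext n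
  simp

@[simp] theorem mapD_one (D : Derivation K A A) : mapD D (1 : LaurentSeries A) = 0 := by
  ext n
  rcases eq_or_ne n 0 with rfl | h <;> simp [HahnSeries.coeff_one, *]

@[simp] theorem mapD_z (D : Derivation K A A) : mapD D (z : LaurentSeries A) = 0 := by
  ext n
  rcases eq_or_ne n 1 with rfl | h <;> simp [*]

variable {ι κ : Type*} [Fintype ι]

theorem map_mapD_mul {l : Type*} (D : Derivation K A A) (F : Matrix l ι (LaurentSeries A))
    (G : Matrix ι κ (LaurentSeries A)) :
    (F * G).map (mapD D) = F.map (mapD D) * G + F * G.map (mapD D) := by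
  ext i j : 2
  simp only [Matrix.map_apply, Matrix.mul_apply, Matrix.add_apply, map_sum, mapD_mul,
    ← Finset.sum_add_distrib]

theorem map_mapD_mEuler {l : Type*} (D : Derivation K A A) (F : Matrix l κ (LaurentSeries A)) :
    (mEuler F).map (mapD D) = mEuler (F.map (mapD D)) := by
  ext i j : 2
  simp only [Matrix.map_apply, mapD_euler]

theorem map_mapD_one {l : Type*} [DecidableEq l] (D : Derivation K A A) :
    (1 : Matrix l l (LaurentSeries A)).map (mapD D) = 0 := by
  ext i j : 2
  rcases eq_or_ne i j with rfl | h <;> simp [*]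

theorem map_mapD_smul {l : Type*} (D : Derivation K A A) (c : LaurentSeries A)
    (F : Matrix l κ (LaurentSeries A)) :
    (c • F).map (mapD D) = mapD D c • F + c • F.map (mapD D) := by
  ext i j : 2
  simp only [Matrix.map_apply, Matrix.smul_apply, Matrix.add_apply, smul_eq_mul, mapD_mul]

/-- A gauge transformation satisfying `D T = z T B` makes `z d/dz + m + z U` constant. -/
theorem map_mapD_gauge [DecidableEq ι] (D : Derivation K A A)
    {T Ti B m U : Matrix ι ι (LaurentSeries A)} (hT : T * Ti = 1)
    (hdT : T.map (mapD D) = (z : LaurentSeries A) • (T * B)) (hm : m.map (mapD D) = 0)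
    (hU : U.map (mapD D) = B + (m * B - B * m)) (hUB : U * B = B * U) (hB : mEuler B = 0) :
    (T * (m + (z : LaurentSeries A) • U) * Ti + T * mEuler Ti).map (mapD D) = 0 := by
  have hT' : Ti * T = 1 := mul_eq_one_comm.mp hT
  have hdTi : Ti.map (mapD D) = -((z : LaurentSeries A) • (B * Ti)) := by
    have h0 := congrArg (fun N => Ti * N.map (mapD D)) hT
    simp only [map_mapD_mul, map_mapD_one, Matrix.mul_zero, hdT, Matrix.mul_add,
      ← Matrix.mul_assoc, hT', Matrix.one_mul, Matrix.mul_smul, Matrix.smul_mul] at h0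
    exact eq_neg_of_add_eq_zero_right h0
  have hadd : ∀ F G : Matrix ι ι (LaurentSeries A),
      (F + G).map (mapD D) = F.map (mapD D) + G.map (mapD D) := fun F G =>
    Matrix.map_add _ (map_add _) F G
  have hE : mEuler (-((z : LaurentSeries A) • (B * Ti))) =
      -((z : LaurentSeries A) • (B * Ti) + (z : LaurentSeries A) • (B * mEuler Ti)) := by
    rw [← neg_one_smul (LaurentSeries A), smul_smul, mEuler_smul, mEuler_mul, hB, Matrix.zero_mul,
      zero_add, neg_one_mul, map_neg, euler_z]
    simp only [neg_smul, neg_add]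
  rw [hadd, map_mapD_mul, map_mapD_mul, hadd, map_mapD_smul, mapD_z, map_mapD_mul, map_mapD_mEuler,
    hdTi, hdT, hm, hU, hE]
  have e : ∀ F G : Matrix ι ι (LaurentSeries A), T * B * F * G = T * (B * F * G) := fun F G => by
    simp only [Matrix.mul_assoc]
  simp only [Matrix.mul_add, Matrix.add_mul, Matrix.mul_smul, Matrix.smul_mul, Matrix.mul_neg,
    zero_add, zero_smul, smul_add, Matrix.mul_sub, Matrix.sub_mul, smul_sub, Matrix.mul_assoc]
  -- Commutation of `U` and `B` removes the `z²` terms; the terms linear in `z` cancel by the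
  -- formula for the derivative of `U`.
  have h2 : U * (B * Ti) = B * (U * Ti) := by rw [← Matrix.mul_assoc, hUB, Matrix.mul_assoc]
  rw [h2]
  abel

end Laurent

/-! ## Sequences and Laurent series -/

section Represents

variable {K ι : Type*} [Field K] [Fintype ι]

/-- The sequence `f` consists of the coefficients of the column `F` of Laurent series. -/
def Represents (A : Type*) [CommRing A] [Algebra (JetFn K ι) A] (f : ℤ → ι → JetFn K ι)
    (F : Matrix ι Unit (LaurentSeries A)) : Prop :=
  ∀ n c, algebraMap (JetFn K ι) A (f n c) = (F c ()).coeff n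

variable {A : Type*} [CommRing A] [Algebra (JetFn K ι) A] {f g : ℤ → ι → JetFn K ι}
  {F G : Matrix ι Unit (LaurentSeries A)}

/-- The bound is required only after mapping to `A`: a sequence unbounded below over the ring of
jets may qualify in a quotient. -/
theorem exists_represents (h : ∃ N : ℤ, ∀ n < N, ∀ c, algebraMap (JetFn K ι) A (f n c) = 0) :
    ∃ F : Matrix ι Unit (LaurentSeries A), Represents A f F := by
  obtain ⟨N, hN⟩ := h
  exact ⟨fun c _ => Laurent.ofFun (fun n => algebraMap (JetFn K ι) A (f n c)) N fun n hn => hN n hn c,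
    fun _ _ => rfl⟩

theorem Represents.zConnection_iterate {R : ℕ → Matrix ι ι (JetFn K ι)} {J : ℕ}
    (hR : ∀ j, J ≤ j → R j = 0) (h : Represents A f F) (N : ℕ) :
    Represents A ((zConnection R)^[N] f) ((Laurent.delta (symbol A R))^[N] F) := by
  intro n c
  have h1 := zConnection_iterate_map hR (algebraMap (JetFn K ι) A).toAddMonoidHom
    (fun j a b v => by
      change algebraMap _ A (R j a b * v) = _ • algebraMap _ A v
      rw [map_mul, Algebra.smul_def]) N f
  have h2 := zConnection_iterate_coeff R N F ()
  have h3 : (fun n c => (algebraMap (JetFn K ι) A).toAddMonoidHom (f n c)) =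
      fun n c => (F c ()).coeff n := by
    funext n c
    exact h n c
  rw [h3, h2] at h1
  exact (congrFun (congrFun h1 n) c).symm

end Represents

namespace FrobeniusManifold

variable {K ι : Type*} [Field K] [Fintype ι] [DecidableEq ι] (M : FrobeniusManifold K ι)

/-- `Res_{z=0} η(f(-z), z g(z))` for sequences of covectors. -/
def pairRes (f g : ℤ → ι → JetFn K ι) : JetFn K ι :=
  formalSum fun m : ℤ => ((-1 : K) ^ m) • ∑ a, ∑ b, M.η⁻¹ a b • (f m a * g (-2 - m) b)

variable {f g : ℤ → ι → JetFn K ι}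

theorem coeff_pairing_coMetric {A : Type*} [CommRing A] [Algebra (JetFn K ι) A] [Algebra K A]
    [IsScalarTower K (JetFn K ι) A] (F G : Matrix ι Unit (LaurentSeries A)) (n : ℤ) :
    (Function.support fun m : ℤ => ((-1 : K) ^ m) • ∑ a, ∑ b, M.η⁻¹ a b •
      ((F a ()).coeff m * (G b ()).coeff (n - m))).Finite ∧
    (Laurent.pairing K (M.coMetric A) F G () ()).coeff n = ∑ᶠ m : ℤ, ((-1 : K) ^ m) •
      ∑ a, ∑ b, M.η⁻¹ a b • ((F a ()).coeff m * (G b ()).coeff (n - m)) := by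
  have hQ : ∀ a b, M.coMetric A a b = HahnSeries.C (algebraMap K A (M.η⁻¹ a b)) := fun a b => by
    rw [coMetric, Matrix.map_apply, constMatrix, Matrix.map_apply, toL_C, pullback_C,
      IsScalarTower.algebraMap_apply K (JetFn K ι) A]
    rfl
  have e : ∀ m : ℤ, ((-1 : K) ^ m) • ∑ a, ∑ b, M.η⁻¹ a b •
      ((F a ()).coeff m * (G b ()).coeff (n - m)) = ∑ a, ∑ b, M.η⁻¹ a b •
      ((Laurent.neg K (F a ())).coeff m * (G b ()).coeff (n - m)) := fun m => by
    simp only [Finset.smul_sum, Laurent.coeff_neg, smul_mul_assoc]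
    exact Finset.sum_congr rfl fun a _ => Finset.sum_congr rfl fun b _ => smul_comm _ _ _
  simp only [e]
  have hfin : ∀ a b, (Function.support fun m : ℤ => M.η⁻¹ a b •
      ((Laurent.neg K (F a ())).coeff m * (G b ()).coeff (n - m))).Finite := fun a b =>
    (Laurent.coeff_mul_eq_finsum (Laurent.neg K (F a ())) (G b ()) n).1.subset fun m hm h =>
      hm (by dsimp only at h ⊢; rw [h, smul_zero])
  have hfin2 : ∀ a, (Function.support fun m : ℤ => ∑ b, M.η⁻¹ a b •
      ((Laurent.neg K (F a ())).coeff m * (G b ()).coeff (n - m))).Finite := fun a =>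
    (Set.finite_iUnion fun b => hfin a b).subset fun m hm => by
      obtain ⟨b, -, hb⟩ := Finset.exists_ne_zero_of_sum_ne_zero hm
      exact Set.mem_iUnion.mpr ⟨b, hb⟩
  refine ⟨(Set.finite_iUnion hfin2).subset fun m hm => ?_, ?_⟩
  · obtain ⟨b, -, hb⟩ := Finset.exists_ne_zero_of_sum_ne_zero hm
    exact Set.mem_iUnion.mpr ⟨b, hb⟩
  · rw [finsum_sum_comm _ _ fun a _ => hfin2 a]
    simp only [Laurent.pairing, Matrix.mul_apply, HahnSeries.coeff_sum, Finset.sum_mul,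
      Matrix.transpose_apply, Matrix.map_apply, hQ]
    rw [Finset.sum_comm]
    refine Finset.sum_congr rfl fun a _ => ?_
    rw [finsum_sum_comm _ _ fun b _ => hfin a b]
    refine Finset.sum_congr rfl fun b _ => ?_
    rw [mul_comm (Laurent.neg K (F a ())), mul_assoc, HahnSeries.C_mul_eq_smul, HahnSeries.coeff_smul,
      Laurent.coeff_mul_eq_sum, smul_finsum' _
        (Laurent.coeff_mul_eq_finsum (Laurent.neg K (F a ())) (G b ()) n).1]
    exact finsum_congr fun m => by rw [smul_eq_mul, ← Algebra.smul_def]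

/-- Over the ring of jets the residue is an infinite sum. Modulo weight `w` it is a coefficient of a
product of Laurent series, to which gauge invariance and self-adjointness apply. -/
theorem mk_pairRes {w : ℕ} {F G : Matrix ι Unit (LaurentSeries (JetFn K ι ⧸ wIdeal (K := K) (ι := ι) w))}
    (hF : Represents _ f F) (hG : Represents _ g G) :
    Ideal.Quotient.mk (wIdeal w) (M.pairRes f g) =
      (Laurent.pairing K (M.coMetric _) F G () ()).coeff (-2) := by
  have h := M.coeff_pairing_coMetric F G (-2)
  have e : ∀ m : ℤ, ((-1 : K) ^ m) • ∑ a, ∑ b, M.η⁻¹ a b •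
      ((F a ()).coeff m * (G b ()).coeff (-2 - m)) = Ideal.Quotient.mk (wIdeal w)
        (((-1 : K) ^ m) • ∑ a, ∑ b, M.η⁻¹ a b • (f m a * g (-2 - m) b)) := fun m => by
    simp only [← hF m, ← hG (-2 - m)]
    rw [← Ideal.Quotient.mkₐ_eq_mk K]
    simp only [map_smul, map_sum, map_mul]
    rfl
  simp only [e] at h
  rw [h.2, pairRes, mk_formalSum]
  rw [← mk_support]
  exact h.1

end FrobeniusManifold

end JetFrobenius

end

/-! ### Gauging the fundamental solution out of the residues -/

noncomputable section

set_option linter.unusedSectionVars false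

namespace JetFrobenius

open MvPowerSeries

namespace FrobeniusManifold

variable {K ι : Type*} [Field K] [Fintype ι] [DecidableEq ι] {M : FrobeniusManifold K ι}
  {Θ : Matrix ι ι (PowerSeries (Fn K ι))} {t : ℤ → ι → JetFn K ι}

section Gauge

variable (A : Type*) [CommRing A] [Algebra (JetFn K ι) A]

theorem symbol_deltaCoeff : symbol A M.deltaCoeff = M.deltaSymbol.map (toL A) :=
  symbol_jetCoeff M.deltaSymbol

theorem symbol_deltaTildeCoeff : symbol A (M.deltaTildeCoeff Θ) = (M.R Θ).map (toL A) :=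
  symbol_jetCoeff (M.R Θ)

theorem delta_fundamental_mul {κ : Type*} (h : M.adjoint Θ * Θ = 1) (N : ℕ)
    (F : Matrix ι κ (LaurentSeries A)) :
    (Laurent.delta (symbol A (M.deltaTildeCoeff Θ)))^[N] (Θ.map (toL A) * F) =
      Θ.map (toL A) * (Laurent.delta (symbol A M.deltaCoeff))^[N] F := by
  have h1 : Θ.map (toL A) * Θ⁻¹.map (toL A) = 1 := by
    rw [← Matrix.map_mul, mul_inv_self h, Matrix.map_one _ (map_zero _) (map_one _)]
  rw [symbol_deltaTildeCoeff, symbol_deltaCoeff]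
  exact Laurent.delta_gauge_iterate h1 (map_toL_R Θ) N F

variable [Algebra K A] {A}

/-- Gauge covariance moves `Θ` to the left of the powers of the connection, and `Θ` then drops out
because it is an isometry. -/
theorem pairing_fundamental_mul {l m : Type*} (h : M.adjoint Θ * Θ = 1) (N : ℕ)
    (F : Matrix ι l (LaurentSeries A)) (G : Matrix ι m (LaurentSeries A)) :
    Laurent.pairing K (M.coMetric A) (Θ.map (toL A) * F)
      ((Laurent.delta (symbol A (M.deltaTildeCoeff Θ)))^[N] (Θ.map (toL A) * G)) =
    Laurent.pairing K (M.coMetric A) F ((Laurent.delta (symbol A M.deltaCoeff))^[N] G) := by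
  rw [delta_fundamental_mul A h, Laurent.pairing_mul_mul (coMetric_fundamental A h)]

/-- Self-adjointness of `δ` together with symmetry of the residue pairing; it makes the two cross
terms of the Virasoro operator equal. -/
theorem coeff_pairing_delta_comm [CharZero K] {l m : Type*} (N : ℕ)
    (F : Matrix ι l (LaurentSeries A)) (G : Matrix ι m (LaurentSeries A)) (i : l) (j : m) :
    (Laurent.pairing K (M.coMetric A) F
      ((Laurent.delta (symbol A M.deltaCoeff))^[N] G) i j).coeff (-2) =
    (Laurent.pairing K (M.coMetric A) G
      ((Laurent.delta (symbol A M.deltaCoeff))^[N] F) j i).coeff (-2) := by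
  have h := Laurent.coeff_pairing_delta_iterate (Q := M.coMetric A) (mEuler_constMatrix A _)
    (M.coMetric_delta A) N F G i j
  rw [symbol_deltaCoeff]
  exact h.symm.trans (Laurent.coeff_pairing_symm (M.coMetric_transpose A)
    (M.coMetric_map_neg A) _ _ _ _)

end Gauge

/-! ### The sequences of the free field -/

variable (M) (Θ)

/-- The functions `(-1)^m ∑ b, η_{ab} t_{-m-1}^b`, coefficients of `∑ k, (-z)^{-k-1} η t_k`. -/
def coordSeq (t : ℤ → ι → JetFn K ι) (m : ℤ) (a : ι) : JetFn K ι :=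
  ((-1 : K) ^ m) • ∑ b, M.η a b • t (-m - 1) b

/-- The sequence `∂_{n,c} f`, extended by zero to negative `n`. -/
def flatSeq (f : JetFn K ι) (n : ℤ) (c : ι) : JetFn K ι :=
  if 0 ≤ n then M.flatField Θ n.toNat c f else 0

variable {M} {Θ}

theorem algebraMap_smul_K {A : Type*} [CommRing A] [Algebra (JetFn K ι) A] [Algebra K A]
    [IsScalarTower K (JetFn K ι) A] (c : K) (f : JetFn K ι) :
    algebraMap (JetFn K ι) A (c • f) = c • algebraMap (JetFn K ι) A f := by
  rw [Algebra.smul_def, map_mul, ← IsScalarTower.algebraMap_apply, ← Algebra.smul_def]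

section Reps

variable {A : Type*} [CommRing A] [Algebra (JetFn K ι) A] [Algebra K A]
  [IsScalarTower K (JetFn K ι) A]

theorem represents_coordSeq {t : ℤ → ι → JetFn K ι} {F : Matrix ι Unit (LaurentSeries A)}
    (h : Represents A (fun n c => t (-n - 1) c) F) :
    Represents A (M.coordSeq t) ((constMatrix M.η).map (toL A) * F.map (Laurent.neg K)) := by
  intro n a
  have hη : ∀ b, (constMatrix M.η).map (toL A) a b = HahnSeries.C (algebraMap K A (M.η a b)) :=
    fun b => by
      rw [Matrix.map_apply, constMatrix, Matrix.map_apply, toL_C, pullback_C,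
        IsScalarTower.algebraMap_apply K (JetFn K ι) A]
      rfl
  rw [coordSeq, algebraMap_smul_K, map_sum, Finset.smul_sum, Matrix.mul_apply, HahnSeries.coeff_sum]
  refine Finset.sum_congr rfl fun b _ => ?_
  rw [hη, HahnSeries.C_mul_eq_smul, HahnSeries.coeff_smul, Matrix.map_apply, Laurent.coeff_neg,
    ← h n b, algebraMap_smul_K, smul_comm, smul_eq_mul, Algebra.smul_def (M.η a b)]

theorem represents_flatSeq (hΘ : M.IsFundamentalSolution Θ) {f : JetFn K ι}
    {S : Matrix ι Unit (LaurentSeries A)} (hS : Represents A (fun n c => M.σ n c f) S) :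
    Represents A (M.flatSeq Θ f) (Θ.map (toL A) * S) := by
  intro n a
  have e : ∀ c, (toL A (Θ a c) * S c ()).coeff n =
      ∑ᶠ j : ℕ, algebraMap _ A (jetCoeff Θ j a c) * algebraMap _ A (M.σ (n - j) c f) := fun c => by
    rw [toL_apply, (Laurent.coeff_ofPowerSeries_mul _ _ _).2]
    refine finsum_congr fun j => ?_
    rw [PowerSeries.coeff_mk, ← hS]
    rfl
  have e' : ∀ c, (toL A (Θ a c) * S c ()).coeff n = ∑ j ∈ Finset.range (n.toNat + 1),
      algebraMap _ A (jetCoeff Θ j a c) * algebraMap _ A (M.σ (n - j) c f) := fun c => by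
    rw [e, finsum_eq_sum_of_support_subset]
    intro j hj
    by_contra hlt
    rw [Finset.coe_range, Set.mem_Iio, not_lt] at hlt
    refine hj ?_
    dsimp only
    rw [M.σ_of_neg (by omega), Pi.zero_apply, map_zero, mul_zero]
  simp only [Matrix.mul_apply, HahnSeries.coeff_sum, Matrix.map_apply, e']
  rw [flatSeq]
  split_ifs with h
  · obtain ⟨m, rfl⟩ := Int.eq_ofNat_of_zero_le h
    rw [Int.toNat_natCast, flatField_eq_sum hΘ, Finset.Nat.sum_antidiagonal_eq_sum_range_succ_mk,
      Finset.sum_comm, map_sum]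
    refine Finset.sum_congr rfl fun c _ => ?_
    rw [map_sum]
    refine Finset.sum_congr rfl fun j hj => ?_
    rw [Finset.mem_range] at hj
    rw [map_mul, Nat.cast_sub (by omega)]
  · rw [map_zero]
    symm
    refine Finset.sum_eq_zero fun c _ => Finset.sum_eq_zero fun j _ => ?_
    rw [M.σ_of_neg (by omega), Pi.zero_apply, map_zero, mul_zero]

theorem exists_represents_σ (f : JetFn K ι) :
    ∃ S : Matrix ι Unit (LaurentSeries A), Represents A (fun n c => M.σ n c f) S :=
  exists_represents ⟨0, fun n hn c => by rw [M.σ_of_neg hn, Pi.zero_apply, map_zero]⟩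

end Reps

section Quotient

/-- Functions modulo those of weight at least `w`. -/
abbrev JetQuot (K ι : Type*) [Field K] (w : ℕ) := JetFn K ι ⧸ wIdeal (K := K) (ι := ι) w

variable {w : ℕ}

theorem represents_sField [CharZero K] (hΘ : M.IsFundamentalSolution Θ)
    (ht : M.IsFlatGeneratingFunction Θ t)
    {P : Matrix ι Unit (LaurentSeries (JetQuot K ι w))}
    (hP : Represents _ (fun n c => t (-n - 1) c) P) :
    Represents _ (fun n c => sField Θ t (-n - 1) c) ((Θ.map (toL (JetQuot K ι w))).transpose * P) := by
  intro n a
  have h := sField_jetSummable hΘ ht (-n - 1) a w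
  change Ideal.Quotient.mk _ _ = _
  dsimp only
  have e0 : ((Θ.map (toL (JetQuot K ι w))).transpose * P) a () = ∑ b, toL (JetQuot K ι w) (Θ b a) * P b () := rfl
  rw [sField, mk_formalSum h, e0, HahnSeries.coeff_sum]
  have e : ∀ b, (toL (JetQuot K ι w) (Θ b a) * P b ()).coeff n =
      ∑ᶠ j : ℕ, Ideal.Quotient.mk (wIdeal w)
        (t (-n - 1 + j) b * pullback (zCoeff j Θ b a)) := fun b => by
    rw [toL_apply, (Laurent.coeff_ofPowerSeries_mul _ _ _).2]
    refine finsum_congr fun j => ?_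
    rw [PowerSeries.coeff_mk, ← hP, map_mul, mul_comm]
    dsimp only
    rw [show -(n - (j : ℤ)) - 1 = -n - 1 + j by ring]
    rfl
  simp only [e]
  rw [← finsum_sum_comm]
  · simp only [map_sum]
  · intro b _
    refine (Set.finite_lt_nat (2 + w + (-n - 1).natAbs)).subset fun j hj => ?_
    by_contra hlt
    rw [Set.mem_ofPred, not_lt] at hlt
    refine hj ?_
    dsimp only
    rw [Ideal.Quotient.eq_zero_iff_mem]
    exact Ideal.mul_mem_right _ _ (flatCoordinate_mem_of_le hΘ ht (by omega) (by omega) b)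

/-- `η t(-z) = Θ(z) η s(-z)`. -/
theorem exists_represents_coordSeq [CharZero K] (hΘ : M.IsSymmetricFundamentalSolution Θ)
    (ht : M.IsFlatGeneratingFunction Θ t) (w : ℕ) :
    ∃ V : Matrix ι Unit (LaurentSeries (JetQuot K ι w)),
      Represents _ (M.coordSeq (sField Θ t)) V ∧
      Represents _ (M.coordSeq t) (Θ.map (toL (JetQuot K ι w)) * V) := by
  obtain ⟨P, hP⟩ : ∃ P : Matrix ι Unit (LaurentSeries (JetQuot K ι w)),
      Represents _ (fun n c => t (-n - 1) c) P := by
    -- Below this bound the index `-n - 1` is at least `2` and at least `w`, as the weight estimate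
    -- for the flat coordinates requires.
    refine exists_represents ⟨-3 - w, fun n hn c => ?_⟩
    exact Ideal.Quotient.eq_zero_iff_mem.mpr
      (flatCoordinate_mem_of_le hΘ.1 ht (by omega) (by omega) c)
  refine ⟨_, represents_coordSeq (represents_sField hΘ.1 ht hP), ?_⟩
  -- Orthogonality in the form `Θ(z) η Θ(-z)ᵀ = η`, with `s(-z) = Θ(-z)ᵀ t(-z)`.
  have h := congrArg (fun N => N.map (toL (JetQuot K ι w)))
    (self_mul_η_mul_transpose hΘ.2.2)
  simp only [Matrix.map_mul] at h
  have h2 : Θ.map (toL (JetQuot K ι w)) *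
      ((constMatrix M.η).map (toL (JetQuot K ι w)) *
      ((Θ.map (toL (JetQuot K ι w))).transpose * P).map
        (Laurent.neg K)) = (constMatrix M.η).map (toL (JetQuot K ι w)) * P.map (Laurent.neg K) := by
    have h3 : ((Θ.map (toL (JetQuot K ι w))).transpose).map
        (Laurent.neg K) =
        ((Θ.map PowerSeries.evalNegHom).transpose).map (toL (JetQuot K ι w)) := by
      rw [Matrix.transpose_map, map_neg_map_toL, Matrix.transpose_map]
    rw [Matrix.map_mul, h3, ← Matrix.mul_assoc, ← Matrix.mul_assoc]
    exact congrArg (fun N => N * P.map (Laurent.neg K)) ((Matrix.mul_assoc _ _ _).trans h)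
  rw [h2]
  exact represents_coordSeq hP

end Quotient

theorem coordSeq_sField_eq_zero [CharZero K] (hΘ : M.IsSymmetricFundamentalSolution Θ)
    (ht : M.IsFlatGeneratingFunction Θ t) {n : ℤ} (hn : -1 ≤ n) (a : ι) :
    M.coordSeq (sField Θ t) n a = 0 := by
  rw [coordSeq]
  simp only [sField_eq_zero hΘ ht (by omega : -n - 1 ≤ 0), smul_zero, Finset.sum_const_zero]

/-- The symbol of `δ` has degree at most one in `z`, so `δ` does not raise the top power of `z`.
This would fail for a general `δ̃`. -/
theorem zConnection_deltaCoeff_eq_zero {f : ℤ → ι → JetFn K ι} {B : ℤ}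
    (h : ∀ n, B ≤ n → ∀ a, f n a = 0) (N : ℕ) {n : ℤ} (hn : B ≤ n) (a : ι) :
    (zConnection M.deltaCoeff)^[N] f n a = 0 := by
  induction N generalizing n a with
  | zero => exact h n hn a
  | succ N ih =>
    rw [Function.iterate_succ_apply', zConnection_eq_sum fun _ => deltaCoeff_eq_zero, ih (by omega),
      smul_zero, zero_add]
    refine Finset.sum_eq_zero fun j hj => Finset.sum_eq_zero fun b _ => ?_
    rw [Finset.mem_range] at hj
    rw [ih (by omega), smul_zero]

/-- The part of the Virasoro operator quadratic in the coordinates vanishes in genus zero. -/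
theorem pairRes_coordSeq_coordSeq [CharZero K] (hΘ : M.IsSymmetricFundamentalSolution Θ)
    (ht : M.IsFlatGeneratingFunction Θ t) (N : ℕ) :
    M.pairRes (M.coordSeq t) ((zConnection (M.deltaTildeCoeff Θ))^[N] (M.coordSeq t)) = 0 := by
  obtain ⟨J, hJ⟩ := exists_deltaTildeCoeff_eq_zero hΘ.2.1
  refine eq_of_forall_mk_eq fun w => ?_
  obtain ⟨V, hV, hV'⟩ := exists_represents_coordSeq hΘ ht w
  rw [M.mk_pairRes hV' (hV'.zConnection_iterate hJ N), pairing_fundamental_mul hΘ.2.2,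
    ← M.mk_pairRes hV (hV.zConnection_iterate (fun _ => deltaCoeff_eq_zero) N)]
  congr 1
  rw [pairRes, formalSum_eq_sum ∅, Finset.sum_empty]
  intro m _
  rw [Finset.sum_eq_zero, smul_zero]
  refine fun a _ => Finset.sum_eq_zero fun b _ => ?_
  -- Both factors are `O(z⁻²)`, whereas a contribution would need exponents with sum `-2`.
  rcases le_or_gt (-1) m with h | h
  · rw [coordSeq_sField_eq_zero hΘ ht h, zero_mul, smul_zero]
  · rw [zConnection_deltaCoeff_eq_zero (B := -1)
      (fun n hn a => coordSeq_sField_eq_zero hΘ ht hn a) N (by omega), mul_zero, smul_zero]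

theorem formalSum_equiv {J J' : Type*} (e : J ≃ J') (G : J' → JetFn K ι) :
    formalSum (fun j => G (e j)) = formalSum G := by
  ext α
  rw [coeff_formalSum, coeff_formalSum]
  exact finsum_comp_equiv e (f := fun j => coeff α (G j))

theorem deltaSigma_apply (k m : ℤ) (a : ι) (f : JetFn K ι) : M.deltaSigma k m a f =
    (zConnection M.deltaCoeff)^[(k + 1).toNat] (fun n c => M.σ n c f) m a := by
  have h := zConnection_iterate_map (R := M.deltaCoeff) (fun _ => deltaCoeff_eq_zero)
    (Pi.evalAddMonoidHom (fun _ : JetFn K ι => JetFn K ι) f) (fun _ _ _ _ => rfl) (k + 1).toNat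
    (fun n c => M.σ n c)
  exact (congrFun (congrFun h m) a).symm

/-- After reindexing by `m ↦ -m - 1`, the sign in `coordSeq` cancels that of the pairing and `η`
cancels `η⁻¹`. -/
theorem pairRes_coordSeq_sField (k : ℤ) (f : JetFn K ι) :
    M.pairRes (M.coordSeq (sField Θ t)) ((zConnection M.deltaCoeff)^[(k + 1).toNat]
      (fun n c => M.σ n c f)) = M.virasoroField Θ t k f := by
  have h0 := formalSum_equiv ((Equiv.neg ℤ).trans (Equiv.subRight (1 : ℤ)))
    fun m => ∑ a, sField Θ t m a * M.deltaSigma k (m - 1) a f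
  rw [pairRes, virasoroField, ← h0]
  congr 1
  funext m
  simp only [Equiv.trans_apply, Equiv.neg_apply, Equiv.subRight_apply, deltaSigma_apply]
  simp only [coordSeq, smul_mul_assoc, Finset.sum_mul]
  have e : ∀ b, ∑ a, M.η⁻¹ a b • ((-1 : K) ^ m) • ∑ c, M.η a c •
      (sField Θ t (-m - 1) c * (zConnection M.deltaCoeff)^[(k + 1).toNat]
        (fun n c => M.σ n c f) (-2 - m) b) = ((-1 : K) ^ m) • (sField Θ t (-m - 1) b *
        (zConnection M.deltaCoeff)^[(k + 1).toNat] (fun n c => M.σ n c f) (-2 - m) b) := fun b => by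
    simp only [smul_comm _ ((-1 : K) ^ m), ← Finset.smul_sum]
    congr 1
    simp only [Finset.smul_sum, smul_smul]
    rw [Finset.sum_comm]
    have h : ∀ c, ∑ a, M.η⁻¹ a b * M.η a c = if b = c then 1 else 0 := fun c => by
      have := congrFun (congrFun (M.η_inv_mul_η) b) c
      rw [Matrix.mul_apply, Matrix.one_apply] at this
      rw [← this]
      refine Finset.sum_congr rfl fun a _ => ?_
      have := congrFun (congrFun (M.η_inv_transpose) b) a
      rw [Matrix.transpose_apply] at this
      rw [this]
    simp only [← Finset.sum_smul, h, ite_smul, one_smul, zero_smul, Finset.sum_ite_eq,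
      Finset.mem_univ, if_true]
  rw [Finset.sum_comm]
  rw [Finset.sum_congr rfl fun b _ => e b, ← Finset.smul_sum, smul_smul,
    Laurent.neg_one_zpow_mul_self, one_smul, show -m - 1 - 1 = -2 - m by ring]

/-- The part of the Virasoro operator linear in the coordinates. -/
theorem pairRes_coordSeq_flatSeq [CharZero K] (hΘ : M.IsSymmetricFundamentalSolution Θ)
    (ht : M.IsFlatGeneratingFunction Θ t) (k : ℤ) (f : JetFn K ι) :
    M.pairRes (M.coordSeq t)
      ((zConnection (M.deltaTildeCoeff Θ))^[(k + 1).toNat] (M.flatSeq Θ f)) =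
      M.virasoroField Θ t k f := by
  obtain ⟨J, hJ⟩ := exists_deltaTildeCoeff_eq_zero hΘ.2.1
  rw [← pairRes_coordSeq_sField]
  refine eq_of_forall_mk_eq fun w => ?_
  obtain ⟨V, hV, hV'⟩ := exists_represents_coordSeq hΘ ht w
  obtain ⟨S, hS⟩ := exists_represents_σ (M := M) (A := JetQuot K ι w) f
  rw [M.mk_pairRes hV' ((represents_flatSeq hΘ.1 hS).zConnection_iterate hJ _),
    pairing_fundamental_mul hΘ.2.2,
    ← M.mk_pairRes hV (hS.zConnection_iterate (fun _ => deltaCoeff_eq_zero) _)]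

/-- The order of the factors does not matter by `coeff_pairing_delta_comm`; the resulting factor `2`
cancels the `1/2` in front of the quadratic expression. -/
theorem pairRes_flatSeq_coordSeq [CharZero K] (hΘ : M.IsSymmetricFundamentalSolution Θ)
    (ht : M.IsFlatGeneratingFunction Θ t) (k : ℤ) (f : JetFn K ι) :
    M.pairRes (M.flatSeq Θ f)
      ((zConnection (M.deltaTildeCoeff Θ))^[(k + 1).toNat] (M.coordSeq t)) =
      M.virasoroField Θ t k f := by
  obtain ⟨J, hJ⟩ := exists_deltaTildeCoeff_eq_zero hΘ.2.1
  rw [← pairRes_coordSeq_sField]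
  refine eq_of_forall_mk_eq fun w => ?_
  obtain ⟨V, hV, hV'⟩ := exists_represents_coordSeq hΘ ht w
  obtain ⟨S, hS⟩ := exists_represents_σ (M := M) (A := JetQuot K ι w) f
  rw [M.mk_pairRes (represents_flatSeq hΘ.1 hS) (hV'.zConnection_iterate hJ _),
    pairing_fundamental_mul hΘ.2.2, coeff_pairing_delta_comm,
    ← M.mk_pairRes hV (hS.zConnection_iterate (fun _ => deltaCoeff_eq_zero) _)]

end FrobeniusManifold

end JetFrobenius

end

noncomputable section

set_option linter.unusedSectionVars false

namespace JetFrobenius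

open MvPowerSeries

namespace FrobeniusManifold

variable {K ι : Type*} [Field K] [Fintype ι] [DecidableEq ι] {M : FrobeniusManifold K ι}
  {Θ : Matrix ι ι (PowerSeries (Fn K ι))} {t : ℤ → ι → JetFn K ι}

/-! ### Constancy of `R(z)` -/

theorem A_mul_comm (a d : ι) : M.A a * M.A d = M.A d * M.A a := by
  ext b c : 1
  rw [Matrix.mul_apply, Matrix.mul_apply]
  calc ∑ e, M.A a b e * M.A d e c = ∑ e, M.A a b e * M.A e d c := by simp only [M.comm d]
    _ = ∑ e, M.A b d e * M.A a e c := M.assoc a b d c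
    _ = _ := by simp only [M.comm b d]

theorem U_mul_A (d : ι) : M.U * M.A d = M.A d * M.U := by
  simp only [U, Matrix.sum_mul, Matrix.mul_sum, Matrix.smul_mul, Matrix.mul_smul, A_mul_comm _ d]

theorem pderiv_E (a d : ι) : pderiv K d (M.E a) = C (M.eulerLin d a) := by
  simp only [E, linearField, map_add, map_sum, Derivation.map_smul, pderiv_C, add_zero]
  rw [Finset.sum_eq_single d]
  · rw [pderiv_X_self, smul_eq_C_mul, mul_one]
  · intro b _ hb
    rw [pderiv_X_of_ne hb, smul_zero]
  · simp

/-- Closedness turns `E^a ∂_d A_a` into the derivative of `A_d` along `E`, which the homogeneity of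
the product computes. The scalar part of `μ` drops out of the commutator. -/
theorem map_pderiv_U (d : ι) : M.U.map (pderiv K d) =
    M.A d + (M.μ.map C * M.A d - M.A d * M.μ.map C) := by
  ext b c : 1
  have h1 : ∀ N : Matrix ι ι (Fn K ι), ∀ L : Matrix ι ι K,
      (((1 - M.r / 2) • (1 : Matrix ι ι K)).map C * N -
        N * ((1 - M.r / 2) • (1 : Matrix ι ι K)).map C) = 0 := by
    intro N L
    have : (((1 - M.r / 2) • (1 : Matrix ι ι K)).map C : Matrix ι ι (Fn K ι)) =
        (C (1 - M.r / 2) : Fn K ι) • 1 := by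
      ext a b : 1
      rw [Matrix.map_apply, Matrix.smul_apply, Matrix.smul_apply, Matrix.one_apply,
        Matrix.one_apply]
      split_ifs <;> simp
    rw [this, Matrix.smul_mul, Matrix.mul_smul, Matrix.one_mul, Matrix.mul_one, sub_self]
  have h2 : M.μ.map C * M.A d - M.A d * M.μ.map C =
      M.A d * M.eulerLin.map C - M.eulerLin.map C * M.A d := by
    have h3 : (M.μ.map C : Matrix ι ι (Fn K ι)) =
        ((1 - M.r / 2) • (1 : Matrix ι ι K)).map C - M.eulerLin.map C := by
      rw [μ]
      exact Matrix.map_sub _ (map_sub _) _ _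
    rw [h3, Matrix.sub_mul, Matrix.mul_sub, ← sub_eq_zero]
    have := h1 (M.A d) M.eulerLin
    rw [← this]
    abel
  have h4 := M.euler d b c
  rw [h2, Matrix.map_apply, U, Matrix.sum_apply, map_sum]
  simp only [Matrix.smul_apply, smul_eq_mul, Derivation.leibniz, pderiv_E, Finset.sum_add_distrib,
    Matrix.add_apply, Matrix.sub_apply, Matrix.mul_apply, Matrix.map_apply]
  have h5 : ∀ x, pderiv K d (M.A x b c) = pderiv K x (M.A d b c) := fun x => M.closed d x b c
  simp only [h5, smul_eq_C_mul] at h4 ⊢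
  have e1 : ∑ x, M.A x b c * C (M.eulerLin d x) = ∑ x, C (M.eulerLin d x) * M.A x b c :=
    Finset.sum_congr rfl fun x _ => mul_comm _ _
  have e2 : ∑ x, M.A d b x * C (M.eulerLin x c) = ∑ x, C (M.eulerLin x c) * M.A d b x :=
    Finset.sum_congr rfl fun x _ => mul_comm _ _
  rw [e1, e2]
  have h6 : ∑ x, M.E x * pderiv K x (M.A d b c) =
      ∑ x, linearField M.eulerLin M.eulerConst x * pderiv K x (M.A d b c) := rfl
  rw [h6]
  linear_combination h4

/-- Endomorphisms constant in `z`, as matrices of Laurent series. -/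
def constL (N : Matrix ι ι (Fn K ι)) : Matrix ι ι (LaurentSeries (JetFn K ι)) :=
  (N.map PowerSeries.C).map (toL (JetFn K ι))

theorem constL_apply (N : Matrix ι ι (Fn K ι)) (a b : ι) :
    constL N a b = HahnSeries.C (pullback (N a b)) := toL_C _

theorem constL_mul (N N' : Matrix ι ι (Fn K ι)) : constL (N * N') = constL N * constL N' := by
  simp only [constL, Matrix.map_mul]

theorem constL_add (N N' : Matrix ι ι (Fn K ι)) : constL (N + N') = constL N + constL N' := by
  ext a b : 1
  simp only [constL_apply, Matrix.add_apply, map_add]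

theorem constL_sub (N N' : Matrix ι ι (Fn K ι)) : constL (N - N') = constL N - constL N' := by
  ext a b : 1
  simp only [constL_apply, Matrix.sub_apply, map_sub]

theorem mEuler_constL (N : Matrix ι ι (Fn K ι)) : Laurent.mEuler (constL N) = 0 := by
  ext a b : 1
  rw [Laurent.mEuler, Matrix.map_apply, constL, Matrix.map_apply, Matrix.map_apply, euler_toL,
    PowerSeries.derivative_C, mul_zero, map_zero, Matrix.zero_apply]

theorem mapD_C (D : Derivation K (JetFn K ι) (JetFn K ι)) (g : JetFn K ι) :
    Laurent.mapD D (HahnSeries.C g) = HahnSeries.C (D g) := by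
  ext n
  rw [Laurent.coeff_mapD, HahnSeries.C_apply, HahnSeries.C_apply]
  rcases eq_or_ne n 0 with rfl | h
  · rw [HahnSeries.coeff_single_same, HahnSeries.coeff_single_same]
  · rw [HahnSeries.coeff_single_of_ne h, HahnSeries.coeff_single_of_ne h, map_zero]

theorem map_deltaSymbol : M.deltaSymbol.map (toL (JetFn K ι)) =
    constL ((M.μ + (1 / 2 : K) • 1).map C) + (Laurent.z : LaurentSeries (JetFn K ι)) • constL M.U := by
  rw [deltaSymbol_eq, Matrix.map_add _ (map_add _)]
  congr 1
  ext a b : 1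
  rw [Matrix.map_apply, Matrix.smul_apply, smul_eq_mul, map_mul, toL_X]
  rfl

/-- A vector field pulled back from the manifold acts on `Θ(z)` by `∇Θ = z Θ A`. -/
theorem map_mapD_fundamental (hΘ : M.IsFundamentalSolution Θ)
    (D : Derivation K (JetFn K ι) (JetFn K ι)) (x : ι → JetFn K ι)
    (hD : ∀ g : Fn K ι, D (pullback g) = ∑ d, x d * pullback (pderiv K d g)) :
    (Θ.map (toL (JetFn K ι))).map (Laurent.mapD D) = (Laurent.z : LaurentSeries (JetFn K ι)) •
      (Θ.map (toL (JetFn K ι)) * ∑ d, (HahnSeries.C (x d) : LaurentSeries (JetFn K ι)) •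
        constL (M.A d)) := by
  ext a b n : 3
  have e : ∀ (d c : ι) (m : ℤ), (toL (JetFn K ι) (Θ a c) *
      ((HahnSeries.C (x d) : LaurentSeries (JetFn K ι)) * constL (M.A d) c b)).coeff m =
      if 0 ≤ m then x d * (pullback (zCoeff m.toNat Θ a c) * pullback (M.A d c b)) else 0 := by
    intro d c m
    rw [constL_apply, ← map_mul, mul_comm, HahnSeries.C_mul_eq_smul, HahnSeries.coeff_smul,
      coeff_toL, smul_eq_mul]
    split_ifs
    · rw [mul_assoc, mul_comm (pullback (M.A d c b))]
      rfl
    · rw [mul_zero]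
  rw [Matrix.map_apply, Matrix.map_apply, Laurent.coeff_mapD, coeff_toL, Matrix.smul_apply,
    smul_eq_mul, Laurent.coeff_z_mul, Matrix.mul_apply, HahnSeries.coeff_sum]
  simp only [Matrix.sum_apply, Matrix.smul_apply, smul_eq_mul, Matrix.map_apply, Finset.mul_sum,
    HahnSeries.coeff_sum, e]
  rcases lt_trichotomy n 0 with h | rfl | h
  · rw [if_neg (by omega), map_zero]
    simp only [if_neg (by omega : ¬ 0 ≤ n - 1), Finset.sum_const_zero]
  · have h0 : PowerSeries.coeff 0 (Θ a b) = (1 : Matrix ι ι (Fn K ι)) a b := by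
      rw [← hΘ.1]
      rfl
    simp only [if_neg (by omega : ¬ (0 : ℤ) ≤ 0 - 1), Finset.sum_const_zero, le_refl, if_true]
    change D (pullback (PowerSeries.coeff 0 (Θ a b))) = 0
    rw [h0, hD]
    refine Finset.sum_eq_zero fun d _ => ?_
    rw [Matrix.one_apply]
    split_ifs <;> simp
  · obtain ⟨m, hm⟩ := Int.eq_ofNat_of_zero_le (by omega : 0 ≤ n - 1)
    obtain rfl : n = m + 1 := by omega
    have h0 : ∀ d, pderiv K d (PowerSeries.coeff (m + 1) (Θ a b)) = (zCoeff m Θ * M.A d) a b :=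
      fun d => by
        rw [← hΘ.2 d m]
        rfl
    rw [if_pos (by omega), show ((m : ℤ) + 1).toNat = m + 1 by omega, add_sub_cancel_right]
    change D (pullback _) = _
    rw [hD, Finset.sum_comm]
    refine Finset.sum_congr rfl fun d _ => ?_
    rw [h0, Matrix.mul_apply, map_sum, Finset.mul_sum]
    refine Finset.sum_congr rfl fun c _ => ?_
    rw [if_pos (by omega), map_mul, Int.toNat_natCast]

/-- `R(z)` is constant. -/
theorem map_mapD_R [CharZero K] (hΘ : M.IsFundamentalSolution Θ) (h : M.adjoint Θ * Θ = 1) (d : ι) :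
    ((M.R Θ).map (toL (JetFn K ι))).map (Laurent.mapD (pderiv K ((0, d) : ℕ × ι))) = 0 := by
  have hTT : Θ.map (toL (JetFn K ι)) * Θ⁻¹.map (toL (JetFn K ι)) = 1 := by
    rw [← Matrix.map_mul, mul_inv_self h, Matrix.map_one _ (map_zero _) (map_one _)]
  rw [map_toL_R, map_deltaSymbol]
  refine Laurent.map_mapD_gauge (B := constL (M.A d)) _ hTT ?_ ?_ ?_ ?_ (mEuler_constL _)
  · rw [map_mapD_fundamental hΘ _ (fun c => if c = d then 1 else 0) fun g => by
      rw [pderiv_pullback]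
      simp]
    congr 2
    rw [Finset.sum_eq_single d]
    · rw [if_pos rfl, map_one, one_smul]
    · intro b _ hb
      rw [if_neg hb, map_zero]
      exact zero_smul (LaurentSeries (JetFn K ι)) (constL (M.A b))
    · simp
  · ext a b : 1
    rw [Matrix.map_apply, constL_apply, mapD_C, Matrix.map_apply, pullback_C, pderiv_C, map_zero,
      Matrix.zero_apply]
  · have e : (M.μ + (1 / 2 : K) • 1).map (C : K → Fn K ι) * M.A d -
        M.A d * (M.μ + (1 / 2 : K) • 1).map C = M.μ.map C * M.A d - M.A d * M.μ.map C := by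
      have e1 : ((M.μ + (1 / 2 : K) • 1).map C : Matrix ι ι (Fn K ι)) =
          M.μ.map C + (C (1 / 2 : K) : Fn K ι) • 1 := by
        ext a b : 1
        simp only [Matrix.map_apply, Matrix.add_apply, Matrix.smul_apply, Matrix.one_apply, map_add,
          smul_eq_mul, map_mul]
        split_ifs <;> simp
      rw [e1, Matrix.add_mul, Matrix.mul_add, Matrix.smul_mul, Matrix.mul_smul, Matrix.one_mul,
        Matrix.mul_one]
      abel
    rw [← constL_mul, ← constL_mul, ← constL_sub, ← constL_add, e, ← map_pderiv_U]
    ext a b : 1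
    rw [Matrix.map_apply, constL_apply, mapD_C, constL_apply, Matrix.map_apply, pderiv_pullback]
  · rw [← constL_mul, ← constL_mul, U_mul_A]

theorem vectorField_deltaTildeCoeff [CharZero K] (hΘ : M.IsFundamentalSolution Θ)
    (h : M.adjoint Θ * Θ = 1) (v : ℕ × ι → JetFn K ι) (j : ℕ) (a b : ι) :
    vectorField v (M.deltaTildeCoeff Θ j a b) = 0 := by
  rw [deltaTildeCoeff, Matrix.map_apply, vectorField_pullback]
  refine Finset.sum_eq_zero fun d _ => ?_
  have h1 := congrArg (fun f => f.coeff (j : ℤ)) (congrFun (congrFun (map_mapD_R hΘ h d) a) b)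
  rw [Matrix.map_apply, Laurent.coeff_mapD, Matrix.map_apply, coeff_toL, if_pos (by omega),
    Int.toNat_natCast] at h1
  rw [← pderiv_pullback]
  exact (congrArg _ h1).trans (mul_zero _)

/-- Constancy of `R(z)` makes `∂_{m,a}` linear over the coefficients of `δ̃`. -/
theorem flatField_zConnection [CharZero K] (hΘ : M.IsSymmetricFundamentalSolution Θ) (m : ℕ) (a : ι)
    (N : ℕ) (f : ℤ → ι → JetFn K ι) :
    (zConnection (M.deltaTildeCoeff Θ))^[N] (fun n c => M.flatField Θ m a (f n c)) =
      fun n c => M.flatField Θ m a ((zConnection (M.deltaTildeCoeff Θ))^[N] f n c) := by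
  obtain ⟨J, hJ⟩ := exists_deltaTildeCoeff_eq_zero hΘ.2.1
  refine zConnection_iterate_map hJ (M.flatD hΘ.1 m a).toLinearMap.toAddMonoidHom (fun j b c v => ?_)
    N f
  change M.flatD hΘ.1 m a (M.deltaTildeCoeff Θ j b c * v) = _ * M.flatD hΘ.1 m a v
  rw [Derivation.leibniz, flatD_apply _ _ _ _ (M.deltaTildeCoeff Θ j b c), flatField,
    vectorField_deltaTildeCoeff hΘ.1 hΘ.2.2, smul_zero, add_zero, smul_eq_mul]

/-! ### The second-order part -/

theorem sum_range_sum_range_eq {R : Type*} [AddCommMonoid R] (J : ℕ) (F : ℕ → ℕ → R)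
    (h : ∀ i j, J ≤ i + j → F i j = 0) : ∑ i ∈ Finset.range J, ∑ j ∈ Finset.range J, F i j =
      ∑ m ∈ Finset.range J, ∑ ij ∈ Finset.HasAntidiagonal.antidiagonal m, F ij.1 ij.2 := by
  simp only [Finset.Nat.sum_antidiagonal_eq_sum_range_succ_mk]
  rw [Finset.sum_range_diag_flip]
  refine Finset.sum_congr rfl fun i _ => ?_
  symm
  refine Finset.sum_subset (fun j hj => ?_) fun j _ hj => h i j ?_
  · rw [Finset.mem_range] at hj ⊢
    omega
  · rw [Finset.mem_range] at hj
    omega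

variable (M) in
/-- The truncation of `σ_d(-z)` to powers of `z` less than `J`, acting on Laurent series. -/
def σL (J : ℕ) (d : ι) : LaurentSeries (JetFn K ι) →+ LaurentSeries (JetFn K ι) :=
  ∑ j ∈ Finset.range J, (AddMonoidHom.mulLeft (Laurent.neg K ((Laurent.z : LaurentSeries (JetFn K ι)) ^ j))).comp
    (Laurent.mapD (M.σD j d))

theorem σL_apply (J : ℕ) (d : ι) (f : LaurentSeries (JetFn K ι)) : M.σL J d f =
    ∑ j ∈ Finset.range J, Laurent.neg K ((Laurent.z : LaurentSeries (JetFn K ι)) ^ j) *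
      Laurent.mapD (M.σD j d) f := by
  rw [σL, AddMonoidHom.finsetSum_apply]
  rfl

theorem coeff_neg_z_pow_mul {A : Type*} [CommRing A] [Algebra K A] (j : ℕ) (f : LaurentSeries A)
    (n : ℤ) : (Laurent.neg K ((Laurent.z : LaurentSeries A) ^ j) * f).coeff n =
      ((-1 : K) ^ j) • f.coeff (n - j) := by
  induction j generalizing n with
  | zero => simp
  | succ j ih =>
    rw [pow_succ', map_mul, Laurent.neg_z, neg_mul, neg_mul, HahnSeries.coeff_neg, mul_assoc,
      Laurent.coeff_z_mul, ih, pow_succ', neg_one_mul, neg_smul,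
      show n - 1 - (j : ℤ) = n - (j + 1 : ℕ) by push_cast; ring]

theorem coeff_σL (J : ℕ) (d : ι) (f : LaurentSeries (JetFn K ι)) (n : ℤ) : (M.σL J d f).coeff n =
    ∑ j ∈ Finset.range J, ((-1 : K) ^ j) • M.σ j d (f.coeff (n - j)) := by
  rw [σL_apply, HahnSeries.coeff_sum]
  refine Finset.sum_congr rfl fun j _ => ?_
  rw [coeff_neg_z_pow_mul, Laurent.coeff_mapD, σD_apply]

theorem σL_mul (J : ℕ) (d : ι) (f g : LaurentSeries (JetFn K ι)) :
    M.σL J d (f * g) = M.σL J d f * g + f * M.σL J d g := by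
  simp only [σL_apply, Laurent.mapD_mul, mul_add, Finset.sum_add_distrib, Finset.sum_mul,
    Finset.mul_sum, mul_assoc]
  congr 1
  exact Finset.sum_congr rfl fun j _ => mul_left_comm _ _ _

variable (M) in
/-- The endomorphism `A_{σ_d(z)}` as a matrix of Laurent series. -/
def 𝓦L (d : ι) : Matrix ι ι (LaurentSeries (JetFn K ι)) := (M.𝓦 d).map HahnSeries.C

theorem constL_𝓦 (d : ι) : ∑ e, (HahnSeries.C (M.𝓧 d e) : LaurentSeries (JetFn K ι)) •
    constL (M.A e) = M.𝓦L d := by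
  ext a b : 1
  simp only [Matrix.sum_apply, Matrix.smul_apply, constL_apply, 𝓦L, 𝓦, Matrix.map_apply, smul_eq_mul,
    map_sum, map_mul]

/-- On functions pulled back from the manifold only `σ_{0,d}` acts, through `𝓧`. The result is the
connection term `z A_σ` of `residueCovariant`. -/
theorem map_σL_fundamental (hΘ : M.IsFundamentalSolution Θ) {J : ℕ} (hJ : 0 < J) (d : ι) :
    (Θ.map (toL (JetFn K ι))).map (M.σL J d) = (Laurent.z : LaurentSeries (JetFn K ι)) •
      (Θ.map (toL (JetFn K ι)) * M.𝓦L d) := by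
  rw [← constL_𝓦, ← map_mapD_fundamental hΘ (M.σD 0 d) _ fun g => by
    rw [σD_apply]
    exact M.σ_zero_pullback d g]
  ext a b : 1
  rw [Matrix.map_apply, σL_apply, Finset.sum_eq_single 0]
  · rw [pow_zero, map_one, one_mul, Matrix.map_apply]
    rfl
  · intro j _ hj
    obtain ⟨j, rfl⟩ := Nat.exists_eq_succ_of_ne_zero hj
    convert mul_zero _
    refine HahnSeries.ext (funext fun n => ?_)
    rw [Laurent.coeff_mapD, Matrix.map_apply, coeff_toL, σD_apply]
    split_ifs
    · exact M.σ_succ_pullback j d _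
    · rw [← σD_apply, map_zero]
      rfl
  · intro h
    exact absurd (Finset.mem_range.mpr hJ) h

theorem map_σL_mul {κ : Type*} (J : ℕ) (d : ι) (F : Matrix ι ι (LaurentSeries (JetFn K ι)))
    (G : Matrix ι κ (LaurentSeries (JetFn K ι))) :
    (F * G).map (M.σL J d) = F.map (M.σL J d) * G + F * G.map (M.σL J d) := by
  ext i j : 2
  simp only [Matrix.map_apply, Matrix.mul_apply, Matrix.add_apply, map_sum, σL_mul,
    ← Finset.sum_add_distrib]

theorem exists_coeff_eq_zero_nat {A : Type*} [CommRing A] (F : Matrix ι Unit (LaurentSeries A)) :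
    ∃ J : ℕ, ∀ n : ℤ, n < -1 - J → ∀ c, (F c ()).coeff n = 0 := by
  choose N hN using fun c => Laurent.exists_coeff_eq_zero (F c ())
  refine ⟨∑ c, (N c).natAbs, fun n hn c => hN c n ?_⟩
  have : (N c).natAbs ≤ ∑ c, (N c).natAbs :=
    Finset.single_le_sum (f := fun c => (N c).natAbs) (fun _ _ => Nat.zero_le _) (Finset.mem_univ c)
  omega

/-- This reads `∂(-z) = Θ(-z) σ(-z)` inside the residue. The truncation at `J` is exact: terms with
`i + j ≥ J` involve coefficients of `G` below its lower bound. -/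
theorem sum_flatField_eq (hΘ : M.IsFundamentalSolution Θ) {J : ℕ}
    {G : LaurentSeries (JetFn K ι)} (hG : ∀ n : ℤ, n < -1 - J → G.coeff n = 0) (a : ι) :
    ∑ m ∈ Finset.range J, ((-1 : K) ^ m) • M.flatField Θ m a (G.coeff (-2 - m)) =
      (∑ d, Laurent.neg K (toL (JetFn K ι) (Θ a d)) * M.σL J d G).coeff (-2) := by
  have e : ∀ d, (Laurent.neg K (toL (JetFn K ι) (Θ a d)) * M.σL J d G).coeff (-2) =
      ∑ m ∈ Finset.range J, ∑ ij ∈ Finset.HasAntidiagonal.antidiagonal m,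
        ((-1 : K) ^ ij.1) • (jetCoeff Θ ij.1 a d * (((-1 : K) ^ ij.2) • M.σ ij.2 d
          (G.coeff (-2 - ij.1 - ij.2)))) := by
    intro d
    have h0 : ∀ i j : ℕ, J ≤ i + j → M.σ j d (G.coeff (-2 - i - j)) = 0 := fun i j hij => by
      rw [hG _ (by omega), ← σD_apply, map_zero]
    rw [← sum_range_sum_range_eq J (fun i j => ((-1 : K) ^ i) • (jetCoeff Θ i a d *
      (((-1 : K) ^ j) • M.σ j d (G.coeff (-2 - i - j))))) fun i j hij => by
        rw [h0 i j hij, smul_zero, mul_zero, smul_zero]]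
    rw [neg_toL, toL_apply, (Laurent.coeff_ofPowerSeries_mul _ _ _).2,
      finsum_eq_sum_of_support_subset (s := Finset.range J)]
    · refine Finset.sum_congr rfl fun i _ => ?_
      rw [PowerSeries.coeff_mk, coeff_σL, PowerSeries.evalNegHom,
        PowerSeries.coeff_rescale, ← Finset.smul_sum, ← Finset.mul_sum, ← smul_mul_assoc]
      congr 1
      rw [Algebra.smul_def]
      simp only [map_mul, map_pow, map_neg, map_one]
      rfl
    · intro i hi
      by_contra hlt
      rw [Finset.coe_range, Set.mem_Iio, not_lt] at hlt
      refine hi ?_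
      dsimp only
      rw [coeff_σL, Finset.sum_eq_zero, mul_zero]
      intro j _
      rw [h0 i j (by omega), smul_zero]
  rw [HahnSeries.coeff_sum]
  simp only [e]
  rw [Finset.sum_comm]
  refine Finset.sum_congr rfl fun m _ => ?_
  rw [flatField_eq_sum hΘ, Finset.sum_comm, Finset.smul_sum]
  refine Finset.sum_congr rfl fun d _ => ?_
  rw [Finset.smul_sum]
  refine Finset.sum_congr rfl fun ij hij => ?_
  rw [Finset.HasAntidiagonal.mem_antidiagonal] at hij
  rw [mul_smul_comm, smul_smul, ← pow_add, hij, show (-2 : ℤ) - ij.1 - ij.2 = -2 - m by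
    rw [← hij]; push_cast; ring]

/-- The second-order part of the Virasoro operator. -/
theorem formalSum_flatField_flatSeq [CharZero K] (hΘ : M.IsSymmetricFundamentalSolution Θ) (k : ℤ)
    (f : JetFn K ι) :
    formalSum (fun m : ℤ => ((-1 : K) ^ m) • ∑ a, ∑ b, M.η⁻¹ a b •
      if 0 ≤ m then M.flatField Θ m.toNat a
        ((zConnection (M.deltaTildeCoeff Θ))^[(k + 1).toNat] (M.flatSeq Θ f) (-2 - m) b) else 0) =
      (2 : K) • M.secondOrder k f := by
  obtain ⟨J, hJ⟩ := exists_deltaTildeCoeff_eq_zero hΘ.2.1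
  obtain ⟨S, hS⟩ := exists_represents_σ (M := M) (A := JetFn K ι) f
  have hH := hS.zConnection_iterate (R := M.deltaCoeff) (fun _ => deltaCoeff_eq_zero) (k + 1).toNat
  have hG := (represents_flatSeq hΘ.1 hS).zConnection_iterate hJ (k + 1).toNat
  rw [delta_fundamental_mul _ hΘ.2.2] at hG
  set H := (Laurent.delta (symbol (JetFn K ι) M.deltaCoeff))^[(k + 1).toNat] S with hHdef
  set T := Θ.map (toL (JetFn K ι)) with hT
  set g := (zConnection (M.deltaTildeCoeff Θ))^[(k + 1).toNat] (M.flatSeq Θ f) with hg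
  have hG' : ∀ n c, g n c = ((T * H) c ()).coeff n := hG
  have hH' : ∀ n c, M.deltaSigma k n c f = (H c ()).coeff n := fun n c => by
    rw [deltaSigma_apply]
    exact hH n c
  obtain ⟨J1, hJ1⟩ := exists_coeff_eq_zero_nat H
  obtain ⟨J2, hJ2⟩ := exists_coeff_eq_zero_nat (T * H)
  obtain ⟨J, hJ0, h1, h2⟩ : ∃ J : ℕ, 0 < J ∧ J1 ≤ J ∧ J2 ≤ J :=
    ⟨J1 + J2 + 1, by omega, by omega, by omega⟩
  let W : ι → Matrix ι Unit (LaurentSeries (JetFn K ι)) := fun d =>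
    (Laurent.z : LaurentSeries (JetFn K ι)) • (M.𝓦L d * H) + H.map (M.σL J d)
  -- By the Leibniz rule, `Θ` intertwines plain differentiation along `σ_d(-z)` with the Dubrovin
  -- covariant derivative.
  have hW : ∀ d, (T * H).map (M.σL J d) = T * W d := fun d => by
    rw [map_σL_mul, map_σL_fundamental hΘ.1 hJ0, Matrix.mul_add, Matrix.smul_mul, Matrix.mul_smul,
      Matrix.mul_assoc, ← hT]
  have hQ : ∀ a b, M.coMetric (JetFn K ι) a b =
      HahnSeries.C (algebraMap K (JetFn K ι) (M.η⁻¹ a b)) := fun a b => by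
    rw [coMetric, Matrix.map_apply, constMatrix, Matrix.map_apply, toL_C, pullback_C]
    rfl
  have hQmul : ∀ a b (F : LaurentSeries (JetFn K ι)) n,
      (M.coMetric (JetFn K ι) a b * F).coeff n = M.η⁻¹ a b • F.coeff n := fun a b F n => by
    rw [hQ, HahnSeries.C_mul_eq_smul, HahnSeries.coeff_smul, smul_eq_mul, ← Algebra.smul_def]
  have lhs : formalSum (fun m : ℤ => ((-1 : K) ^ m) • ∑ a, ∑ b, M.η⁻¹ a b •
      if 0 ≤ m then M.flatField Θ m.toNat a (g (-2 - m) b) else 0) =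
      (∑ d, (M.coMetric (JetFn K ι) * W d) d ()).coeff (-2) := by
    have e1 : ∀ d, (M.coMetric (JetFn K ι) * W d) d () = ∑ a, Laurent.neg K (T a d) *
        ∑ b, M.coMetric (JetFn K ι) a b * M.σL J d ((T * H) b ()) := fun d => by
      -- Orthogonality is used backwards: the bare cometric is written as `Θ(-z)ᵀ η⁻¹ Θ(z)`, whose
      -- left factor assembles `∂(-z)` from `σ(-z)`.
      have h3 := congrArg (fun N => N * W d) (coMetric_fundamental (JetFn K ι) hΘ.2.2)
      rw [← h3, Matrix.mul_assoc, Matrix.mul_assoc, ← hT, ← hW, Matrix.mul_apply]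
      rfl
    have e2 : ∑ d, ∑ a, Laurent.neg K (T a d) *
        ∑ b, M.coMetric (JetFn K ι) a b * M.σL J d ((T * H) b ()) =
        ∑ a, ∑ b, M.coMetric (JetFn K ι) a b *
          ∑ d, Laurent.neg K (T a d) * M.σL J d ((T * H) b ()) := by
      rw [Finset.sum_comm]
      simp only [Finset.mul_sum]
      refine Finset.sum_congr rfl fun a _ => ?_
      rw [Finset.sum_comm]
      exact Finset.sum_congr rfl fun b _ => Finset.sum_congr rfl fun d _ => mul_left_comm _ _ _
    have e3 : ∀ a b, (∑ d, Laurent.neg K (T a d) * M.σL J d ((T * H) b ())).coeff (-2) =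
        ∑ m ∈ Finset.range J, ((-1 : K) ^ m) • M.flatField Θ m a (g (-2 - m) b) := fun a b => by
      simp only [hG']
      exact (sum_flatField_eq hΘ.1 (fun n hn => hJ2 n (by omega) b) a).symm
    simp only [e1, e2, HahnSeries.coeff_sum, hQmul]
    simp only [← HahnSeries.coeff_sum, e3]
    rw [formalSum_eq_sum ((Finset.range J).map Nat.castEmbedding), Finset.sum_map]
    · simp only [Nat.castEmbedding_apply, Finset.smul_sum]
      rw [Finset.sum_comm]
      refine Finset.sum_congr rfl fun a _ => ?_
      rw [Finset.sum_comm]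
      refine Finset.sum_congr rfl fun b _ => Finset.sum_congr rfl fun m _ => ?_
      rw [if_pos (Int.natCast_nonneg m), Int.toNat_natCast, zpow_natCast, smul_comm]
    · intro m hm
      rw [Finset.sum_eq_zero, smul_zero]
      refine fun a _ => Finset.sum_eq_zero fun b _ => ?_
      split_ifs with h0
      · obtain ⟨m, rfl⟩ := Int.eq_ofNat_of_zero_le h0
        have hm' : J ≤ m := by
          by_contra hlt
          exact hm (Finset.mem_map.mpr ⟨m, Finset.mem_range.mpr (not_le.mp hlt), rfl⟩)
        rw [hG', hJ2 _ (by omega), ← flatD_apply _ hΘ.1, map_zero, smul_zero]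
      · rw [smul_zero]
  rw [lhs, secondOrder, smul_smul, mul_one_div_cancel two_ne_zero, one_smul, HahnSeries.coeff_sum]
  refine Finset.sum_congr rfl fun d _ => ?_
  rw [Matrix.mul_apply, HahnSeries.coeff_sum]
  refine Finset.sum_congr rfl fun b _ => ?_
  rw [hQmul]
  congr 1
  simp only [W, Matrix.add_apply, Matrix.smul_apply, smul_eq_mul, HahnSeries.coeff_add,
    Laurent.coeff_z_mul, Matrix.map_apply, coeff_σL, residueCovariant]
  rw [add_comm]
  congr 1
  · rw [formalSum_eq_sum (Finset.range J)]
    · refine Finset.sum_congr rfl fun j _ => ?_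
      rw [hH', show (-1 : ℤ) - j - 1 = -2 - j by ring]
    · intro j hj
      rw [Finset.mem_range, not_lt] at hj
      rw [hH', hJ1 _ (by omega), ← σD_apply, map_zero, smul_zero]
  · rw [Matrix.mul_apply, HahnSeries.coeff_sum]
    refine Finset.sum_congr rfl fun c _ => ?_
    rw [𝓦L, Matrix.map_apply, hH', HahnSeries.C_mul_eq_smul, HahnSeries.coeff_smul, smul_eq_mul]

end FrobeniusManifold

end JetFrobenius

end

noncomputable section

set_option linter.unusedSectionVars false

namespace JetFrobenius

namespace Laurent

/-! ### Traces of powers of connections -/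

variable {A : Type*} [CommRing A] {ι κ : Type*} [Fintype ι] [DecidableEq ι]

/-- The matrix of coefficients of `z^n`. -/
def mCoeff {l : Type*} (n : ℤ) (F : Matrix l κ (LaurentSeries A)) : Matrix l κ A :=
  F.map fun f => f.coeff n

/-- A matrix of constant series. -/
def mC {l : Type*} (N : Matrix l κ A) : Matrix l κ (LaurentSeries A) := N.map HahnSeries.C

theorem mCoeff_apply {l : Type*} (n : ℤ) (F : Matrix l κ (LaurentSeries A)) (a : l) (b : κ) :
    mCoeff n F a b = (F a b).coeff n := rfl

theorem mCoeff_add {l : Type*} (n : ℤ) (F G : Matrix l κ (LaurentSeries A)) :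
    mCoeff n (F + G) = mCoeff n F + mCoeff n G := rfl

theorem mCoeff_z_smul {l : Type*} (n : ℤ) (F : Matrix l κ (LaurentSeries A)) :
    mCoeff n ((z : LaurentSeries A) • F) = mCoeff (n - 1) F := by
  ext a b : 1
  rw [mCoeff_apply, Matrix.smul_apply, smul_eq_mul, coeff_z_mul, mCoeff_apply]

theorem mCoeff_zInv_smul {l : Type*} (n : ℤ) (F : Matrix l κ (LaurentSeries A)) :
    mCoeff n ((zInv : LaurentSeries A) • F) = mCoeff (n + 1) F := by
  ext a b : 1
  rw [mCoeff_apply, Matrix.smul_apply, smul_eq_mul, coeff_zInv_mul, mCoeff_apply]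

theorem mCoeff_mC_mul (n : ℤ) (N : Matrix ι ι A) (F : Matrix ι κ (LaurentSeries A)) :
    mCoeff n (mC N * F) = N * mCoeff n F := by
  ext a b : 1
  rw [mCoeff_apply, Matrix.mul_apply, Matrix.mul_apply, HahnSeries.coeff_sum]
  refine Finset.sum_congr rfl fun c _ => ?_
  rw [mC, Matrix.map_apply, HahnSeries.C_mul_eq_smul, HahnSeries.coeff_smul, smul_eq_mul,
    mCoeff_apply]

theorem mCoeff_mul_mC [Fintype κ] {l : Type*} (n : ℤ) (F : Matrix l ι (LaurentSeries A))
    (N : Matrix ι κ A) : mCoeff n (F * mC N) = mCoeff n F * N := by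
  ext a b : 1
  rw [mCoeff_apply, Matrix.mul_apply, Matrix.mul_apply, HahnSeries.coeff_sum]
  refine Finset.sum_congr rfl fun c _ => ?_
  rw [mC, Matrix.map_apply, mul_comm, HahnSeries.C_mul_eq_smul, HahnSeries.coeff_smul, smul_eq_mul,
    mCoeff_apply, mul_comm]

theorem mCoeff_mEuler {l : Type*} (n : ℤ) (F : Matrix l κ (LaurentSeries A)) :
    mCoeff n (mEuler F) = (n : A) • mCoeff n F := by
  ext a b : 1
  rw [mCoeff_apply, mEuler, Matrix.map_apply, coeff_euler, Matrix.smul_apply, mCoeff_apply,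
    zsmul_eq_mul, smul_eq_mul]

theorem mEuler_mC {l : Type*} (N : Matrix l κ A) : mEuler (mC N) = 0 := by
  ext a b n
  rw [mEuler, Matrix.map_apply, coeff_euler, mC, Matrix.map_apply, HahnSeries.C_apply]
  rcases eq_or_ne n 0 with rfl | h
  · rw [zero_smul]; rfl
  · rw [HahnSeries.coeff_single_of_ne h, smul_zero]; rfl

theorem mCoeff_one (n : ℤ) :
    mCoeff n (1 : Matrix ι ι (LaurentSeries A)) = if n = 0 then 1 else 0 := by
  ext a b : 1
  rw [mCoeff_apply, Matrix.one_apply]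
  split_ifs with h1 h2 h2
  · rw [h1, h2, HahnSeries.coeff_one, if_pos rfl, Matrix.one_apply_eq]
  · rw [HahnSeries.coeff_one, if_neg h2, Matrix.zero_apply]
  · rw [Matrix.one_apply_ne h1]; rfl
  · rfl

theorem trace_mCoeff_mul_comm (n : ℤ) (F G : Matrix ι ι (LaurentSeries A)) :
    (mCoeff n (F * G)).trace = (mCoeff n (G * F)).trace := by
  have h := congrArg (fun f => f.coeff n) (Matrix.trace_mul_comm F G)
  simp only [Matrix.trace, Matrix.diag_apply, HahnSeries.coeff_sum] at h
  exact h

/-- `δ^q 1`. -/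
def deltaPow (S : Matrix ι ι (LaurentSeries A)) (q : ℕ) : Matrix ι ι (LaurentSeries A) :=
  (delta S)^[q] (1 : Matrix ι ι (LaurentSeries A))

theorem deltaPow_zero (S : Matrix ι ι (LaurentSeries A)) : deltaPow S 0 = 1 := rfl

theorem deltaPow_succ (S : Matrix ι ι (LaurentSeries A)) (q : ℕ) :
    deltaPow S (q + 1) = delta S (deltaPow S q) :=
  Function.iterate_succ_apply' _ _ _

section Linear

variable (V U : Matrix ι ι A)

theorem mCoeff_delta (n : ℤ) (F : Matrix ι κ (LaurentSeries A)) :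
    mCoeff n (delta (mC V + (z : LaurentSeries A) • mC U) F) =
      ((n + 1 : ℤ) : A) • mCoeff (n + 1) F + V * mCoeff (n + 1) F + U * mCoeff n F := by
  rw [delta, mCoeff_zInv_smul, mCoeff_add, mCoeff_mEuler, Matrix.add_mul, mCoeff_add, mCoeff_mC_mul,
    Matrix.smul_mul, mCoeff_z_smul, mCoeff_mC_mul, add_sub_cancel_right, add_assoc]

/-- Each use of `V` or of `∂_z` lowers the degree by one, and `∂_z` kills the constant term. So `V`
occurs exactly once in degree `-1`. -/
theorem mCoeff_delta_iterate (q : ℕ) :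
    (∀ n > 0, mCoeff n (deltaPow (mC V + (z : LaurentSeries A) • mC U) q) = 0) ∧
    mCoeff 0 (deltaPow (mC V + (z : LaurentSeries A) • mC U) q) = U ^ q ∧
    mCoeff (-1) (deltaPow (mC V + (z : LaurentSeries A) • mC U) q) =
      ∑ j ∈ Finset.range q, U ^ j * V * U ^ (q - 1 - j) := by
  induction q with
  | zero =>
    refine ⟨fun n hn => ?_, ?_, ?_⟩
    · rw [deltaPow_zero, mCoeff_one, if_neg (by omega)]
    · rw [deltaPow_zero, mCoeff_one, if_pos rfl, pow_zero]
    · rw [deltaPow_zero, mCoeff_one, if_neg (by omega), Finset.sum_range_zero]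
  | succ q ih =>
    obtain ⟨h1, h2, h3⟩ := ih
    refine ⟨fun n hn => ?_, ?_, ?_⟩
    · rw [deltaPow_succ, mCoeff_delta, h1 (n + 1) (by omega), h1 n hn, smul_zero,
        Matrix.mul_zero, Matrix.mul_zero, add_zero, add_zero]
    · rw [deltaPow_succ, mCoeff_delta, h1 (0 + 1) (by omega), h2, smul_zero,
        Matrix.mul_zero, add_zero, zero_add, pow_succ']
    · rw [deltaPow_succ, mCoeff_delta, h3, show (-1 : ℤ) + 1 = 0 by norm_num, h2,
        Int.cast_zero, zero_smul, zero_add, Finset.sum_range_succ', pow_zero, Matrix.one_mul,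
        Nat.sub_zero, Nat.add_sub_cancel, add_comm, Matrix.mul_sum]
      congr 1
      refine Finset.sum_congr rfl fun j _ => ?_
      rw [pow_succ', show q - (j + 1) = q - 1 - j by omega]
      simp only [Matrix.mul_assoc]

/-- The second descent in degree starts from `z⁻¹`, where `∂_z` contributes `-1`; hence `V - 1` in
place of `V`. -/
theorem mCoeff_neg_two_delta_iterate (q : ℕ) :
    mCoeff (-2) (deltaPow (mC V + (z : LaurentSeries A) • mC U) q) =
      ∑ i ∈ Finset.range q, ∑ j ∈ Finset.range (q - 1 - i),
        U ^ i * ((V - 1) * (U ^ j * V * U ^ (q - 1 - i - 1 - j))) := by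
  induction q with
  | zero => rw [deltaPow_zero, mCoeff_one, if_neg (by omega), Finset.sum_range_zero]
  | succ q ih =>
    rw [deltaPow_succ, mCoeff_delta, ih, show (-2 : ℤ) + 1 = -1 by norm_num,
      (mCoeff_delta_iterate V U q).2.2, Finset.sum_range_succ', pow_zero, Nat.add_sub_cancel,
      Nat.sub_zero, add_comm, Matrix.mul_sum]
    congr 1
    · refine Finset.sum_congr rfl fun i _ => ?_
      rw [Matrix.mul_sum, show q - (i + 1) = q - 1 - i by omega]
      refine Finset.sum_congr rfl fun j _ => ?_
      rw [pow_succ', Matrix.mul_assoc U]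
    · simp only [Matrix.one_mul]
      rw [← Matrix.mul_sum, Matrix.sub_mul, Matrix.one_mul, Int.cast_neg, Int.cast_one, neg_one_smul]
      abel

/-- By cyclicity of the trace, the terms with the same number `j` of factors `U` between `V - 1` and
`V` coincide, and there are `q - 1 - j` of them. The traces are symmetric under `j ↦ q - 2 - j`, so
adding the reflected sum makes every multiplicity `q`. -/
theorem two_mul_trace_mCoeff_delta_iterate (q : ℕ) :
    2 * (mCoeff (-2) (deltaPow (mC V + (z : LaurentSeries A) • mC U) q)).trace =
      q * ∑ j ∈ Finset.range (q - 1), ((V - 1) * U ^ j * V * U ^ (q - 2 - j)).trace := by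
  set T : ℕ → A := fun j => ((V - 1) * U ^ j * V * U ^ (q - 2 - j)).trace with hT
  have h1 : (mCoeff (-2) (deltaPow (mC V + (z : LaurentSeries A) • mC U) q)).trace =
      ∑ j ∈ Finset.range (q - 1), ((q - 1 - j : ℕ) : A) * T j := by
    rw [mCoeff_neg_two_delta_iterate, Matrix.trace_sum]
    have h2 : ∀ i ∈ Finset.range q, (∑ j ∈ Finset.range (q - 1 - i),
        U ^ i * ((V - 1) * (U ^ j * V * U ^ (q - 1 - i - 1 - j)))).trace =
        ∑ j ∈ Finset.range (q - 1 - i), T j := fun i hi => by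
      rw [Matrix.trace_sum]
      refine Finset.sum_congr rfl fun j hj => ?_
      rw [Finset.mem_range] at hi hj
      rw [Matrix.trace_mul_comm, hT]
      dsimp only
      rw [show q - 2 - j = q - 1 - i - 1 - j + i by omega, pow_add]
      simp only [Matrix.mul_assoc]
    rw [Finset.sum_congr rfl h2, Finset.sum_comm' (t' := Finset.range (q - 1))
      (s' := fun j => Finset.range (q - 1 - j))]
    · refine Finset.sum_congr rfl fun j _ => ?_
      rw [Finset.sum_const, Finset.card_range, nsmul_eq_mul]
    · intro i j
      simp only [Finset.mem_range]
      omega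
  -- Replacing `V - 1` by `V` changes the trace by a quantity independent of `j`; with two factors
  -- `V` the symmetry is cyclicity.
  have hsymm : ∀ j ∈ Finset.range (q - 1), T (q - 1 - 1 - j) = T j := fun j hj => by
    rw [Finset.mem_range] at hj
    have h3 : ∀ i l, i + l = q - 2 → ((V - 1) * U ^ i * V * U ^ l).trace =
        (V * U ^ i * V * U ^ l).trace - (V * U ^ (q - 2)).trace := fun i l hil => by
      rw [Matrix.sub_mul, Matrix.sub_mul, Matrix.sub_mul, Matrix.trace_sub, Matrix.one_mul,
        Matrix.mul_assoc (U ^ i), Matrix.trace_mul_comm (U ^ i), Matrix.mul_assoc V (U ^ l),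
        ← pow_add, add_comm l, hil]
    rw [hT]
    dsimp only
    rw [h3 _ _ (by omega), h3 _ _ (by omega), show q - 2 - (q - 1 - 1 - j) = j by omega,
      show q - 1 - 1 - j = q - 2 - j by omega, Matrix.mul_assoc (V * _), Matrix.trace_mul_comm,
      ← Matrix.mul_assoc]
  have h4 : ∑ j ∈ Finset.range (q - 1), ((q - 1 - j : ℕ) : A) * T j =
      ∑ j ∈ Finset.range (q - 1), ((j + 1 : ℕ) : A) * T j := by
    rw [← Finset.sum_range_reflect]
    refine Finset.sum_congr rfl fun j hj => ?_
    rw [hsymm j hj]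
    rw [Finset.mem_range] at hj
    congr 2
    omega
  rw [two_mul, h1]
  nth_rewrite 2 [h4]
  rw [← Finset.sum_add_distrib, Finset.mul_sum]
  refine Finset.sum_congr rfl fun j hj => ?_
  rw [Finset.mem_range] at hj
  rw [← add_mul, ← Nat.cast_add, show q - 1 - j + (j + 1) = q by omega]

end Linear

section Conformal

/-- If `[ν, R] = ε z dR/dz` for a constant matrix `ν`, then `[ν, δ^q 1] = ε (z d/dz + q) δ^q 1`. -/
theorem conformal_delta_iterate {ν R : Matrix ι ι (LaurentSeries A)} {ε : A}
    (hν : mEuler ν = 0) (hR : ν * R - R * ν = (HahnSeries.C ε : LaurentSeries A) • mEuler R) (q : ℕ) :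
    ν * deltaPow R q - deltaPow R q * ν = (HahnSeries.C ε : LaurentSeries A) •
      (mEuler (deltaPow R q) + (q : LaurentSeries A) • deltaPow R q) := by
  induction q with
  | zero => simp [deltaPow_zero, mEuler_one]
  | succ q ih =>
    rw [deltaPow_succ]
    set Y := deltaPow R q with hY
    have h1 : mEuler (ν * Y - Y * ν) = ν * mEuler Y - mEuler Y * ν := by
      rw [sub_eq_add_neg, mEuler_add, mEuler_mul, hν, Matrix.zero_mul, zero_add,
        ← neg_one_smul (LaurentSeries A) (Y * ν), mEuler_smul, mEuler_mul, hν, Matrix.mul_zero,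
        add_zero, map_neg, euler_one, neg_zero, zero_smul, zero_add, neg_one_smul, sub_eq_add_neg]
    have h2 : ν * (R * Y) - R * Y * ν = (ν * R - R * ν) * Y + R * (ν * Y - Y * ν) := by
      noncomm_ring
    have hC : euler (HahnSeries.C ε : LaurentSeries A) = 0 := by
      ext n
      rw [coeff_euler, HahnSeries.C_apply]
      rcases eq_or_ne n 0 with rfl | h
      · rw [zero_smul]; rfl
      · rw [HahnSeries.coeff_single_of_ne h, smul_zero]; rfl
    have h3 : ν * (mEuler Y + R * Y) - (mEuler Y + R * Y) * ν =
        (HahnSeries.C ε : LaurentSeries A) • (mEuler (mEuler Y + R * Y) +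
          (q : LaurentSeries A) • (mEuler Y + R * Y)) := by
      have : ν * (mEuler Y + R * Y) - (mEuler Y + R * Y) * ν =
          mEuler (ν * Y - Y * ν) + (ν * (R * Y) - R * Y * ν) := by
        rw [h1]; noncomm_ring
      rw [this, h2, ih, hR, mEuler_smul, hC, zero_smul, zero_add, mEuler_add, mEuler_smul,
        euler_natCast, zero_smul, zero_add, mEuler_add, mEuler_mul]
      simp only [Matrix.mul_smul, Matrix.smul_mul, Matrix.mul_add, smul_add]
      abel
    rw [delta, Matrix.mul_smul, Matrix.smul_mul, ← smul_sub, h3, mEuler_smul, euler_zInv,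
      smul_comm (zInv : LaurentSeries A)]
    congr 1
    rw [neg_smul, smul_add, Nat.cast_succ, add_smul, one_smul,
      smul_comm (zInv : LaurentSeries A) (q : LaurentSeries A)]
    abel

/-- A commutator has trace zero, so `ε (n + q)` annihilates the trace of the coefficient of `z^n`.
At `n = -2` the argument fails only for `q = 2`. -/
theorem trace_mCoeff_delta_iterate_eq_zero
    {ν R : Matrix ι ι (LaurentSeries A)} {ε : A}
    (hν : mEuler ν = 0) (hR : ν * R - R * ν = (HahnSeries.C ε : LaurentSeries A) • mEuler R)
    {q : ℕ} (hq : IsUnit (ε * (((-2 : ℤ) : A) + q))) : (mCoeff (-2) (deltaPow R q)).trace = 0 := by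
  have h := congrArg (fun F => (mCoeff (-2) F).trace) (conformal_delta_iterate hν hR q)
  have h0 : ∀ F G : Matrix ι ι (LaurentSeries A), (mCoeff (-2) (F - G)).trace =
      (mCoeff (-2) F).trace - (mCoeff (-2) G).trace := fun F G => Matrix.trace_sub _ _
  have h1 : ∀ F : Matrix ι ι (LaurentSeries A), mCoeff (-2) ((HahnSeries.C ε : LaurentSeries A) • F) =
      ε • mCoeff (-2) F := fun F => by
    ext a b : 1
    rw [mCoeff_apply, Matrix.smul_apply, Matrix.smul_apply, smul_eq_mul, HahnSeries.C_mul_eq_smul,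
      HahnSeries.coeff_smul, mCoeff_apply]
  have h2 : ∀ F : Matrix ι ι (LaurentSeries A), mCoeff (-2) ((q : LaurentSeries A) • F) =
      (q : A) • mCoeff (-2) F := fun F => by
    ext a b : 1
    rw [mCoeff_apply, Matrix.smul_apply, Matrix.smul_apply, smul_eq_mul, ← nsmul_eq_mul,
      HahnSeries.coeff_nsmul, smul_eq_mul, ← nsmul_eq_mul, mCoeff_apply]
    rfl
  rw [h0, trace_mCoeff_mul_comm, sub_self, h1, mCoeff_add, mCoeff_mEuler, h2, ← add_smul, smul_smul,
    Matrix.trace_smul, smul_eq_mul] at h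
  exact (hq.mul_right_eq_zero).mp h.symm

theorem mCoeff_deltaPow_two (R : Matrix ι ι (LaurentSeries A)) :
    mCoeff (-2) (deltaPow R 2) = mCoeff 0 (R * R) - mCoeff 0 R := by
  rw [deltaPow_succ, deltaPow_succ, deltaPow_zero, delta, delta, mEuler_one, zero_add,
    Matrix.mul_one, mEuler_smul, euler_zInv, Matrix.mul_smul, mCoeff_zInv_smul, mCoeff_add,
    mCoeff_add, neg_smul, mCoeff_zInv_smul, mCoeff_zInv_smul, mCoeff_mEuler]
  have h : mCoeff (-2 + 1) (-((zInv : LaurentSeries A) • R)) = -mCoeff 0 R := by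
    rw [show mCoeff (-2 + 1) (-((zInv : LaurentSeries A) • R)) =
      -mCoeff (-2 + 1) ((zInv : LaurentSeries A) • R) from rfl, mCoeff_zInv_smul]
    rfl
  rw [h]
  simp only [Int.reduceNeg, Int.reduceAdd, Int.cast_zero, zero_smul, add_zero]
  abel

end Conformal

end Laurent

end JetFrobenius

end

noncomputable section

set_option linter.unusedSectionVars false

namespace JetFrobenius

open MvPowerSeries

namespace Laurent

variable {A : Type*} [CommRing A] {ι κ : Type*} [Fintype ι]

theorem ext_mCoeff {l : Type*} {F G : Matrix l κ (LaurentSeries A)}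
    (h : ∀ n, mCoeff n F = mCoeff n G) : F = G := by
  ext a b n
  exact congrFun (congrFun (h n) a) b

theorem mCoeff_sub {l : Type*} (n : ℤ) (F G : Matrix l κ (LaurentSeries A)) :
    mCoeff n (F - G) = mCoeff n F - mCoeff n G := rfl

theorem delta_iterate_sub (S : Matrix ι ι (LaurentSeries A)) (q : ℕ)
    (F G : Matrix ι κ (LaurentSeries A)) :
    (delta S)^[q] (F - G) = (delta S)^[q] F - (delta S)^[q] G := by
  have h : ∀ F G : Matrix ι κ (LaurentSeries A), delta S (F - G) = delta S F - delta S G :=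
    fun F G => map_sub (AddMonoidHom.mk' (delta S) (delta_add S)) F G
  induction q with
  | zero => rfl
  | succ q ih => simp only [Function.iterate_succ_apply', ih, h]

end Laurent

namespace FrobeniusManifold

variable {K ι : Type*} [Field K] [Fintype ι] [DecidableEq ι] {M : FrobeniusManifold K ι}
  {Θ : Matrix ι ι (PowerSeries (Fn K ι))} {t : ℤ → ι → JetFn K ι}

open Laurent

/-! ### The second derivatives of the potential -/

theorem mCoeff_map_toL (S : Matrix ι ι (PowerSeries (Fn K ι))) (n : ℤ) :
    mCoeff n (S.map (toL (JetFn K ι))) = if 0 ≤ n then jetCoeff S n.toNat else 0 := by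
  ext a b : 1
  rw [mCoeff_apply, Matrix.map_apply, coeff_toL]
  split_ifs <;> rfl

theorem mCoeff_map_toL_mul_eq_zero {κ : Type*} (S : Matrix ι ι (PowerSeries (Fn K ι)))
    {F : Matrix ι κ (LaurentSeries (JetFn K ι))} {B : ℤ} (hF : ∀ n < B, mCoeff n F = 0) {n : ℤ}
    (hn : n < B) : mCoeff n (S.map (toL (JetFn K ι)) * F) = 0 := by
  ext a b : 1
  rw [mCoeff_apply, Matrix.mul_apply, HahnSeries.coeff_sum]
  refine Finset.sum_eq_zero fun c _ => ?_
  rw [Matrix.map_apply, toL_apply, (coeff_ofPowerSeries_mul _ _ _).2]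
  refine finsum_eq_zero_of_forall_eq_zero fun j => ?_
  rw [← mCoeff_apply, hF _ (by omega), Matrix.zero_apply, mul_zero]

theorem mCoeff_delta_iterate_eq_zero {κ : Type*} (S : Matrix ι ι (PowerSeries (Fn K ι)))
    {F : Matrix ι κ (LaurentSeries (JetFn K ι))} (hF : ∀ n < 0, mCoeff n F = 0) (q : ℕ) {n : ℤ}
    (hn : n < -q) : mCoeff n ((delta (S.map (toL (JetFn K ι))))^[q] F) = 0 := by
  induction q generalizing n with
  | zero => exact hF n (by simpa using hn)
  | succ q ih =>
    rw [Function.iterate_succ_apply', delta, mCoeff_zInv_smul, mCoeff_add, mCoeff_mEuler,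
      ih (by push_cast at hn; omega),
      mCoeff_map_toL_mul_eq_zero S (B := -q) (fun n hn => ih hn) (by push_cast at hn; omega), smul_zero, add_zero]

theorem mCoeff_mul_map_toL {M : ℕ} {F : Matrix ι ι (LaurentSeries (JetFn K ι))} {n : ℤ}
    (hF : ∀ m : ℕ, M ≤ m → mCoeff (n - m) F = 0) (S : Matrix ι ι (PowerSeries (Fn K ι))) :
    mCoeff n (F * S.map (toL (JetFn K ι))) =
      ∑ m ∈ Finset.range M, mCoeff (n - m) F * jetCoeff S m := by
  ext a b : 1
  rw [mCoeff_apply, Matrix.mul_apply, HahnSeries.coeff_sum, Matrix.sum_apply]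
  simp only [Matrix.mul_apply]
  rw [Finset.sum_comm]
  refine Finset.sum_congr rfl fun c _ => ?_
  rw [mul_comm, Matrix.map_apply, toL_apply, (coeff_ofPowerSeries_mul _ _ _).2,
    finsum_eq_sum_of_support_subset (s := Finset.range M)]
  · refine Finset.sum_congr rfl fun m _ => ?_
    rw [PowerSeries.coeff_mk, mul_comm]
    rfl
  · intro m hm
    by_contra hlt
    rw [Finset.coe_range, Set.mem_Iio, not_lt] at hlt
    refine hm ?_
    dsimp only
    rw [← mCoeff_apply, hF m hlt, Matrix.zero_apply, mul_zero]

variable (Θ) in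
/-- The sequence of matrices of series `X_m(z)` such that `X_0 = 1` and
`z X_{m+1}(z) = X_m(z) - Θ(z) (Θ⁻¹)_m`. For `m > 0` its coefficients are, up to sign and the metric,
the second derivatives of the potential. -/
def hessian : ℕ → Matrix ι ι (LaurentSeries (JetFn K ι))
  | 0 => 1
  | m + 1 => fun a b => Laurent.ofFun (fun n => if 0 ≤ n then
      -(∑ l ∈ Finset.range (m + 1), jetCoeff Θ (l + n.toNat + 1) * jetCoeff Θ⁻¹ (m - l)) a b else 0) 0
      fun n hn => if_neg (by omega)

theorem mCoeff_hessian_succ (m : ℕ) (n : ℤ) : mCoeff n (hessian Θ (m + 1)) = if 0 ≤ n then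
    -(∑ l ∈ Finset.range (m + 1), jetCoeff Θ (l + n.toNat + 1) * jetCoeff Θ⁻¹ (m - l)) else 0 := by
  ext a b : 1
  rw [mCoeff_apply, hessian, coeff_ofFun]
  split_ifs <;> rfl

theorem mCoeff_hessian_eq_zero (m : ℕ) {n : ℤ} (hn : n < 0) : mCoeff n (hessian Θ m) = 0 := by
  rcases m with _ | m
  · rw [hessian, mCoeff_one, if_neg (by omega)]
  · rw [mCoeff_hessian_succ, if_neg (by omega)]

/-- Positive powers of `z` match by shifting the summation index. At `z^0` the identity is the
coefficient of `z^m` in `Θ Θ⁻¹ = 1`. -/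
theorem z_smul_hessian_succ (h : M.adjoint Θ * Θ = 1) (m : ℕ) :
    (z : LaurentSeries (JetFn K ι)) • hessian Θ (m + 1) =
      hessian Θ m - Θ.map (toL (JetFn K ι)) * mC (jetCoeff Θ⁻¹ m) := by
  refine ext_mCoeff fun n => ?_
  rw [mCoeff_z_smul, mCoeff_sub, mCoeff_mul_mC, mCoeff_map_toL]
  have hm := sum_jetCoeff_mul Θ Θ⁻¹ m
  rw [mul_inv_self h, jetCoeff_one, Finset.Nat.sum_antidiagonal_eq_sum_range_succ_mk,
    Finset.sum_range_succ'] at hm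
  dsimp only at hm
  rcases lt_trichotomy n 0 with hn | rfl | hn
  · rw [mCoeff_hessian_eq_zero _ (by omega), mCoeff_hessian_eq_zero _ (by omega),
      if_neg (by omega), Matrix.zero_mul, sub_zero]
  · rw [mCoeff_hessian_eq_zero _ (by omega), if_pos le_rfl, eq_comm, sub_eq_zero, Int.toNat_zero]
    rcases m with _ | m
    · rw [hessian, mCoeff_one, if_pos rfl]
      simpa using hm.symm
    · rw [if_neg (by omega), Nat.sub_zero] at hm
      rw [mCoeff_hessian_succ, if_pos le_rfl, Int.toNat_zero, eq_neg_of_add_eq_zero_right hm]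
      congr 1
      refine Finset.sum_congr rfl fun l _ => ?_
      rw [show m + 1 - (l + 1) = m - l by omega, add_zero]
  · obtain ⟨i, hi⟩ := Int.eq_ofNat_of_zero_le (by omega : 0 ≤ n - 1)
    obtain rfl : n = i + 1 := by omega
    rw [mCoeff_hessian_succ, if_pos (by omega), if_pos (by omega), add_sub_cancel_right,
      Int.toNat_natCast, show ((i : ℤ) + 1).toNat = i + 1 by omega, Finset.sum_range_succ', neg_add,
      sub_eq_add_neg, zero_add, Nat.sub_zero]
    congr 1
    rcases m with _ | m
    · rw [hessian, mCoeff_one, if_neg (by omega), Finset.sum_range_zero, neg_zero]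
    · rw [mCoeff_hessian_succ, if_pos (by omega), show ((i : ℤ) + 1).toNat = i + 1 by omega]
      congr 1
      refine Finset.sum_congr rfl fun l _ => ?_
      rw [show l + 1 + i + 1 = l + (i + 1) + 1 by ring, show m + 1 - (l + 1) = m - l by omega]

/-- Applying `δ̃^{N+1}` to the recursion for `z X_{m+1}` and using `[δ̃^{N+1}, z] = (N+1) δ̃^N`
expresses each summand as a consecutive difference minus a term in `Θ (δ^{N+1} 1) (Θ⁻¹)_m`. The
differences telescope to the trace for `δ̃`. The other terms reassemble `Θ (δ^{N+1} 1) Θ⁻¹`, whose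
coefficients have the same traces as those of `δ^{N+1} 1`. -/
theorem sum_trace_delta_hessian (h : M.adjoint Θ * Θ = 1) (N : ℕ) :
    ((N + 1 : ℕ) : JetFn K ι) * ∑ m ∈ Finset.range (N + 1), (mCoeff (-2 - m)
      ((delta (symbol (JetFn K ι) (M.deltaTildeCoeff Θ)))^[N] (hessian Θ (m + 1)))).trace =
      (mCoeff (-2) (deltaPow (symbol (JetFn K ι) (M.deltaTildeCoeff Θ)) (N + 1))).trace -
      (mCoeff (-2) (deltaPow (symbol (JetFn K ι) M.deltaCoeff) (N + 1))).trace := by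
  set R := symbol (JetFn K ι) (M.deltaTildeCoeff Θ) with hR
  set S := symbol (JetFn K ι) M.deltaCoeff with hS
  set T := Θ.map (toL (JetFn K ι)) with hT
  have hcast : ∀ (n : ℤ) (F : Matrix ι ι (LaurentSeries (JetFn K ι))),
      mCoeff n (((N + 1 : ℕ) : LaurentSeries (JetFn K ι)) • F) =
        ((N + 1 : ℕ) : JetFn K ι) • mCoeff n F := fun n F => by
    ext a b : 1
    rw [mCoeff_apply, Matrix.smul_apply, Matrix.smul_apply, smul_eq_mul, ← nsmul_eq_mul,
      HahnSeries.coeff_nsmul, smul_eq_mul, ← nsmul_eq_mul, mCoeff_apply]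
    rfl
  have hgauge : ∀ m, (delta R)^[N + 1] (T * mC (jetCoeff Θ⁻¹ m)) =
      T * deltaPow S (N + 1) * mC (jetCoeff Θ⁻¹ m) := fun m => by
    rw [delta_iterate_mul_const R _ _ _ (mEuler_mC _)]
    have := delta_fundamental_mul (JetFn K ι) h (N + 1) (1 : Matrix ι ι (LaurentSeries (JetFn K ι)))
    rw [Matrix.mul_one] at this
    rw [this]
    rfl
  have hstep : ∀ m : ℕ, ((N + 1 : ℕ) : JetFn K ι) *
      (mCoeff (-2 - m) ((delta R)^[N] (hessian Θ (m + 1)))).trace =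
      ((mCoeff (-2 - m) ((delta R)^[N + 1] (hessian Θ m))).trace -
        (mCoeff (-2 - (m + 1 : ℕ)) ((delta R)^[N + 1] (hessian Θ (m + 1)))).trace) -
      (mCoeff (-2 - m) (T * deltaPow S (N + 1)) * jetCoeff Θ⁻¹ m).trace := fun m => by
    have h1 := congrArg (mCoeff (-2 - m)) (delta_iterate_z_smul R N (hessian Θ (m + 1)))
    rw [z_smul_hessian_succ h, delta_iterate_sub, hgauge, mCoeff_sub, mCoeff_mul_mC, mCoeff_add,
      mCoeff_z_smul, hcast, show (-2 : ℤ) - m - 1 = -2 - (m + 1 : ℕ) by push_cast; ring] at h1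
    rw [← smul_eq_mul, ← Matrix.trace_smul, eq_sub_of_add_eq' h1.symm, Matrix.trace_sub,
      Matrix.trace_sub]
    ring
  have hz : ∀ n : ℤ, n < -(N + 1 : ℕ) → mCoeff n (T * deltaPow S (N + 1)) = 0 := fun n hn => by
    have := delta_fundamental_mul (JetFn K ι) h (N + 1) (1 : Matrix ι ι (LaurentSeries (JetFn K ι)))
    rw [Matrix.mul_one] at this
    have e : T * deltaPow S (N + 1) = (delta R)^[N + 1] T := this.symm
    rw [e, hR, symbol_deltaTildeCoeff]
    refine mCoeff_delta_iterate_eq_zero _ (fun n hn => ?_) _ hn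
    rw [hT, mCoeff_map_toL, if_neg (by omega)]
  rw [Finset.mul_sum]
  simp only [hstep]
  rw [Finset.sum_sub_distrib, Finset.sum_range_sub', ← Matrix.trace_sum,
    ← mCoeff_mul_map_toL (n := -2) (fun m hm => hz _ (by omega)), trace_mCoeff_mul_comm,
    ← Matrix.mul_assoc, ← Matrix.map_mul, inv_mul_self h, Matrix.map_one _ (map_zero _) (map_one _),
    Matrix.one_mul]
  congr 1
  -- The last term of the telescoping sum vanishes: `N + 1` applications of `δ̃` to a power series
  -- reach no lower than `z^{-(N+1)}`.
  have h0 : mCoeff (-2 - ((N + 1 : ℕ) : ℤ)) ((delta R)^[N + 1] (hessian Θ (N + 1))) = 0 := by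
    rw [hR, symbol_deltaTildeCoeff]
    exact mCoeff_delta_iterate_eq_zero _ (fun n hn => mCoeff_hessian_eq_zero _ hn) _ (by omega)
  rw [h0, Matrix.trace_zero, sub_zero]
  simp only [Nat.cast_zero, sub_zero]
  rfl

/-! ### Traces -/

theorem jetCoeff_mul_zero (S T : Matrix ι ι (PowerSeries (Fn K ι))) :
    jetCoeff (S * T) 0 = jetCoeff S 0 * jetCoeff T 0 := by
  rw [← sum_jetCoeff_mul, Finset.Nat.antidiagonal_zero, Finset.sum_singleton]

theorem jetCoeff_deltaSymbol_zero :
    jetCoeff M.deltaSymbol 0 = (M.μ + (1 / 2 : K) • 1).map C := by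
  ext a b : 1
  simp only [jetCoeff, zCoeff, deltaSymbol_eq, constMatrix, Matrix.map_apply, Matrix.add_apply,
    Matrix.smul_apply (_ : PowerSeries (Fn K ι)), smul_eq_mul (a := (PowerSeries.X : PowerSeries (Fn K ι))), map_add, PowerSeries.coeff_zero_X_mul, add_zero, PowerSeries.coeff_zero_C,
    pullback_C]

theorem jetCoeff_R_zero (hf : M.IsFundamentalSolution Θ) (ha : M.adjoint Θ * Θ = 1) :
    jetCoeff (M.R Θ) 0 = (M.μ + (1 / 2 : K) • 1).map C := by
  have h1 : jetCoeff Θ⁻¹ 0 = 1 := by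
    have := jetCoeff_mul_zero Θ Θ⁻¹
    rw [mul_inv_self ha, jetCoeff_one, if_pos rfl, jetCoeff_zero hf, Matrix.one_mul] at this
    exact this.symm
  have h2 : jetCoeff (M.R Θ) 0 = jetCoeff (Θ * M.deltaSymbol * Θ⁻¹) 0 := by
    ext a b : 1
    simp only [jetCoeff, zCoeff, R, Matrix.map_apply, Matrix.add_apply, Matrix.smul_apply,
      smul_eq_mul, map_add, PowerSeries.coeff_zero_X_mul, add_zero]
  rw [h2, jetCoeff_mul_zero, jetCoeff_mul_zero, h1, jetCoeff_zero hf, Matrix.one_mul, Matrix.mul_one,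
    jetCoeff_deltaSymbol_zero]

/-- For `q ≠ 2` this is conformality. For `q = 2` the coefficient is `R_0² - R_0` with `R_0 = μ +
1/2`, that is, `μ² - 1/4`. -/
theorem trace_mCoeff_deltaPow_deltaTildeCoeff [CharZero K] (hΘ : M.IsSymmetricFundamentalSolution Θ)
    (q : ℕ) : (mCoeff (-2) (deltaPow (symbol (JetFn K ι) (M.deltaTildeCoeff Θ)) q)).trace =
      if q = 2 then C (M.μ ^ 2 - (1 / 4 : K) • 1).trace else 0 := by
  obtain ⟨hf, ⟨μs, -, -, -, -, -, ε, hε, hR⟩, ha⟩ := hΘ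
  have hε0 : ε ≠ 0 := by rcases hε with rfl | rfl <;> simp
  rw [symbol_deltaTildeCoeff]
  split_ifs with hq
  · have h0 : jetCoeff (M.R Θ) 0 = (M.μ + (1 / 2 : K) • 1).map C := jetCoeff_R_zero hf ha
    rw [hq, mCoeff_deltaPow_two, ← Matrix.map_mul, mCoeff_map_toL, mCoeff_map_toL, if_pos le_rfl,
      if_pos le_rfl, Int.toNat_zero, ← sum_jetCoeff_mul, Finset.Nat.antidiagonal_zero,
      Finset.sum_singleton, h0, ← Matrix.map_mul]
    have e : ∀ N : Matrix ι ι K, (N.map (C : K → JetFn K ι)).trace = C N.trace := fun N => by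
      simp only [Matrix.trace, Matrix.diag_apply, Matrix.map_apply, map_sum]
    rw [Matrix.trace_sub, e, e, ← map_sub, ← Matrix.trace_sub]
    congr 2
    rw [pow_two, Matrix.add_mul, Matrix.mul_add, Matrix.mul_add, Matrix.smul_mul, Matrix.mul_smul,
      Matrix.smul_mul, Matrix.mul_smul, Matrix.one_mul, Matrix.mul_one, Matrix.mul_one]
    module
  · refine trace_mCoeff_delta_iterate_eq_zero (ν := mC (μs.map C)) (ε := C ε) (mEuler_mC _) ?_ ?_
    · refine ext_mCoeff fun n => ?_
      have e : mCoeff n ((HahnSeries.C (C ε) : LaurentSeries (JetFn K ι)) •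
          mEuler ((M.R Θ).map (toL (JetFn K ι)))) =
          (C ε : JetFn K ι) • mCoeff n (mEuler ((M.R Θ).map (toL (JetFn K ι)))) := by
        ext a b : 1
        rw [mCoeff_apply, Matrix.smul_apply, Matrix.smul_apply, smul_eq_mul,
          HahnSeries.C_mul_eq_smul, HahnSeries.coeff_smul, mCoeff_apply]
      rw [e, mCoeff_sub, mCoeff_mC_mul, mCoeff_mul_mC, mCoeff_mEuler, mCoeff_map_toL]
      split_ifs with hn
      · obtain ⟨k, rfl⟩ := Int.eq_ofNat_of_zero_le hn
        have h1 := congrArg (fun N => N.map (pullback : Fn K ι →ₐ[K] JetFn K ι)) (hR k)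
        ext a b : 1
        have h2 := congrFun (congrFun h1 a) b
        simp only [Matrix.map_apply, Matrix.sub_apply, Matrix.mul_apply, map_sub, map_sum, map_mul,
          pullback_C, Matrix.smul_apply, map_smul] at h2
        simp only [Matrix.sub_apply, Matrix.mul_apply, Matrix.map_apply, Matrix.smul_apply, jetCoeff,
          Int.toNat_natCast, smul_eq_mul, Int.cast_natCast]
        rw [h2, smul_eq_C_mul, map_mul, map_natCast, mul_assoc]
      · simp
    · have e : (C ε : JetFn K ι) * (((-2 : ℤ) : JetFn K ι) + (q : JetFn K ι)) =
          C (ε * ((-2 : ℤ) + (q : ℤ) : ℤ)) := by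
        rw [map_mul, map_intCast]
        push_cast
        rfl
      rw [e]
      refine (IsUnit.mk0 _ (mul_ne_zero hε0 ?_)).map C
      rw [Int.cast_ne_zero]
      omega

theorem two_mul_trace_mCoeff_deltaPow_deltaCoeff [CharZero K] (q : ℕ) :
    2 * (mCoeff (-2) (deltaPow (symbol (JetFn K ι) M.deltaCoeff) q)).trace =
      (q : JetFn K ι) * pullback (∑ j ∈ Finset.range (q - 1), ((M.μ - (1 / 2 : K) • 1).map C * M.U ^ j *
        (M.μ + (1 / 2 : K) • 1).map C * M.U ^ (q - 2 - j)).trace) := by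
  have hS : symbol (JetFn K ι) M.deltaCoeff = mC ((M.μ + (1 / 2 : K) • 1).map C) +
      (z : LaurentSeries (JetFn K ι)) • mC (M.U.map pullback) := by
    rw [symbol_deltaCoeff, map_deltaSymbol]
    refine congrArg₂ (fun F G => F + (z : LaurentSeries (JetFn K ι)) • G) ?_ ?_ <;> ext a b : 1
    · rw [constL_apply, Matrix.map_apply, pullback_C, mC, Matrix.map_apply, Matrix.map_apply]
    · rw [constL_apply, mC, Matrix.map_apply, Matrix.map_apply]
  rw [hS, two_mul_trace_mCoeff_delta_iterate, map_sum]
  congr 1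
  refine Finset.sum_congr rfl fun j _ => ?_
  let φ : Matrix ι ι (Fn K ι) →ₐ[K] Matrix ι ι (JetFn K ι) := pullback.mapMatrix
  have hφ : ∀ N, pullback (Matrix.trace N) = (φ N).trace := fun N => by
    simp only [Matrix.trace, Matrix.diag_apply, map_sum]
    rfl
  have hC : ∀ N : Matrix ι ι K, φ (N.map C) = N.map C := fun N => by
    ext a b : 1
    exact pullback_C _
  rw [hφ, map_mul, map_mul, map_mul, map_pow, map_pow, hC, hC]
  have e : ((M.μ + (1 / 2 : K) • 1).map C : Matrix ι ι (JetFn K ι)) - 1 =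
      (M.μ - (1 / 2 : K) • 1).map C := by
    have h1 : (1 : Matrix ι ι (JetFn K ι)) = (1 : Matrix ι ι K).map C :=
      (Matrix.map_one _ (map_zero _) (map_one _)).symm
    rw [h1, ← Matrix.map_sub _ (map_sub _)]
    congr 1
    module
  rw [e]
  rfl

theorem jetCoeff_constMatrix_mul (N : Matrix ι ι K) (S : Matrix ι ι (PowerSeries (Fn K ι)))
    (j : ℕ) : jetCoeff (constMatrix N * S) j = (N.map C : Matrix ι ι (JetFn K ι)) * jetCoeff S j := by
  ext a b : 1
  simp only [jetCoeff, zCoeff, Matrix.map_apply, Matrix.mul_apply, map_sum, constMatrix,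
    PowerSeries.coeff_C_mul, map_mul, pullback_C]

theorem jetCoeff_mul_constMatrix (S : Matrix ι ι (PowerSeries (Fn K ι))) (N : Matrix ι ι K)
    (j : ℕ) : jetCoeff (S * constMatrix N) j = jetCoeff S j * (N.map C : Matrix ι ι (JetFn K ι)) := by
  ext a b : 1
  simp only [jetCoeff, zCoeff, Matrix.map_apply, Matrix.mul_apply, map_sum, constMatrix,
    PowerSeries.coeff_mul_C, map_mul, pullback_C]

theorem jetCoeff_inv_mul_η (h : M.adjoint Θ * Θ = 1) (j : ℕ) :
    jetCoeff Θ⁻¹ j * (M.η.map C : Matrix ι ι (JetFn K ι)) =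
      ((-1 : K) ^ j) • ((M.η.map C : Matrix ι ι (JetFn K ι)) * (jetCoeff Θ j).transpose) := by
  have h1 : Θ⁻¹ * constMatrix M.η =
      constMatrix M.η * (Θ.map PowerSeries.evalNegHom).transpose := by
    rw [inv_eq_adjoint h, adjoint_eq, Matrix.mul_assoc, constMatrix_η_inv_mul, Matrix.mul_one]
  have h2 : jetCoeff (Θ.map PowerSeries.evalNegHom).transpose j =
      ((-1 : K) ^ j) • (jetCoeff Θ j).transpose := by
    ext a b : 1
    simp only [jetCoeff, zCoeff, Matrix.map_apply, Matrix.transpose_apply, Matrix.smul_apply,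
      PowerSeries.evalNegHom, PowerSeries.coeff_rescale]
    rw [smul_eq_C_mul]
    simp only [map_mul, map_pow, map_neg, map_one]
  rw [← jetCoeff_mul_constMatrix, h1, jetCoeff_constMatrix_mul, h2, Matrix.mul_smul]

theorem jetCoeff_mul_η (h : M.adjoint Θ * Θ = 1) (j : ℕ) :
    jetCoeff Θ j * (M.η.map C : Matrix ι ι (JetFn K ι)) =
      ((-1 : K) ^ j) • ((M.η.map C : Matrix ι ι (JetFn K ι)) * (jetCoeff Θ⁻¹ j).transpose) := by
  have h1 := congrArg Matrix.transpose (jetCoeff_inv_mul_η h j)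
  have h2 : (M.η.map C : Matrix ι ι (JetFn K ι)).transpose = M.η.map C := by
    rw [← Matrix.transpose_map, η_transpose]
  rw [Matrix.transpose_mul, Matrix.transpose_smul, Matrix.transpose_mul, Matrix.transpose_transpose,
    h2] at h1
  rw [h1, smul_smul, ← mul_pow, neg_one_mul, _root_.neg_neg, one_pow, one_smul]

/-- The second derivatives of the potential. -/
theorem flatField_coordSeq (hΘ : M.IsSymmetricFundamentalSolution Θ)
    (ht : M.IsFlatGeneratingFunction Θ t) (m n : ℕ) (a c : ι) :
    M.flatField Θ m a (M.coordSeq t n c) = ((-1 : K) ^ m) •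
      (mCoeff n (hessian Θ (m + 1)) * (M.η.map C : Matrix ι ι (JetFn K ι))) c a := by
  have h := hΘ.2.2
  have h1 : mCoeff n (hessian Θ (m + 1)) * (M.η.map C : Matrix ι ι (JetFn K ι)) =
      ((-1 : K) ^ (m + n)) • ∑ l ∈ Finset.range (m + 1), (M.η.map C : Matrix ι ι (JetFn K ι)) *
        (jetCoeff Θ (m - l) * jetCoeff Θ⁻¹ (l + n + 1)).transpose := by
    rw [mCoeff_hessian_succ, if_pos (Int.natCast_nonneg n), Int.toNat_natCast, Matrix.neg_mul,
      Matrix.sum_mul, ← Finset.sum_neg_distrib, Finset.smul_sum]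
    refine Finset.sum_congr rfl fun l hl => ?_
    rw [Finset.mem_range] at hl
    rw [Matrix.mul_assoc, jetCoeff_inv_mul_η h, Matrix.mul_smul, ← Matrix.mul_assoc,
      jetCoeff_mul_η h, Matrix.smul_mul, smul_smul, ← pow_add,
      show m - l + (l + n + 1) = m + n + 1 by omega, pow_succ, mul_neg_one, neg_smul, _root_.neg_neg,
      Matrix.transpose_mul, Matrix.mul_assoc]
  have h2 : ∀ b, M.flatField Θ m a (t (-n - 1) b) =
      ∑ l ∈ Finset.range (m + 1), (jetCoeff Θ (m - l) * jetCoeff Θ⁻¹ (l + n + 1)) a b := fun b => by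
    rw [ht.2, Matrix.sum_apply, map_sum]
    refine Finset.sum_congr rfl fun l _ => ?_
    rw [if_pos (by omega), show ((l : ℤ) - (-n - 1)).toNat = l + n + 1 by omega]
    simp only [Matrix.mul_apply, map_sum, map_mul]
    rfl
  rw [h1, Matrix.smul_apply, smul_smul, pow_add, ← mul_assoc, ← mul_pow, neg_one_mul, _root_.neg_neg,
    one_pow, one_mul, coordSeq, ← M.flatD_apply hΘ.1, Derivation.map_smul, map_sum, zpow_natCast]
  have h3 : ∀ b, M.flatD hΘ.1 m a (M.η c b • t (-n - 1) b) = M.η c b •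
      ∑ l ∈ Finset.range (m + 1), (jetCoeff Θ (m - l) * jetCoeff Θ⁻¹ (l + n + 1)) a b :=
    fun b => by rw [Derivation.map_smul, flatD_apply, h2]
  simp only [h3]
  simp only [Matrix.sum_apply, smul_eq_C_mul, Finset.mul_sum,
    Matrix.mul_apply (M := (M.η.map C : Matrix ι ι (JetFn K ι))), Matrix.map_apply,
    Matrix.transpose_apply]
  rw [Finset.sum_comm]

/-- The part of the Virasoro operator involving the second derivatives of the potential. -/
theorem formalSum_flatField_coordSeq [CharZero K] (hΘ : M.IsSymmetricFundamentalSolution Θ)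
    (ht : M.IsFlatGeneratingFunction Θ t) {k : ℤ} (hk : -1 ≤ k) :
    formalSum (fun m : ℤ => ((-1 : K) ^ m) • ∑ a, ∑ b, M.η⁻¹ a b •
      (zConnection (M.deltaTildeCoeff Θ))^[(k + 1).toNat] (fun n c =>
        if 0 ≤ m ∧ 0 ≤ n then M.flatField Θ m.toNat a (M.coordSeq t n c) else 0) (-2 - m) b) =
      (2 : K) • pullback (M.H k) +
        (if k = 0 then (1 / 2 : K) * (M.μ ^ 2 - (1 / 4 : K) • 1).trace else 0) • 1 := by
  obtain ⟨J, hJ⟩ := exists_deltaTildeCoeff_eq_zero hΘ.2.1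
  set N := (k + 1).toNat with hN
  set R := symbol (JetFn K ι) (M.deltaTildeCoeff Θ) with hR
  have h1 : ∀ (m : ℕ) a b, (zConnection (M.deltaTildeCoeff Θ))^[N] (fun n c =>
      if 0 ≤ (m : ℤ) ∧ 0 ≤ n then M.flatField Θ (m : ℤ).toNat a (M.coordSeq t n c) else 0)
      (-2 - m) b = ((-1 : K) ^ m) •
        (mCoeff (-2 - m) ((delta R)^[N] (hessian Θ (m + 1))) * (M.η.map C : Matrix ι ι (JetFn K ι))) b a := fun m a b => by
    let F : Matrix ι ι (LaurentSeries (JetFn K ι)) :=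
      hessian Θ (m + 1) * mC (((-1 : K) ^ m) • M.η.map C)
    have e : (fun (n : ℤ) c => if 0 ≤ (m : ℤ) ∧ 0 ≤ n then
        M.flatField Θ (m : ℤ).toNat a (M.coordSeq t n c) else 0) =
        fun n c => (F c a).coeff n := by
      funext n c
      rw [← mCoeff_apply, mCoeff_mul_mC, Matrix.mul_smul]
      split_ifs with h
      · obtain ⟨n, rfl⟩ := Int.eq_ofNat_of_zero_le h.2
        rw [Int.toNat_natCast, flatField_coordSeq hΘ ht]
        rfl
      · rw [mCoeff_hessian_eq_zero _ (by omega), Matrix.zero_mul, smul_zero]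
        rfl
    rw [e, zConnection_iterate_coeff]
    dsimp only
    rw [delta_iterate_mul_const _ _ _ _ (mEuler_mC _), ← mCoeff_apply, mCoeff_mul_mC,
      Matrix.mul_smul]
    rfl
  have h2 : formalSum (fun m : ℤ => ((-1 : K) ^ m) • ∑ a, ∑ b, M.η⁻¹ a b •
      (zConnection (M.deltaTildeCoeff Θ))^[N] (fun n c =>
        if 0 ≤ m ∧ 0 ≤ n then M.flatField Θ m.toNat a (M.coordSeq t n c) else 0) (-2 - m) b) =
      ∑ m ∈ Finset.range (N + 1),
        (mCoeff (-2 - m) ((delta R)^[N] (hessian Θ (m + 1)))).trace := by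
    rw [formalSum_eq_sum ((Finset.range (N + 1)).map Nat.castEmbedding), Finset.sum_map]
    · refine Finset.sum_congr rfl fun m _ => ?_
      simp only [Nat.castEmbedding_apply, h1]
      set Y := mCoeff (-2 - m) ((delta R)^[N] (hessian Θ (m + 1)))
      have e : Y.trace = (Y * (M.η.map C : Matrix ι ι (JetFn K ι)) * M.η⁻¹.map C).trace := by
        rw [Matrix.mul_assoc, ← Matrix.map_mul, η_mul_η_inv,
          Matrix.map_one _ (map_zero _) (map_one _), Matrix.mul_one]
      rw [e, zpow_natCast, Matrix.trace_mul_comm]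
      simp only [Matrix.trace, Matrix.diag_apply, Finset.smul_sum]
      refine Finset.sum_congr rfl fun a _ => ?_
      rw [Matrix.mul_apply]
      refine Finset.sum_congr rfl fun b _ => ?_
      rw [smul_comm ((-1 : K) ^ m), smul_smul ((-1 : K) ^ m), ← mul_pow, neg_one_mul, _root_.neg_neg,
        one_pow, one_smul, Matrix.map_apply, smul_eq_C_mul]
    · intro m hm
      rw [Finset.sum_eq_zero, smul_zero]
      refine fun a _ => Finset.sum_eq_zero fun b _ => ?_
      rcases lt_or_ge m 0 with h0 | h0
      · have h := zConnection_iterate_map hJ (0 : JetFn K ι →+ JetFn K ι)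
          (fun _ _ _ _ => (smul_zero _).symm) N (fun _ _ => 0)
        have h' := congrFun (congrFun h (-2 - m)) b
        simp only [AddMonoidHom.zero_apply] at h'
        simp only [if_neg (not_and_of_not_left _ (not_le.mpr h0))]
        rw [h', smul_zero]
      · obtain ⟨m, rfl⟩ := Int.eq_ofNat_of_zero_le h0
        -- Since `δ̃^N` lowers the degree by at most `N`, the coefficient of `z^{-2-m}` vanishes for
        -- these `m`.
        have hm' : N + 1 ≤ m := by
          by_contra hlt
          exact hm (Finset.mem_map.mpr ⟨m, Finset.mem_range.mpr (not_le.mp hlt), rfl⟩)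
        rw [h1, hR, symbol_deltaTildeCoeff, mCoeff_delta_iterate_eq_zero _
          (fun n hn => mCoeff_hessian_eq_zero _ hn) _ (by omega), Matrix.zero_mul,
          Matrix.zero_apply, smul_zero, smul_zero]
  have h3 := sum_trace_delta_hessian hΘ.2.2 N
  rw [← hR, trace_mCoeff_deltaPow_deltaTildeCoeff hΘ] at h3
  have h4 := two_mul_trace_mCoeff_deltaPow_deltaCoeff (M := M) (N + 1)
  have h5 : pullback (M.H k) = (-1 / 4 : K) • pullback (∑ j ∈ Finset.range (N + 1 - 1),
      ((M.μ - (1 / 2 : K) • 1).map C * M.U ^ j * (M.μ + (1 / 2 : K) • 1).map C *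
        M.U ^ (N + 1 - 2 - j)).trace) := by
    rw [H, map_smul, ← hN, Nat.add_sub_cancel, show k.toNat = N + 1 - 2 by omega]
  rw [h2, h5]
  set X := ∑ m ∈ Finset.range (N + 1),
    (mCoeff (-2 - m) ((delta R)^[N] (hessian Θ (m + 1)))).trace
  set P := (mCoeff (-2) (deltaPow (symbol (JetFn K ι) M.deltaCoeff) (N + 1))).trace
  set S := pullback (∑ j ∈ Finset.range (N + 1 - 1),
      ((M.μ - (1 / 2 : K) • 1).map C * M.U ^ j * (M.μ + (1 / 2 : K) • 1).map C *
        M.U ^ (N + 1 - 2 - j)).trace)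
  have hcast : ∀ x : JetFn K ι, ((N + 1 : ℕ) : JetFn K ι) * x = ((N + 1 : ℕ) : K) • x := fun x => by
    rw [smul_eq_C_mul, map_natCast]
  have h6 : P = (1 / 2 : K) • ((N + 1 : ℕ) : K) • S := by
    rw [← hcast, ← h4, two_mul, smul_add, ← add_smul]
    norm_num
  have hne : ((N + 1 : ℕ) : K) ≠ 0 := Nat.cast_ne_zero.mpr (Nat.succ_ne_zero N)
  -- Here `N + 1 = k + 2`, so the exceptional value `q = 2` is `k = 0`. Characteristic zero allows
  -- the common factor `N + 1` to be cancelled.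
  rw [hcast, h6] at h3
  refine smul_right_injective _ hne ?_
  dsimp only
  rw [h3]
  rcases eq_or_ne k 0 with rfl | hk0
  · have hN1 : N = 1 := by omega
    simp only [hN1, if_true]
    rw [← mul_one (C _ : JetFn K ι), ← smul_eq_C_mul]
    push_cast
    module
  · rw [if_neg (by omega), if_neg hk0]
    module

end FrobeniusManifold

end JetFrobenius

end

/-! ### Conjugation by the genus zero partition function -/

noncomputable section

set_option linter.unusedSectionVars false

namespace JetFrobenius

open MvPowerSeries

section Exponential

variable {K ι : Type*} [Field K] {F : JetFn K ι} {f g : HSeries K ι} {B : ℤ}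

/-- The bound on positive powers of `ħ` leaves finitely many terms of the exponential in each
degree. The length `L` is kept free so that several such sums can share it. -/
theorem expMul_eq_sum (hf : ∀ i > B, f i = 0) {i : ℤ} {L : ℕ} (hL : B - i < L) :
    expMul F f i = ∑ p ∈ Finset.range L, ((p.factorial : K)⁻¹) • (F ^ p * f (i + p)) := by
  rw [expMul, finsum_eq_sum_of_support_subset]
  intro p hp
  by_contra hlt
  rw [Finset.coe_range, Set.mem_Iio, not_lt] at hlt
  refine hp ?_
  dsimp only
  rw [hf _ (by omega), mul_zero, smul_zero]

theorem expMul_sub_one (g : HSeries K ι) (i : ℤ) :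
    expMul F g (i - 1) = expMul F (fun j => g (j - 1)) i := by
  simp only [expMul, show ∀ p : ℕ, i - 1 + (p : ℤ) = i + p - 1 from fun p => by ring]

theorem mul_expMul (hf : ∀ i > B, f i = 0) (c : JetFn K ι) (i : ℤ) :
    c * expMul F f i = expMul F (fun j => c * f j) i := by
  have hL : B - i < ((B - i).toNat + 1 : ℕ) := by omega
  rw [expMul_eq_sum hf hL, expMul_eq_sum (fun j hj => by rw [hf j hj, mul_zero]) hL, Finset.mul_sum]
  refine Finset.sum_congr rfl fun p _ => ?_
  rw [mul_smul_comm, mul_left_comm]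

/-- The chain rule `D e^{F/ħ} = e^{F/ħ} (D + ħ⁻¹ DF)`; the factor `ħ⁻¹` is the shift `j + 1`. -/
theorem derivation_expMul [CharZero K] (D : Derivation K (JetFn K ι) (JetFn K ι))
    (hf : ∀ i > B, f i = 0) (i : ℤ) :
    D (expMul F f i) = expMul F (fun j => D (f j) + D F * f (j + 1)) i := by
  have hL : B - i < ((B - i).toNat + 1 : ℕ) := by omega
  -- One more term is taken on the left because differentiating `F^{p+1}` lowers the power by one.
  have hL' : B - i < ((B - i).toNat + 1 + 1 : ℕ) := by omega
  have h1 : ∀ p : ℕ, (((p + 1).factorial : K)⁻¹) • D (F ^ (p + 1)) =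
      ((p.factorial : K)⁻¹) • (F ^ p * D F) := fun p => by
    have hp : ((p + 1 : ℕ) : K) ≠ 0 := Nat.cast_ne_zero.mpr p.succ_ne_zero
    rw [D.leibniz_pow, Nat.add_sub_cancel, ← Nat.cast_smul_eq_nsmul K, smul_smul,
      Nat.factorial_succ, Nat.cast_mul, mul_inv, mul_right_comm, inv_mul_cancel₀ hp, one_mul,
      smul_eq_mul]
  rw [expMul_eq_sum (f := fun j => D (f j) + D F * f (j + 1)) (B := B) (fun j hj => by
      rw [hf j hj, hf _ (by omega), map_zero, mul_zero, add_zero]) hL, expMul_eq_sum hf hL', map_sum]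
  have h2 : ∀ p : ℕ, D (((p.factorial : K)⁻¹) • (F ^ p * f (i + p))) =
      ((p.factorial : K)⁻¹) • (F ^ p * D (f (i + p))) +
        (((p.factorial : K)⁻¹) • D (F ^ p)) * f (i + p) := fun p => by
    rw [Derivation.map_smul, D.leibniz, smul_add, smul_mul_assoc, smul_eq_mul, smul_eq_mul,
      mul_comm (f _)]
  simp only [h2, Finset.sum_add_distrib, mul_add, smul_add]
  congr 1
  · rw [Finset.sum_range_succ, hf (i + ((B - i).toNat + 1 : ℕ)) (by omega), map_zero, mul_zero,
      smul_zero, add_zero]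
  · rw [Finset.sum_range_succ', pow_zero, D.map_one_eq_zero, smul_zero, zero_mul, add_zero]
    refine Finset.sum_congr rfl fun p _ => ?_
    rw [h1, smul_mul_assoc, mul_assoc, show i + ((p + 1 : ℕ) : ℤ) = i + p + 1 by push_cast; ring]

end Exponential

section Vanishing

variable {K ι : Type*} [Field K] [Fintype ι] {V : Type*} [AddCommGroup V] [Module (JetFn K ι) V]

theorem zConnection_iterate_eq_zero {R : ℕ → Matrix ι ι (JetFn K ι)} {J : ℕ}
    (hR : ∀ j, J ≤ j → R j = 0) {f : ℤ → ι → V} {B : ℤ} (hf : ∀ n < B, ∀ c, f n c = 0) (N : ℕ)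
    {n : ℤ} (hn : n < B - N) (c : ι) : (zConnection R)^[N] f n c = 0 := by
  induction N generalizing n c with
  | zero => exact hf n (by simpa using hn) c
  | succ N ih =>
    rw [Function.iterate_succ_apply', zConnection_eq_sum hR, ih (by push_cast at hn; omega),
      smul_zero, zero_add]
    refine Finset.sum_eq_zero fun j _ => Finset.sum_eq_zero fun b _ => ?_
    rw [ih (by push_cast at hn; omega), smul_zero]

end Vanishing

namespace FrobeniusManifold

variable {K ι : Type*} [Field K] [Fintype ι] [DecidableEq ι] {M : FrobeniusManifold K ι}
  {Θ : Matrix ι ι (PowerSeries (Fn K ι))} {t : ℤ → ι → JetFn K ι} {F₀ : JetFn K ι}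

theorem flatSeq_of_neg {m : ℤ} (h : m < 0) (a : ι) (f : JetFn K ι) : M.flatSeq Θ f m a = 0 :=
  if_neg (not_le.mpr h)

theorem flatSeq_natCast (hΘ : M.IsFundamentalSolution Θ) (m : ℕ) (a : ι) (f : JetFn K ι) :
    M.flatSeq Θ f m a = M.flatD hΘ m a f := by
  rw [flatSeq, if_pos (Int.natCast_nonneg m), Int.toNat_natCast, flatD_apply]

theorem flatSeq_zero (hΘ : M.IsFundamentalSolution Θ) (m : ℤ) (a : ι) : M.flatSeq Θ 0 m a = 0 := by
  rcases lt_or_ge m 0 with h | h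
  · exact flatSeq_of_neg h a 0
  · obtain ⟨m, rfl⟩ := Int.eq_ofNat_of_zero_le h
    rw [flatSeq_natCast hΘ, map_zero]

theorem flatSeq_add (hΘ : M.IsFundamentalSolution Θ) (m : ℤ) (a : ι) (f g : JetFn K ι) :
    M.flatSeq Θ (f + g) m a = M.flatSeq Θ f m a + M.flatSeq Θ g m a := by
  rcases lt_or_ge m 0 with h | h
  · simp only [flatSeq_of_neg h, add_zero]
  · obtain ⟨m, rfl⟩ := Int.eq_ofNat_of_zero_le h
    simp only [flatSeq_natCast hΘ, map_add]

theorem flatSeq_mul (hΘ : M.IsFundamentalSolution Θ) (m : ℤ) (a : ι) (f g : JetFn K ι) :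
    M.flatSeq Θ (f * g) m a = M.flatSeq Θ f m a * g + f * M.flatSeq Θ g m a := by
  rcases lt_or_ge m 0 with h | h
  · simp only [flatSeq_of_neg h, zero_mul, mul_zero, add_zero]
  · obtain ⟨m, rfl⟩ := Int.eq_ofNat_of_zero_le h
    simp only [flatSeq_natCast hΘ, Derivation.leibniz, smul_eq_mul]
    ring

variable (M Θ t) in
/-- The conjugate `Z₀⁻¹ Φ_{m,a} Z₀` of the free field. -/
def conjField (m : ℤ) (a : ι) (f : HSeries K ι) : HSeries K ι :=
  fun i => M.flatSeq Θ (f (i - 1)) m a + M.coordSeq t m a * f i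

theorem conjField_eq_zero (hΘ : M.IsFundamentalSolution Θ) {f : HSeries K ι} {B : ℤ}
    (hf : ∀ i > B, f i = 0) (m : ℤ) (a : ι) : ∀ i > B + 1, M.conjField Θ t m a f i = 0 := by
  intro i hi
  rw [conjField, hf _ (by omega), hf _ (by omega), flatSeq_zero hΘ, mul_zero, add_zero]

/-- For `m ≥ 0` the equation for `∂_{m,a} F₀` supplies `coordSeq` at `m`, which continues the
multiplication operators at `m < 0`. The `ħ` in the free field cancels the `ħ⁻¹` from the
exponential. -/
theorem freeField_expMul [CharZero K] (hΘ : M.IsFundamentalSolution Θ)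
    (hF₀ : M.IsPotential Θ t F₀) {f : HSeries K ι} {B : ℤ} (hf : ∀ i > B, f i = 0) (m : ℤ) (a : ι) :
    M.freeField Θ t m a (expMul F₀ f) = expMul F₀ (M.conjField Θ t m a f) := by
  funext i
  rcases lt_or_ge m 0 with h | h
  · rw [freeField, if_neg (not_le.mpr h)]
    refine (mul_expMul hf _ i).trans ?_
    congr 1
    funext j
    rw [conjField, flatSeq_of_neg h, zero_add]
    rfl
  · obtain ⟨m, rfl⟩ := Int.eq_ofNat_of_zero_le h
    rw [freeField, if_pos h, Int.toNat_natCast]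
    refine ((derivation_expMul (M.flatD hΘ m a) hf (i - 1)).trans (expMul_sub_one _ _)).trans ?_
    congr 1
    funext j
    rw [conjField, flatSeq_natCast hΘ, sub_add_cancel, M.flatD_apply hΘ (f := F₀), hF₀.1, coordSeq,
      zpow_natCast]

variable (M Θ t) in
/-- The conjugate `Z₀⁻¹ :Φ_{m,a} Φ_{n,c}: Z₀` of a normal ordered product. -/
def conjNormal (m : ℤ) (a : ι) (n : ℤ) (c : ι) (f : HSeries K ι) : HSeries K ι := fun i =>
  (if 0 ≤ m then M.flatField Θ m.toNat a (M.flatSeq Θ (f (i - 2)) n c) else 0) +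
    M.flatSeq Θ (f (i - 1)) m a * M.coordSeq t n c +
    M.coordSeq t m a * M.flatSeq Θ (f (i - 1)) n c +
    f (i - 1) * (if 0 ≤ m ∧ 0 ≤ n then M.flatField Θ m.toNat a (M.coordSeq t n c) else 0) +
    f i * (M.coordSeq t m a * M.coordSeq t n c)

theorem conjField_conjField (hΘ : M.IsFundamentalSolution Θ) (m : ℤ) (a : ι) (n : ℤ) (c : ι)
    (f : HSeries K ι) (i : ℤ) : M.conjField Θ t m a (M.conjField Θ t n c f) i =
      M.flatSeq Θ (M.flatSeq Θ (f (i - 2)) n c) m a +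
      M.flatSeq Θ (f (i - 1)) m a * M.coordSeq t n c +
      M.coordSeq t m a * M.flatSeq Θ (f (i - 1)) n c +
      f (i - 1) * M.flatSeq Θ (M.coordSeq t n c) m a +
      f i * (M.coordSeq t m a * M.coordSeq t n c) := by
  rw [conjField, conjField, conjField, flatSeq_add hΘ, flatSeq_mul hΘ,
    show i - 1 - 1 = i - 2 by ring]
  ring

/-- Conjugation respects composition, so only contractions need attention. For `m ≥ 0 > n` normal
ordering removes the derivative of the coordinate. For `m, n ≥ 0` the derivative of `∂_{n,c} F₀`
remains; this explains the condition in the fourth term of `conjNormal`. -/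
theorem normalOrder_expMul [CharZero K] (hΘ : M.IsFundamentalSolution Θ)
    (hF₀ : M.IsPotential Θ t F₀) {f : HSeries K ι} {B : ℤ} (hf : ∀ i > B, f i = 0)
    (m : ℤ) (a : ι) (n : ℤ) (c : ι) :
    M.normalOrder Θ t m a n c (expMul F₀ f) = expMul F₀ (M.conjNormal Θ t m a n c f) := by
  rw [normalOrder]
  split_ifs with h
  · rw [Function.comp_apply, freeField_expMul hΘ hF₀ hf,
      freeField_expMul hΘ hF₀ (conjField_eq_zero hΘ hf m a)]
    congr 1
    funext i
    rw [conjField_conjField hΘ, conjNormal, if_pos h.1, if_neg (by omega)]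
    simp only [flatSeq_of_neg h.2]
    rw [← M.flatD_apply hΘ, map_zero]
    ring
  · rw [Function.comp_apply, freeField_expMul hΘ hF₀ hf,
      freeField_expMul hΘ hF₀ (conjField_eq_zero hΘ hf n c)]
    congr 1
    funext i
    rw [conjField_conjField hΘ, conjNormal]
    rcases lt_or_ge m 0 with hm | hm
    · simp only [flatSeq_of_neg hm, if_neg (not_le.mpr hm), if_neg (not_and_of_not_left _ (not_le.mpr hm))]
    · rw [if_pos hm, if_pos ⟨hm, by omega⟩]
      simp only [flatSeq, if_pos hm]

theorem conjNormal_eq_zero (hΘ : M.IsFundamentalSolution Θ) {f : HSeries K ι} {B : ℤ}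
    (hf : ∀ i > B, f i = 0) (m : ℤ) (a : ι) (n : ℤ) (c : ι) :
    ∀ i > B + 2, M.conjNormal Θ t m a n c f i = 0 := by
  intro i hi
  rw [conjNormal, hf i (by omega), hf (i - 1) (by omega), hf (i - 2) (by omega)]
  simp only [flatSeq_zero hΘ, ← M.flatD_apply hΘ, map_zero, ite_self]
  ring

theorem jetSummable_pairRes {f g : ℤ → ι → JetFn K ι}
    (hf : ∀ w, ∃ F, Represents (JetQuot K ι w) f F) (hg : ∀ w, ∃ G, Represents (JetQuot K ι w) g G) :
    JetSummable fun m : ℤ => ((-1 : K) ^ m) • ∑ a, ∑ b, M.η⁻¹ a b • (f m a * g (-2 - m) b) := by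
  intro w
  obtain ⟨F, hF⟩ := hf w
  obtain ⟨G, hG⟩ := hg w
  rw [← mk_support]
  refine (M.coeff_pairing_coMetric F G (-2)).1.subset fun m hm h => hm ?_
  dsimp only at h ⊢
  rw [← h]
  simp only [← hF m, ← hG (-2 - m)]
  rw [← Ideal.Quotient.mkₐ_eq_mk K]
  simp only [map_smul, map_sum, map_mul]
  rfl

/-- The connection acts on the second slot only. It commutes with multiplication by functions, and
with `∂_{m,a}` by constancy of `R(z)`. -/
theorem zConnection_iterate_conjNormal [CharZero K] (hΘ : M.IsSymmetricFundamentalSolution Θ) (N : ℕ)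
    (f : HSeries K ι) (m : ℤ) (a : ι) (j n : ℤ) (b : ι) :
    (zConnection (M.deltaTildeCoeff Θ))^[N] (fun n c => M.conjNormal Θ t m a n c f j) n b =
      (if 0 ≤ m then M.flatField Θ m.toNat a
        ((zConnection (M.deltaTildeCoeff Θ))^[N] (M.flatSeq Θ (f (j - 2))) n b) else 0) +
      M.flatSeq Θ (f (j - 1)) m a * (zConnection (M.deltaTildeCoeff Θ))^[N] (M.coordSeq t) n b +
      M.coordSeq t m a * (zConnection (M.deltaTildeCoeff Θ))^[N] (M.flatSeq Θ (f (j - 1))) n b +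
      f (j - 1) * (zConnection (M.deltaTildeCoeff Θ))^[N] (fun n c =>
        if 0 ≤ m ∧ 0 ≤ n then M.flatField Θ m.toNat a (M.coordSeq t n c) else 0) n b +
      f j * (M.coordSeq t m a * (zConnection (M.deltaTildeCoeff Θ))^[N] (M.coordSeq t) n b) := by
  obtain ⟨J, hJ⟩ := exists_deltaTildeCoeff_eq_zero hΘ.2.1
  have hmul : ∀ (x : JetFn K ι) (g : ℤ → ι → JetFn K ι),
      (zConnection (M.deltaTildeCoeff Θ))^[N] (fun n c => x * g n c) n b =
        x * (zConnection (M.deltaTildeCoeff Θ))^[N] g n b := fun x g =>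
    congrFun (congrFun (zConnection_iterate_map hJ (AddMonoidHom.mulLeft x)
      (fun _ _ _ v => (mul_left_comm x _ v)) N g) n) b
  have h1 : (zConnection (M.deltaTildeCoeff Θ))^[N] (fun n c => if 0 ≤ m then
        M.flatField Θ m.toNat a (M.flatSeq Θ (f (j - 2)) n c) else 0) n b =
      if 0 ≤ m then M.flatField Θ m.toNat a
        ((zConnection (M.deltaTildeCoeff Θ))^[N] (M.flatSeq Θ (f (j - 2))) n b) else 0 := by
    split_ifs
    · exact congrFun (congrFun (flatField_zConnection hΘ _ _ _ _) n) b
    · exact zConnection_iterate_eq_zero hJ (B := n + N + 1) (fun _ _ _ => rfl) N (by omega) b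
  have hadd : ∀ g h : ℤ → ι → JetFn K ι,
      (zConnection (M.deltaTildeCoeff Θ))^[N] (fun n c => g n c + h n c) n b =
        (zConnection (M.deltaTildeCoeff Θ))^[N] g n b +
          (zConnection (M.deltaTildeCoeff Θ))^[N] h n b := fun g h =>
    congrFun (congrFun (zConnection_iterate_add hJ N g h) n) b
  simp only [conjNormal, hadd, h1, hmul]

theorem exists_represents_flatSeq [CharZero K] (hΘ : M.IsFundamentalSolution Θ) (f : JetFn K ι) (w : ℕ) :
    ∃ F, Represents (JetQuot K ι w) (M.flatSeq Θ f) F := by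
  obtain ⟨S, hS⟩ := exists_represents_σ (M := M) (A := JetQuot K ι w) f
  exact ⟨_, represents_flatSeq hΘ hS⟩

/-- The terms of the residue of `:η(Φ(-z), z δ̃_z^N Φ(z)):`, conjugated by `Z₀`. -/
theorem formalSum_conjNormal [CharZero K] (hΘ : M.IsSymmetricFundamentalSolution Θ)
    (ht : M.IsFlatGeneratingFunction Θ t) {k : ℤ} (hk : -1 ≤ k) (f : HSeries K ι) (j : ℤ) :
    JetSummable (fun m : ℤ => ((-1 : K) ^ m) • ∑ a, ∑ b, M.η⁻¹ a b •
      (zConnection (M.deltaTildeCoeff Θ))^[(k + 1).toNat]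
        (fun n c => M.conjNormal Θ t m a n c f j) (-2 - m) b) ∧
    formalSum (fun m : ℤ => ((-1 : K) ^ m) • ∑ a, ∑ b, M.η⁻¹ a b •
      (zConnection (M.deltaTildeCoeff Θ))^[(k + 1).toNat]
        (fun n c => M.conjNormal Θ t m a n c f j) (-2 - m) b) =
      (2 : K) • M.secondOrder k (f (j - 2)) + (2 : K) • M.virasoroField Θ t k (f (j - 1)) +
        f (j - 1) * ((2 : K) • pullback (M.H k) +
          (if k = 0 then (1 / 2 : K) * (M.μ ^ 2 - (1 / 4 : K) • 1).trace else 0) • 1) := by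
  obtain ⟨J, hJ⟩ := exists_deltaTildeCoeff_eq_zero hΘ.2.1
  have hτ : ∀ w, ∃ F, Represents (JetQuot K ι w) (M.coordSeq t) F := fun w =>
    let ⟨_, _, h⟩ := exists_represents_coordSeq hΘ ht w
    ⟨_, h⟩
  have hit : ∀ {g : ℤ → ι → JetFn K ι}, (∀ w, ∃ F, Represents (JetQuot K ι w) g F) → ∀ w, ∃ F,
      Represents (JetQuot K ι w) ((zConnection (M.deltaTildeCoeff Θ))^[(k + 1).toNat] g) F :=
    fun h w => let ⟨_, hF⟩ := h w
      ⟨_, hF.zConnection_iterate hJ _⟩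
  have hfl := fun f => exists_represents_flatSeq hΘ.1 (K := K) (M := M) (Θ := Θ) f
  -- The two terms in which `∂_{m,a}` acts from the left are finite sums over `m`: they need `m ≥
  -- 0`, and `δ̃^{k+1}` lowers the degree of a power series by at most `k + 1`.
  have hfin : ∀ x : ℤ → ι → ι → JetFn K ι,
      (∀ m : ℤ, m < 0 ∨ ((k + 1).toNat : ℤ) < m + 2 → ∀ a b, x m a b = 0) →
      JetSummable fun m : ℤ => ((-1 : K) ^ m) • ∑ a, ∑ b, M.η⁻¹ a b • x m a b := fun x hx => by
    refine jetSummable_of_finite ((Set.finite_Icc (0 : ℤ) (k + 1).toNat).subset fun m hm => ?_)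
    by_contra hlt
    refine hm ?_
    rw [Set.mem_Icc, not_and_or, not_le, not_le] at hlt
    dsimp only
    rw [Finset.sum_eq_zero fun a _ => Finset.sum_eq_zero fun b _ => by
      rw [hx m (by omega), smul_zero], smul_zero]
  have s1 := hfin (fun m a b => if 0 ≤ m then M.flatField Θ m.toNat a
      ((zConnection (M.deltaTildeCoeff Θ))^[(k + 1).toNat] (M.flatSeq Θ (f (j - 2))) (-2 - m) b)
      else 0) fun m hm a b => by
    split_ifs with h
    · rw [zConnection_iterate_eq_zero hJ (B := 0) (fun n hn c => flatSeq_of_neg hn c _) _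
        (by omega), ← M.flatD_apply hΘ.1, map_zero]
    · rfl
  have s4 := hfin (fun m a b => (zConnection (M.deltaTildeCoeff Θ))^[(k + 1).toNat] (fun n c =>
      if 0 ≤ m ∧ 0 ≤ n then M.flatField Θ m.toNat a (M.coordSeq t n c) else 0) (-2 - m) b)
    fun m hm a b => by
      rcases hm with hm | hm
      · exact zConnection_iterate_eq_zero hJ (B := (k + 1).toNat - 1 - m) (fun n _ c => if_neg (by omega)) _
          (by omega) b
      · exact zConnection_iterate_eq_zero hJ (B := 0) (fun n _ c => if_neg (by omega)) _
          (by omega) b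
  -- The three terms containing an undifferentiated coordinate series may be infinite sums, so their
  -- convergence is taken from the weight filtration.
  have s2 := jetSummable_pairRes (M := M) (hfl (f (j - 1))) (hit hτ)
  have s3 := jetSummable_pairRes (M := M) hτ (hit (hfl (f (j - 1))))
  have s5 := jetSummable_pairRes (M := M) hτ (hit hτ)
  have s4' := s4.mul_left fun _ => f (j - 1)
  have s5' := s5.mul_left fun _ => f j
  have hlin : ∀ (m : ℤ) (x y u v w : ι → ι → JetFn K ι) (c d : JetFn K ι),
      ((-1 : K) ^ m) • ∑ a, ∑ b, M.η⁻¹ a b • (x a b + y a b + u a b + c * v a b + d * w a b) =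
        ((-1 : K) ^ m) • ∑ a, ∑ b, M.η⁻¹ a b • x a b +
        ((-1 : K) ^ m) • ∑ a, ∑ b, M.η⁻¹ a b • y a b +
        ((-1 : K) ^ m) • ∑ a, ∑ b, M.η⁻¹ a b • u a b +
        c * (((-1 : K) ^ m) • ∑ a, ∑ b, M.η⁻¹ a b • v a b) +
        d * (((-1 : K) ^ m) • ∑ a, ∑ b, M.η⁻¹ a b • w a b) := fun m x y u v w c d => by
    simp only [smul_add, Finset.sum_add_distrib, mul_smul_comm, Finset.mul_sum]
  simp only [zConnection_iterate_conjNormal hΘ]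
  have e := funext fun m : ℤ => hlin m
    (fun a b => if 0 ≤ m then M.flatField Θ m.toNat a
      ((zConnection (M.deltaTildeCoeff Θ))^[(k + 1).toNat] (M.flatSeq Θ (f (j - 2))) (-2 - m) b)
      else 0)
    (fun a b => M.flatSeq Θ (f (j - 1)) m a *
      (zConnection (M.deltaTildeCoeff Θ))^[(k + 1).toNat] (M.coordSeq t) (-2 - m) b)
    (fun a b => M.coordSeq t m a *
      (zConnection (M.deltaTildeCoeff Θ))^[(k + 1).toNat] (M.flatSeq Θ (f (j - 1))) (-2 - m) b)
    (fun a b => (zConnection (M.deltaTildeCoeff Θ))^[(k + 1).toNat] (fun n c =>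
      if 0 ≤ m ∧ 0 ≤ n then M.flatField Θ m.toNat a (M.coordSeq t n c) else 0) (-2 - m) b)
    (fun a b => M.coordSeq t m a *
      (zConnection (M.deltaTildeCoeff Θ))^[(k + 1).toNat] (M.coordSeq t) (-2 - m) b)
    (f (j - 1)) (f j)
  rw [e]
  refine ⟨(((s1.add s2).add s3).add s4').add s5', ?_⟩
  rw [formalSum_add (((s1.add s2).add s3).add s4') s5', formalSum_add ((s1.add s2).add s3) s4',
    formalSum_add (s1.add s2) s3, formalSum_add s1 s2, mul_formalSum _ s4, mul_formalSum _ s5,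
    formalSum_flatField_flatSeq hΘ, formalSum_flatField_coordSeq hΘ ht hk]
  have h2 := pairRes_flatSeq_coordSeq hΘ ht k (f (j - 1))
  have h3 := pairRes_coordSeq_flatSeq hΘ ht k (f (j - 1))
  have h5 := pairRes_coordSeq_coordSeq hΘ ht (k + 1).toNat
  rw [pairRes] at h2 h3 h5
  rw [h2, h3, h5, mul_zero, add_zero, add_assoc (_ • _), ← two_smul K (M.virasoroField Θ t k _)]

theorem zConnection_iterate_flatSeq_zero [CharZero K] (hΘ : M.IsSymmetricFundamentalSolution Θ) (N : ℕ) (n : ℤ)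
    (b : ι) : (zConnection (M.deltaTildeCoeff Θ))^[N] (M.flatSeq Θ 0) n b = 0 := by
  obtain ⟨J, hJ⟩ := exists_deltaTildeCoeff_eq_zero hΘ.2.1
  exact zConnection_iterate_eq_zero hJ (B := n + N + 1) (fun n _ c => flatSeq_zero hΘ.1 n c) N
    (by omega) b

theorem virasoroField_zero [CharZero K] (hΘ : M.IsSymmetricFundamentalSolution Θ)
    (ht : M.IsFlatGeneratingFunction Θ t) (k : ℤ) : M.virasoroField Θ t k 0 = 0 := by
  rw [← pairRes_flatSeq_coordSeq hΘ ht, pairRes, formalSum_eq_sum ∅, Finset.sum_empty]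
  intro m _
  simp only [flatSeq_zero hΘ.1, zero_mul, smul_zero, Finset.sum_const_zero]

theorem secondOrder_zero [CharZero K] (hΘ : M.IsSymmetricFundamentalSolution Θ) (k : ℤ) :
    M.secondOrder k 0 = 0 := by
  refine (smul_eq_zero_iff_right (two_ne_zero (α := K))).mp ?_
  rw [← formalSum_flatField_flatSeq hΘ, formalSum_eq_sum ∅, Finset.sum_empty]
  intro m _
  simp only [zConnection_iterate_flatSeq_zero hΘ, ← M.flatD_apply hΘ.1, map_zero, ite_self,
    smul_zero, Finset.sum_const_zero]

/-- A conjugated quadratic expression raises the power of `ħ` by at most two. So `L` terms of the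
exponential suffice for all `m` simultaneously, and the sum over `p` can be exchanged with the
formal sum over `m`. -/
theorem residueQuadratic_expMul [CharZero K] (hΘ : M.IsSymmetricFundamentalSolution Θ)
    (ht : M.IsFlatGeneratingFunction Θ t) (hF₀ : M.IsPotential Θ t F₀) {k : ℤ} (hk : -1 ≤ k)
    {f : HSeries K ι} {B : ℤ} (hf : ∀ i > B, f i = 0) {i : ℤ} {L : ℕ} (hL : B + 2 - i < L) :
    M.residueQuadratic Θ t k (expMul F₀ f) i = ∑ p ∈ Finset.range L, ((p.factorial : K)⁻¹) •
      (F₀ ^ p * ((2 : K) • M.secondOrder k (f (i + p - 2)) +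
        (2 : K) • M.virasoroField Θ t k (f (i + p - 1)) +
        f (i + p - 1) * ((2 : K) • pullback (M.H k) +
          (if k = 0 then (1 / 2 : K) * (M.μ ^ 2 - (1 / 4 : K) • 1).trace else 0) • 1))) := by
  obtain ⟨J, hJ⟩ := exists_deltaTildeCoeff_eq_zero hΘ.2.1
  have h1 : ∀ m a n b, (zConnection (M.deltaTildeCoeff Θ))^[(k + 1).toNat]
      (fun n c => M.normalOrder Θ t m a n c) n b (expMul F₀ f) i =
      ∑ p ∈ Finset.range L, ((p.factorial : K)⁻¹) • (F₀ ^ p *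
        (zConnection (M.deltaTildeCoeff Θ))^[(k + 1).toNat]
          (fun n c => M.conjNormal Θ t m a n c f (i + p)) n b) := fun m a n b => by
    -- On operators `zConnection` is defined through values. Evaluation at `Z₀ f` and the truncated
    -- exponential are both linear over functions, so it commutes with each of them.
    let ev : (HSeries K ι → HSeries K ι) →+ JetFn K ι :=
      { toFun := fun x => x (expMul F₀ f) i, map_zero' := rfl, map_add' := fun _ _ => rfl }
    let tr : HSeries K ι →+ JetFn K ι :=
      { toFun := fun g => ∑ p ∈ Finset.range L, ((p.factorial : K)⁻¹) • (F₀ ^ p * g (i + p))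
        map_zero' := by simp
        map_add' := fun g h => by
          simp only [Pi.add_apply, mul_add, smul_add, Finset.sum_add_distrib] }
    have hev := congrFun (congrFun (zConnection_iterate_map hJ ev (fun _ _ _ _ => rfl)
      (k + 1).toNat (fun n c => M.normalOrder Θ t m a n c)) n) b
    have htr := congrFun (congrFun (zConnection_iterate_map hJ tr (fun j c d v => by
        simp only [tr, AddMonoidHom.coe_mk, ZeroHom.coe_mk, Pi.smul_apply, smul_eq_mul,
          Finset.mul_sum, mul_smul_comm, mul_left_comm (F₀ ^ _)])
      (k + 1).toNat (fun n c => M.conjNormal Θ t m a n c f)) n) b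
    have he : (fun n c => ev (M.normalOrder Θ t m a n c)) =
        fun n c => tr (M.conjNormal Θ t m a n c f) := by
      funext n c
      change M.normalOrder Θ t m a n c (expMul F₀ f) i = _
      rw [normalOrder_expMul hΘ.1 hF₀ hf]
      exact expMul_eq_sum (conjNormal_eq_zero hΘ.1 hf m a n c) hL
    rw [he, htr] at hev
    refine hev.symm.trans ?_
    simp only [tr, AddMonoidHom.coe_mk, ZeroHom.coe_mk]
    refine Finset.sum_congr rfl fun p _ => ?_
    have hp := congrFun (congrFun (zConnection_iterate_map hJ
      (Pi.evalAddMonoidHom (fun _ : ℤ => JetFn K ι) (i + p)) (fun _ _ _ _ => rfl)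
      (k + 1).toNat (fun n c => M.conjNormal Θ t m a n c f)) n) b
    exact congrArg (fun x => ((p.factorial : K)⁻¹) • (F₀ ^ p * x)) hp.symm
  have h2 : ∀ m : ℤ, ((-1 : K) ^ m) • ∑ a, ∑ b, M.η⁻¹ a b •
      (zConnection (M.deltaTildeCoeff Θ))^[(k + 1).toNat]
        (fun n c => M.normalOrder Θ t m a n c) (-2 - m) b (expMul F₀ f) i =
      ∑ p ∈ Finset.range L, (((p.factorial : K)⁻¹) • F₀ ^ p) *
        (((-1 : K) ^ m) • ∑ a, ∑ b, M.η⁻¹ a b •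
          (zConnection (M.deltaTildeCoeff Θ))^[(k + 1).toNat]
            (fun n c => M.conjNormal Θ t m a n c f (i + p)) (-2 - m) b) := fun m => by
    simp only [h1, Finset.smul_sum, Finset.mul_sum]
    rw [Finset.sum_comm (s := Finset.range L)]
    refine Finset.sum_congr rfl fun a _ => ?_
    rw [Finset.sum_comm (s := Finset.range L)]
    refine Finset.sum_congr rfl fun b _ => Finset.sum_congr rfl fun p _ => ?_
    rw [mul_smul_comm, mul_smul_comm, smul_mul_assoc]
  rw [residueQuadratic]
  simp only [h2]
  rw [formalSum_finsetSum _ fun p _ => (formalSum_conjNormal hΘ ht hk f _).1.mul_left _]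
  refine Finset.sum_congr rfl fun p _ => ?_
  rw [mul_formalSum _ (formalSum_conjNormal hΘ ht hk f _).1, (formalSum_conjNormal hΘ ht hk f _).2,
    smul_mul_assoc]

/-- Conjugation of the Virasoro operators by the genus zero partition function. -/
theorem virasoro_expMul [CharZero K] (hΘ : M.IsSymmetricFundamentalSolution Θ)
    (ht : M.IsFlatGeneratingFunction Θ t) (hF₀ : M.IsPotential Θ t F₀) {k : ℤ} (hk : -1 ≤ k)
    {f : HSeries K ι} {B : ℤ} (hf : ∀ i > B, f i = 0) :
    M.virasoro Θ t k (expMul F₀ f) =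
      expMul F₀ (fun i => M.secondOrder k (f (i - 1)) + M.virasoroField Θ t k (f i) +
        pullback (M.H k) * f i) := by
  funext i
  have hL : B + 2 - i < ((B + 2 - i).toNat + 1 : ℕ) := by omega
  rw [virasoro, residueQuadratic_expMul (i := i + 1) (L := (B + 2 - i).toNat + 1) hΘ ht hF₀ hk hf (by omega),
    expMul_eq_sum hf (by omega : B - i < ((B + 2 - i).toNat + 1 : ℕ)),
    expMul_eq_sum (B := B + 1) (fun j hj => by
      rw [hf j (by omega), hf (j - 1) (by omega), virasoroField_zero hΘ ht, secondOrder_zero hΘ, mul_zero,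
        add_zero, add_zero]) (by omega : B + 1 - i < ((B + 2 - i).toNat + 1 : ℕ)),
    Finset.smul_sum, Finset.smul_sum, ← Finset.sum_sub_distrib]
  refine Finset.sum_congr rfl fun p _ => ?_
  rw [show i + 1 + (p : ℤ) - 2 = i + p - 1 by ring, show i + 1 + (p : ℤ) - 1 = i + p by ring,
    smul_comm _ ((p.factorial : K)⁻¹), smul_comm _ ((p.factorial : K)⁻¹), ← smul_sub]
  congr 1
  rw [← mul_smul_comm, ← mul_smul_comm, ← mul_sub]
  congr 1
  rw [mul_add, mul_smul_comm, mul_smul_comm, mul_one, mul_comm (f _)]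
  -- For `k = 0` half of the trace term `(1/2) Tr(μ² - 1/4)` cancels the central constant of `L_0`.
  split_ifs <;> module

end FrobeniusManifold

end JetFrobenius

end

open JetFrobenius in
theorem mainTheorem7 {K ι : Type*} [Field K] [CharZero K] [Fintype ι] [DecidableEq ι]
    (M : FrobeniusManifold K ι) (Θ : Matrix ι ι (PowerSeries (Fn K ι)))
    (hΘ : M.IsSymmetricFundamentalSolution Θ) (hnorm : M.IsNormalized Θ)
    (t : ℤ → ι → JetFn K ι) (ht : M.IsFlatGeneratingFunction Θ t)
    (F₀ : JetFn K ι) (hF₀ : M.IsPotential Θ t F₀)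
    (k : ℤ) (hk : -1 ≤ k)
    (f : HSeries K ι) (hf : ∃ B : ℤ, ∀ i > B, f i = 0) :
    M.virasoro Θ t k (expMul F₀ f) =
      expMul F₀ (fun i => M.secondOrder k (f (i - 1)) + M.virasoroField Θ t k (f i) +
        pullback (M.H k) * f i) := by
  obtain ⟨B, hB⟩ := hf
  exact FrobeniusManifold.virasoro_expMul hΘ ht hF₀ hk hB
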